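/- Units are such that a particle of momentum $p$ has kinetic energy $p^2$. Let $\rho>0$, $L=\rho^{-41/60}$, $\Lambda=[0,L]^3$ with periodic boundary conditions, $|\Lambda|=L^3=\rho^{-41/20}$, and $N=\rho|\Lambda|=\rho^{-21/20}$ (rounded down to an integer). Let $\beta=\beta(\rho)$ be a function of $\rho$ such that $\lim_{\rho\to0}\rho^{2/3}\beta(\rho)$ exists and lies in $(0,\infty)$. Put $\rho_c(\beta)=(4\pi\beta)^{-3/2}\zeta(3/2)$, $R=R[\beta]=\lim_{\rho\to0}\rho_c(\beta(\rho))/\rho$ and $[t]_+=\max\{t,0\}$. Let $$f_0(\rho,\beta)=\rho\mu+\frac{1}{(2\pi)^3\beta}\int_{\mathbb R^3}\ln\bigl(1-e^{-\beta(p^2-\mu)}\bigr)\,dp$$ be the free energy per volume of the ideal Bose gas in the thermodynamic limit, where $\mu=0$ if $\rho\ge\rho_c(\beta)$, and otherwise $\mu<0$ is determined by $\rho=(2\pi)^{-3}\int_{\mathbb R^3}(e^{\beta(p^2-\mu)}-1)^{-1}dp$. Let $\eta=1/200$, $\Lambda^*=(2\pi L^{-1}\mathbb Z)^3$, and $$P_0=\{0\},\quad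 P_I=\{p\in\Lambda^*:0<|p|<\rho^{1/3+\eta}\},\quad P_L=\{p\in\Lambda^*:\rho^{1/3+\eta}\le|p|\le\rho^{1/3-\eta}\}.$$ Let $M$ be the set of all $\alpha:\Lambda^*\to\{0,1,2,\dots\}$ supported in $P_0\cup P_I\cup P_L$ with $\sum_k\alpha(k)=N$ and $\alpha(k)\le\rho^{-3\eta}$ for all $k\in P_L$. For $\alpha\in M$ let $|\alpha\rangle$ be the normalized $N$-boson state with $\alpha(k)$ particles of momentum $k$ for each $k\in\Lambda^*$, and let $$N_\alpha=\alpha(0)^2+\sum_{u,v\in P_L\cup P_0,\ u\ne\pm v}2\,\alpha(u)\alpha(v)\qquad\text{(sum over ordered pairs)}.$$ Then for every $\rho>0$ there is a state (positive operator of trace one) $\Gamma_0=\Gamma_0(\rho)$ on the Fock space of $\Lambda$, of the form $$\Gamma_0=\sum_{\alpha\in M}g_\alpha|\alpha\rangle\langle\alpha|,\qquad g_\alpha\in\mathbb R,\qquad\sum_{\alpha\in M}g_\alpha=1,$$ such that the following two assertions hold. (1) For every smooth, compactly supported, spherically symmetric $V:\mathbb R^3\to[0,\infty)$, with $V_0=\int_{\mathbb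 R^3}V(x)\,dx$, with $H_N$ the restriction to $N$ particles of the periodic Hamiltonian $$H=\sum_{p}p^2a_p^\dagger a_p+\frac1{|\Lambda|}\sum_{p,q,u}\frac{\widehat V_u}{2}a_p^\dagger a_q^\dagger a_{p-u}a_{q+u},\qquad \widehat V_u=\int_{[-L/2,L/2]^3}e^{-iu\cdot x}V(x)\,dx$$ (momentum sums over $\Lambda^*$), and with $S(\Gamma)=-\operatorname{Tr}\Gamma\ln\Gamma$, $$\limsup_{\rho\to0}\Bigl(\frac1{|\Lambda|}\operatorname{Tr}H_N\Gamma_0-\frac1{|\Lambda|\beta}S(\Gamma_0)-f_0(\rho,\beta)\Bigr)\rho^{-2}\le\frac12V_0\bigl(2-[1-R]_+^2\bigr).$$ (2) $\displaystyle\lim_{\rho\to0}\sum_{\alpha\in M}N^{-2}N_\alpha g_\alpha=2-[1-R]_+^2.$ -/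

import Mathlib

open Filter Topology
open scoped ContDiff

namespace BoseGas

/-- Physical space, and also the space of momenta. -/
abbrev Space := EuclideanSpace ℝ (Fin 3)

/-! ### Ideal Bose gas in the thermodynamic limit -/

/-- The critical density `ρ_c(β) = (4πβ)^{-3/2} ζ(3/2)`. -/
noncomputable def criticalDensity (β : ℝ) : ℝ :=
  (4 * Real.pi * β) ^ (-(3 / 2) : ℝ) * (riemannZeta (3 / 2)).re

/-- The density `(2π)^{-3} ∫ (e^{β(p² - μ)} - 1)⁻¹ dp` of the ideal gas at chemical potential
`μ < 0`. -/
noncomputable def idealDensity (μ β : ℝ) : ℝ :=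
  1 / (2 * Real.pi) ^ 3 * ∫ p : Space, 1 / (Real.exp (β * (‖p‖ ^ 2 - μ)) - 1)

open Classical in
/-- The chemical potential `μ(ρ, β)`: it is `0` for `ρ ≥ ρ_c(β)`, and for `ρ < ρ_c(β)` it is the
unique `μ < 0` at which the ideal gas has density `ρ`. -/
noncomputable def chemicalPotential (ρ β : ℝ) : ℝ :=
  if criticalDensity β ≤ ρ then 0
  else Classical.epsilon fun μ : ℝ => μ < 0 ∧ ρ = idealDensity μ β

/-- The free energy per volume `f₀(ρ, β)` of the ideal Bose gas in the thermodynamic limit (for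
`ρ ≥ ρ_c(β)` the chemical potential, hence the first term, vanishes). -/
noncomputable def idealFreeEnergy (ρ β : ℝ) : ℝ :=
  ρ * chemicalPotential ρ β +
    1 / ((2 * Real.pi) ^ 3 * β) *
      ∫ p : Space, Real.log (1 - Real.exp (-β * (‖p‖ ^ 2 - chemicalPotential ρ β)))

/-! ### Bosonic Fock space over the torus of side `L`, in the occupation number representation -/

/-- Labels of the momenta `p ∈ Λ* = (2π/L) ℤ³`. -/
abbrev Mode := Fin 3 → ℤ

/-- The momentum `2πn/L ∈ Λ*` with label `n`. -/
noncomputable def momentum (L : ℝ) (n : Mode) : Space :=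
  WithLp.toLp 2 fun i => 2 * Real.pi / L * (n i : ℝ)

/-- Occupation numbers `α : Λ* → ℕ` with finitely many particles in total. -/
abbrev Occ := Mode →₀ ℕ

/-- The bosonic Fock space `⨁_N H_{N,Λ}`: square summable amplitudes of the occupation numbers. The
`N`-particle space `H_{N,Λ}` consists of the vectors supported on the `α` with `∑ α(k) = N`. -/
def Fock : Type := lp (fun _ : Occ => ℂ) 2

noncomputable instance : NormedAddCommGroup Fock :=
  inferInstanceAs (NormedAddCommGroup (lp (fun _ : Occ => ℂ) 2))

noncomputable instance : InnerProductSpace ℂ Fock :=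
  inferInstanceAs (InnerProductSpace ℂ (lp (fun _ : Occ => ℂ) 2))

instance : CompleteSpace Fock :=
  inferInstanceAs (CompleteSpace (lp (fun _ : Occ => ℂ) 2))

/-- The normalized vector `|α⟩`. -/
noncomputable def ket (α : Occ) : Fock :=
  (lp.single 2 α (1 : ℂ) : lp (fun _ : Occ => ℂ) 2)

/-- The amplitudes `⟨α|ψ⟩` of a vector `ψ` of Fock space. -/
noncomputable def amplitude (ψ : Fock) : Occ → ℂ := fun α => inner ℂ (ket α) ψ

/-- The annihilation operator `a_k`, acting on arbitrary amplitude functions: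
`a_k |α⟩ = √α(k) |α - δ_k⟩`. -/
noncomputable def annihilate (k : Mode) : (Occ → ℂ) →ₗ[ℂ] (Occ → ℂ) where
  toFun ψ α := (Real.sqrt (α k + 1) : ℂ) * ψ (α + Finsupp.single k 1)
  map_add' ψ φ := by ext α; simp [mul_add]
  map_smul' c ψ := by ext α; simp [mul_left_comm]

/-- The creation operator `a_k†`, acting on arbitrary amplitude functions:
`a_k† |α⟩ = √(α(k) + 1) |α + δ_k⟩`. -/
noncomputable def create (k : Mode) : (Occ → ℂ) →ₗ[ℂ] (Occ → ℂ) where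
  toFun ψ α := (Real.sqrt (α k) : ℂ) * ψ (α - Finsupp.single k 1)
  map_add' ψ φ := by ext α; simp [mul_add]
  map_smul' c ψ := by ext α; simp [mul_left_comm]

/-- The Fourier coefficient `V̂_p = ∫_Λ e^{-ip·x} V(x) dx`, `p = 2πn/L`, of the interaction on the
torus; the fundamental domain is centred at `0`, where `|x|` is the distance of `x` and `0` on the
torus. -/
noncomputable def fourierCoeff (L : ℝ) (V : Space → ℝ) (n : Mode) : ℂ :=
  ∫ x in {x : Space | ∀ i, |x i| ≤ L / 2},
    Complex.exp (-Complex.I * (inner ℝ (momentum L n) x : ℝ)) * (V x : ℂ)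

/-- The Hamiltonian with periodic boundary conditions on the box of side `L`,
`H = ∑_p p² a_p† a_p + |Λ|⁻¹ ∑_{p,q,u} (V̂_u / 2) a_p† a_q† a_{p-u} a_{q+u}`,
whose restriction to the `N`-particle space is `H_N`. On a vector with finitely many non-zero
amplitudes, both sums have finitely many non-zero terms in each component. -/
noncomputable def hamiltonian (L : ℝ) (V : Space → ℝ) (ψ : Occ → ℂ) : Occ → ℂ := fun γ =>
  (∑' p : Mode, ((‖momentum L p‖ ^ 2 : ℝ) : ℂ) * create p (annihilate p ψ) γ) +
    1 / (L : ℂ) ^ 3 * ∑' x : Mode × Mode × Mode,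
      fourierCoeff L V x.2.2 / 2 *
        create x.1 (create x.2.1 (annihilate (x.1 - x.2.2) (annihilate (x.2.1 + x.2.2) ψ))) γ

/-- The trace of an operator on Fock space, `Tr T = ∑_γ ⟨γ|T|γ⟩`. -/
noncomputable def trace (T : Fock →L[ℂ] Fock) : ℂ := ∑' γ : Occ, inner ℂ (ket γ) (T (ket γ))

/-- `Γ` is a state: a positive operator with trace one. -/
def IsState (Γ : Fock →L[ℂ] Fock) : Prop :=
  Γ.IsPositive ∧ HasSum (fun γ : Occ => inner ℂ (ket γ) (Γ (ket γ))) 1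

/-- The energy `Tr H Γ = ∑_γ ⟨γ|H Γ|γ⟩`. -/
noncomputable def energy (L : ℝ) (V : Space → ℝ) (Γ : Fock →L[ℂ] Fock) : ℝ :=
  (∑' γ : Occ, hamiltonian L V (amplitude (Γ (ket γ))) γ).re

/-- The von Neumann entropy `S(Γ) = -Tr Γ ln Γ`, through the continuous functional calculus of the
self-adjoint operator `Γ` applied to `t ↦ -t ln t`. -/
noncomputable def entropy (Γ : Fock →L[ℂ] Fock) : ℝ := (trace (cfc Real.negMulLog Γ)).re

/-! ### Choice of the box and of the momentum regions -/

/-- The side length `L = ρ^{-41/60}` of the box `Λ`, so that `|Λ| = ρ^{-41/20}`. -/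
noncomputable def boxSide (ρ : ℝ) : ℝ := ρ ^ (-(41 / 60) : ℝ)

/-- The number of particles `N = ρ |Λ| = ρ^{-21/20}`, rounded down to an integer. -/
noncomputable def particleNumber (ρ : ℝ) : ℕ := ⌊ρ ^ (-(21 / 20) : ℝ)⌋₊

/-- The exponent `η = 1/200`. -/
noncomputable def eta : ℝ := 1 / 200

/-- The common value `ρ^η` of the four cutoff parameters `ε_L, η_L, ε_H, η_H`. -/
noncomputable def cutoff (ρ : ℝ) : ℝ := ρ ^ eta

/-- `P₀ = {0}`. -/
def P0 : Set Mode := {0}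

/-- `P_I = {p : 0 < |p| < ε_L ρ^{1/3}}`. -/
def PI (ρ : ℝ) : Set Mode :=
  {n | 0 < ‖momentum (boxSide ρ) n‖ ∧ ‖momentum (boxSide ρ) n‖ < cutoff ρ * ρ ^ (1 / 3 : ℝ)}

/-- `P_L = {p : ε_L ρ^{1/3} ≤ |p| ≤ η_L⁻¹ ρ^{1/3}}`. -/
def PL (ρ : ℝ) : Set Mode :=
  {n | cutoff ρ * ρ ^ (1 / 3 : ℝ) ≤ ‖momentum (boxSide ρ) n‖ ∧
    ‖momentum (boxSide ρ) n‖ ≤ (cutoff ρ)⁻¹ * ρ ^ (1 / 3 : ℝ)}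

/-- `P_H = {p : ε_H ≤ |p| ≤ η_H⁻¹}`. -/
def PH (ρ : ℝ) : Set Mode :=
  {n | cutoff ρ ≤ ‖momentum (boxSide ρ) n‖ ∧ ‖momentum (boxSide ρ) n‖ ≤ (cutoff ρ)⁻¹}

/-- The maximal occupation number `m_c = ρ^{-3η}` of a momentum in `P_L`. -/
noncomputable def mc (ρ : ℝ) : ℝ := ρ ^ (-(3 * eta))

/-- `M̃`: the occupation numbers of `N` particles with momenta in `P = P₀ ∪ P_L ∪ P_I ∪ P_H`. -/
def MTilde (ρ : ℝ) : Set Occ :=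
  {α | (α.support : Set Mode) ⊆ P0 ∪ PL ρ ∪ PI ρ ∪ PH ρ ∧
    (α.sum fun _ m => m) = particleNumber ρ}

/-- `M`: the members of `M̃` that are supported in `P₀ ∪ P_I ∪ P_L` and have occupation numbers at
most `m_c` on `P_L`. -/
def M (ρ : ℝ) : Set Occ :=
  {α | α ∈ MTilde ρ ∧ (α.support : Set Mode) ⊆ P0 ∪ PI ρ ∪ PL ρ ∧
    ∀ k ∈ PL ρ, (α k : ℝ) ≤ mc ρ}

/-- There are finitely many momenta in a ball. -/
theorem finite_modes (L K : ℝ) (hL : 0 < L) : {n : Mode | ‖momentum L n‖ ≤ K}.Finite := by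
  apply Set.Finite.subset (Set.Finite.pi' (fun _ : Fin 3 => Set.finite_Icc (-⌈K*L⌉) ⌈K*L⌉))
  intro n hn i
  have h1 : ‖momentum L n i‖ ≤ K := (PiLp.norm_apply_le _ i).trans hn
  simp only [momentum, norm_mul, norm_div, Real.norm_eq_abs, abs_of_pos hL, abs_of_pos Real.pi_pos, abs_two] at h1
  have h2 : |(n i : ℝ)| ≤ K * L := by
    rw [div_mul_eq_mul_div, div_le_iff₀ hL] at h1
    have := abs_nonneg (n i : ℝ)
    nlinarith [Real.pi_gt_three]
  have h3 := abs_le.1 h2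
  have h4 := Int.le_ceil (K*L)
  constructor
  · have : (-(⌈K*L⌉:ℝ)) ≤ n i := by linarith
    exact_mod_cast this
  · have : (n i : ℝ) ≤ ⌈K*L⌉ := by linarith
    exact_mod_cast this

/-- `M` is finite, so that the sums over `M` below are finite sums. -/
theorem finite_M (ρ : ℝ) (hρ : 0 < ρ) : (M ρ).Finite := by
  classical
  have hL : 0 < boxSide ρ := by unfold boxSide; positivity
  have hF : (P0 ∪ PI ρ ∪ PL ρ).Finite := by
    refine ((Set.finite_singleton _).union ?_).union ?_
    · exact (finite_modes _ _ hL).subset fun n hn => hn.2.le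
    · exact (finite_modes _ _ hL).subset fun n hn => hn.2
  apply Set.Finite.subset (Finset.finite_toSet (hF.toFinset.finsuppAntidiag (particleNumber ρ)))
  intro α hα
  simp only [Finset.mem_coe, Finset.mem_finsuppAntidiag']
  refine ⟨hα.1.2, fun k hk => ?_⟩
  simpa using hα.2.1 hk

/-- `N_α = α(0)² + ∑_{u,v ∈ P_L ∪ P₀, u ≠ ±v} 2 α(u) α(v)`, the sum being over ordered pairs. -/
noncomputable def pairNumber (ρ : ℝ) (α : Occ) : ℝ :=
  (α 0 : ℝ) * α 0 +
    ∑ᶠ (x : Mode × Mode) (_ : x.1 ∈ PL ρ ∪ P0 ∧ x.2 ∈ PL ρ ∪ P0 ∧ x.1 ≠ x.2 ∧ x.1 ≠ -x.2),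
      2 * (α x.1 : ℝ) * (α x.2 : ℝ)

/-- The diagonal operator `∑_{α ∈ M} g_α |α⟩⟨α|` (a finite sum). -/
noncomputable def diagonal (ρ : ℝ) (g : Occ → ℝ) : Fock →L[ℂ] Fock :=
  ∑ᶠ α ∈ M ρ, (g α : ℂ) • InnerProductSpace.rankOne ℂ (ket α) (ket α)

end BoseGas

open BoseGas

namespace BoseGas

/-! ### Diagonal operators on Fock space -/

/-! The trial state is the Gibbs state of the kinetic energy on a finite set S ⊆ M of typical
occupation numbers: the excited modes lie in P_I ∪ P_L, the number of excited particles is within a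
width w of a prescribed mean, few particles are in P_I, and the rest have momentum 0.

Free part. For Gibbs weights, kinetic energy minus entropy/β is exactly -ln Z_S / β
(`gibbs_free_energy_le`). Grand-canonically, the excited modes are independent truncated geometric
variables of fugacity e^{y - a|n|²}, with a = β(2π/L)² and y ≤ 0. Chebyshev and Markov show that S
keeps at least half of their partition function (`half_prod_le_sum_filter`,
`Cutoffs.exists_typical`). Poisson summation compares its logarithm with the pressure of the
infinite gas, up to a surface term (`Cutoffs.le_sum_log_truncZ`). Since f₀ is a Legendre transform,
the same y gives a lower bound on it (`le_idealFreeEnergy`); the pressures cancel, and what remains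
is -y times a mismatch of particle numbers, plus errors.

Interaction. On a diagonal state only the direct and exchange terms survive; they are at most V₀(2N²
- α(0)²)/2 (`re_hamiltonian_ket_le`). Likewise N_α is 2N² - α(0)² up to o(N²)
(`abs_pairNumber_sub_le`). Both assertions thus reduce to α(0)/N → [1-R]_+ on S. To get this, y is
chosen so that the mean excited number is the smaller of N - w and its value at y = 0
(`Cutoffs.exists_meanNumber_eq`); the latter is asymptotic to RN (`tendsto_latticeNumber_div`).

Scales. Here a is of order ρ^{7/10}, so the fluctuations w ~ 1/a are of order ρ^{-42/60}. This is
small against N = ρ^{-63/60} and against ρ^{-43/60}, the error in ln Z that an energy density of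
order ρ² tolerates. -/

theorem aeval_apply_of_eigenvector {E : Type*} [NormedAddCommGroup E] [InnerProductSpace ℂ E]
    (T : E →L[ℂ] E) (v : E) (l : ℝ) (h : T v = (l : ℂ) • v) (p : Polynomial ℝ) :
    (Polynomial.aeval T p) v = ((p.eval l : ℝ) : ℂ) • v := by
  have hpow : ∀ n : ℕ, (T ^ n) v = ((l : ℂ) ^ n) • v := by
    intro n
    induction n with
    | zero => simp
    | succ n ih => rw [pow_succ', mul_apply_eq_comp, ih, map_smul, h, smul_smul, pow_succ]
  induction p using Polynomial.induction_on' with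
  | add p q hp hq => simp [hp, hq, add_smul]
  | monomial n a =>
    rw [Polynomial.aeval_monomial, Polynomial.eval_monomial, mul_apply_eq_comp, hpow,
      Algebra.algebraMap_eq_smul_one, smul_apply, one_apply_eq_self]
    push_cast
    rw [← smul_smul]
    rfl

/-- A polynomial in T acts on v by its value at l. Polynomials uniformly close to f on an interval
containing l and the spectrum of T transfer this to f. It is what evaluates the entropy of a
diagonal operator. -/
theorem cfc_apply_of_eigenvector {E : Type*} [NormedAddCommGroup E] [InnerProductSpace ℂ E]
    [CompleteSpace E] (T : E →L[ℂ] E) (hT : IsSelfAdjoint T) (v : E) (l : ℝ)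
    (h : T v = (l : ℂ) • v) (f : ℝ → ℝ) (hf : Continuous f) :
    cfc f T v = ((f l : ℝ) : ℂ) • v := by
  rw [← sub_eq_zero, ← norm_le_zero_iff]
  refine le_of_forall_pos_le_add fun ε hε => ?_
  set B := max |l| (‖T‖ * ‖(1 : E →L[ℂ] E)‖)
  obtain ⟨p, hp⟩ := exists_polynomial_near_of_continuousOn (-B) B f hf.continuousOn
    (ε / (2 * (‖v‖ + 1))) (by positivity)
  have hl := hp l (abs_le.1 (le_max_left _ _))
  have h1 : ‖cfc (fun x => p.eval x - f x) T‖ ≤ ε / (2 * (‖v‖ + 1)) := by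
    refine norm_cfc_le (by positivity) fun x hx => ?_
    have h3 := spectrum.norm_le_norm_mul_of_mem hx
    exact (hp x (abs_le.1 (h3.trans (le_max_right _ _)))).le
  rw [cfc_sub _ _ T p.continuous.continuousOn hf.continuousOn, cfc_polynomial p T hT] at h1
  have h2 : cfc f T v - ((f l : ℝ) : ℂ) • v =
      (((p.eval l - f l : ℝ)) : ℂ) • v - (Polynomial.aeval T p - cfc f T) v := by
    rw [sub_apply, aeval_apply_of_eigenvector T v l h p]
    push_cast
    rw [sub_smul]; abel
  rw [h2, zero_add]
  refine (norm_sub_le _ _).trans ?_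
  have h4 := (Polynomial.aeval T p - cfc f T).le_opNorm v
  rw [norm_smul, Complex.norm_real, Real.norm_eq_abs]
  have h5 : |p.eval l - f l| * ‖v‖ ≤ ε / (2 * (‖v‖ + 1)) * ‖v‖ := by gcongr
  have h6 : ‖Polynomial.aeval T p - cfc f T‖ * ‖v‖ ≤ ε / (2 * (‖v‖ + 1)) * ‖v‖ := by gcongr
  have h7 : ε / (2 * (‖v‖ + 1)) * ‖v‖ ≤ ε / 2 := by
    rw [div_mul_eq_mul_div, div_le_div_iff₀ (by positivity) (by positivity)]
    nlinarith
  linarith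

theorem inner_ket (α γ : Occ) : inner ℂ (ket α) (ket γ) = if α = γ then (1 : ℂ) else 0 := by
  classical
  have := lp.inner_single_left (𝕜 := ℂ) (G := fun _ : Occ => ℂ) α (1 : ℂ)
    (lp.single 2 γ (1 : ℂ) : lp (fun _ : Occ => ℂ) 2)
  refine Eq.trans this ?_
  rw [lp.single_apply]
  by_cases h : α = γ
  · subst h; simp
  · simp [h]

theorem diagonal_apply_ket (ρ : ℝ) (hρ : 0 < ρ) (g : Occ → ℝ) (γ : Occ) :
    diagonal ρ g (ket γ) = (((M ρ).indicator g γ : ℝ) : ℂ) • ket γ := by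
  classical
  have hd : diagonal ρ g = ∑ α ∈ (finite_M ρ hρ).toFinset,
      (g α : ℂ) • InnerProductSpace.rankOne ℂ (ket α) (ket α) := by
    rw [diagonal, finsum_mem_eq_finite_toFinset_sum _ (finite_M ρ hρ)]
  rw [hd, sum_apply]
  simp only [smul_apply, InnerProductSpace.rankOne_apply, inner_ket]
  by_cases h : γ ∈ M ρ
  · rw [Finset.sum_eq_single_of_mem γ (by simpa using h)]
    · simp [h]
    · intro b _ hb; simp [hb]
  · rw [Finset.sum_eq_zero]
    · simp [h]
    · intro b hb
      have : b ≠ γ := by rintro rfl; exact h (by simpa using hb)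
      simp [this]

theorem diagonal_isPositive (ρ : ℝ) (hρ : 0 < ρ) (g : Occ → ℝ) (hg : ∀ α, 0 ≤ g α) :
    (diagonal ρ g).IsPositive := by
  classical
  rw [diagonal, finsum_mem_eq_finite_toFinset_sum _ (finite_M ρ hρ)]
  refine Finset.sum_induction _ (fun T : Fock →L[ℂ] Fock => T.IsPositive)
    (fun _ _ => ContinuousLinearMap.IsPositive.add) ContinuousLinearMap.isPositive_zero ?_
  intro α _
  exact (InnerProductSpace.isPositive_rankOne_self (ket α)).smul_of_nonneg (by exact_mod_cast hg α)

theorem inner_diagonal (ρ : ℝ) (hρ : 0 < ρ) (g : Occ → ℝ) (γ : Occ) :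
    inner ℂ (ket γ) (diagonal ρ g (ket γ)) = (((M ρ).indicator g γ : ℝ) : ℂ) := by
  rw [diagonal_apply_ket ρ hρ, inner_smul_right, inner_ket]; simp

theorem diagonal_isState (ρ : ℝ) (hρ : 0 < ρ) (g : Occ → ℝ) (hg : ∀ α, 0 ≤ g α)
    (h1 : (∑ᶠ α ∈ M ρ, g α) = 1) : IsState (diagonal ρ g) := by
  classical
  refine ⟨diagonal_isPositive ρ hρ g hg, ?_⟩
  simp_rw [inner_diagonal ρ hρ]
  rw [finsum_mem_eq_finite_toFinset_sum _ (finite_M ρ hρ)] at h1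
  have : HasSum (fun γ => (M ρ).indicator g γ) 1 := by
    rw [← h1]
    have := hasSum_sum_of_ne_finset_zero (L := .unconditional Occ) (f := (M ρ).indicator g)
      (s := (finite_M ρ hρ).toFinset) (by intro b hb; simpa using fun h => absurd h (by simpa using hb))
    convert this using 1
    refine Finset.sum_congr rfl fun x hx => ?_
    rw [Set.indicator_of_mem (by simpa using hx)]
  have h2 := (Complex.hasSum_ofReal (f := (M ρ).indicator g)).2 this
  simpa using h2

theorem entropy_diagonal (ρ : ℝ) (hρ : 0 < ρ) (g : Occ → ℝ) (hg : ∀ α, 0 ≤ g α) :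
    entropy (diagonal ρ g) = ∑ α ∈ (finite_M ρ hρ).toFinset, Real.negMulLog (g α) := by
  classical
  have hsa := (diagonal_isPositive ρ hρ g hg).isSelfAdjoint
  unfold entropy trace
  have h : ∀ γ : Occ, inner ℂ (ket γ) (cfc Real.negMulLog (diagonal ρ g) (ket γ)) =
      ((Real.negMulLog ((M ρ).indicator g γ) : ℝ) : ℂ) := by
    intro γ
    rw [cfc_apply_of_eigenvector _ hsa _ _ (diagonal_apply_ket ρ hρ g γ) _
      Real.continuous_negMulLog, inner_smul_right, inner_ket]
    simp
  simp_rw [h]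
  rw [tsum_eq_sum (s := (finite_M ρ hρ).toFinset)]
  · rw [Complex.re_sum]
    refine Finset.sum_congr rfl fun x hx => ?_
    rw [Set.indicator_of_mem (by simpa using hx), Complex.ofReal_re]
  -- Off `M` the eigenvalue is 0, where `Real.negMulLog` vanishes.
  · intro b hb
    rw [Set.indicator_of_notMem (by simpa using hb)]; simp

theorem amplitude_diagonal (ρ : ℝ) (hρ : 0 < ρ) (g : Occ → ℝ) (γ : Occ) :
    amplitude (diagonal ρ g (ket γ)) =
      (((M ρ).indicator g γ : ℝ) : ℂ) • fun α => if α = γ then (1 : ℂ) else 0 := by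
  ext α
  rw [amplitude, diagonal_apply_ket ρ hρ, inner_smul_right, inner_ket]
  simp

theorem hamiltonian_smul (L : ℝ) (V : Space → ℝ) (c : ℂ) (ψ : Occ → ℂ) (γ : Occ) :
    hamiltonian L V (c • ψ) γ = c * hamiltonian L V ψ γ := by
  simp only [hamiltonian, map_smul, Pi.smul_apply, smul_eq_mul, mul_add]
  congr 1
  · rw [← tsum_mul_left]
    exact tsum_congr fun p => by ring
  · rw [mul_left_comm, ← tsum_mul_left (a := c)]
    congr 1
    exact tsum_congr fun p => by ring

theorem energy_diagonal (ρ : ℝ) (hρ : 0 < ρ) (g : Occ → ℝ) (L : ℝ) (V : Space → ℝ) :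
    energy L V (diagonal ρ g) = ∑ α ∈ (finite_M ρ hρ).toFinset,
      g α * (hamiltonian L V (fun γ => if γ = α then (1 : ℂ) else 0) α).re := by
  unfold energy
  simp_rw [amplitude_diagonal ρ hρ, hamiltonian_smul]
  rw [tsum_eq_sum (s := (finite_M ρ hρ).toFinset)]
  · rw [Complex.re_sum]
    refine Finset.sum_congr rfl fun x hx => ?_
    rw [Set.indicator_of_mem (by simpa using hx), Complex.re_ofReal_mul]
  · intro b hb
    rw [Set.indicator_of_notMem (by simpa using hb)]; simp


/-! ### Diagonal matrix elements of the Hamiltonian -/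

theorem norm_fourierCoeff_le (L : ℝ) (V : Space → ℝ) (hV : ∀ x, 0 ≤ V x)
    (hi : MeasureTheory.Integrable V) (n : Mode) : ‖fourierCoeff L V n‖ ≤ ∫ x, V x := by
  unfold fourierCoeff
  refine (MeasureTheory.norm_integral_le_integral_norm _).trans ?_
  have : ∀ x, ‖Complex.exp (-Complex.I * (inner ℝ (momentum L n) x : ℝ)) * (V x : ℂ)‖ = V x := by
    intro x
    rw [norm_mul, Complex.norm_exp, Complex.norm_real, Real.norm_of_nonneg (hV x)]
    simp
  simp_rw [this]
  exact MeasureTheory.setIntegral_le_integral hi (Eventually.of_forall hV)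

/-- The amplitudes of `|α⟩`. -/
noncomputable def ketAmplitude (α : Occ) : Occ → ℂ := fun γ => if γ = α then 1 else 0

theorem create_annihilate_ket (α : Occ) (p : Mode) :
    create p (annihilate p (ketAmplitude α)) α = (α p : ℂ) := by
  simp only [create, annihilate, LinearMap.coe_mk, AddHom.coe_mk, ketAmplitude]
  -- Subtraction of occupation numbers is truncated at 0; the factor √α(p) removes the case in which
  -- that matters.
  by_cases h : α p = 0
  · simp [h]
  · have hle : Finsupp.single p 1 ≤ α := by
      rw [Finsupp.single_le_iff]; omega
    rw [tsub_add_cancel_of_le hle, if_pos rfl]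
    have : (((α - Finsupp.single p 1 : Occ) p : ℕ) : ℝ) + 1 = α p := by
      rw [Finsupp.tsub_apply, Finsupp.single_eq_same]
      have : 1 ≤ α p := by omega
      push_cast [this]; ring
    rw [this, mul_one, ← Complex.ofReal_mul, Real.mul_self_sqrt (by positivity)]
    simp

theorem single_add_single_eq_iff (p q r s : Mode) :
    (Finsupp.single r 1 + Finsupp.single s 1 : Occ) = Finsupp.single p 1 + Finsupp.single q 1 ↔
      (r = p ∧ s = q) ∨ (r = q ∧ s = p) := by
  constructor
  · intro h
    have h1 := DFunLike.congr_fun h r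
    have h2 := DFunLike.congr_fun h p
    have h3 := DFunLike.congr_fun h q
    have h4 := DFunLike.congr_fun h s
    simp only [Finsupp.add_apply, Finsupp.single_apply] at h1 h2 h3 h4
    by_cases hrp : r = p
    · subst hrp
      left
      refine ⟨rfl, ?_⟩
      have := add_left_cancel h
      exact Finsupp.single_left_injective one_ne_zero this
    · right
      by_cases hrq : r = q
      · subst hrq
        refine ⟨rfl, ?_⟩
        rw [add_comm (Finsupp.single p 1)] at h
        exact Finsupp.single_left_injective one_ne_zero (add_left_cancel h)
      · have e1 : ¬ p = r := fun h => hrp h.symm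
        have e2 : ¬ q = r := fun h => hrq h.symm
        simp [e1, e2] at h1
  · rintro (⟨rfl, rfl⟩ | ⟨rfl, rfl⟩)
    · rfl
    · exact add_comm _ _

/-- The four operators lead back to α only if {p - u, q + u} = {p, q}: the direct term u = 0 and the
exchange term u = p - q. These coincide for p = q, where the coefficient is α(p)(α(p) - 1). -/
theorem quartic_ket (α : Occ) (p q u : Mode) :
    create p (create q (annihilate (p - u) (annihilate (q + u) (ketAmplitude α)))) α =
      if u = 0 ∨ u = p - q then ((α p * (α - Finsupp.single p 1 : Occ) q : ℕ) : ℂ) else 0 := by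
  simp only [create, annihilate, LinearMap.coe_mk, AddHom.coe_mk, ketAmplitude]
  by_cases h : α p = 0
  · simp [h]
  by_cases h' : (α - Finsupp.single p 1 : Occ) q = 0
  · simp [h']
  -- Both particles can be removed; in terms of the remainder γ no truncated subtraction is left.
  obtain ⟨γ, rfl⟩ : ∃ γ : Occ, α = γ + Finsupp.single q 1 + Finsupp.single p 1 := by
    refine ⟨α - Finsupp.single p 1 - Finsupp.single q 1, ?_⟩
    rw [tsub_add_cancel_of_le (Finsupp.single_le_iff.2 (by omega)),
      tsub_add_cancel_of_le (Finsupp.single_le_iff.2 (by omega))]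
  simp only [add_tsub_cancel_right]
  have key : (γ + Finsupp.single (p - u) 1 + Finsupp.single (q + u) 1 =
      γ + Finsupp.single q 1 + Finsupp.single p 1) ↔ (u = 0 ∨ u = p - q) := by
    rw [add_assoc, add_assoc, add_right_inj, single_add_single_eq_iff]
    constructor
    · rintro (⟨h1, _⟩ | ⟨h1, _⟩)
      · right; rw [← h1]; abel
      · left; exact sub_eq_self.1 h1
    · rintro (h1 | h1)
      · right; simp [h1]
      · left; simp [h1]
  by_cases hu : u = 0 ∨ u = p - q
  · rw [if_pos (key.2 hu), if_pos hu]
    have main : Real.sqrt (((γ + Finsupp.single q 1 + Finsupp.single p 1 : Occ) p : ℕ)) *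
        (Real.sqrt (((γ + Finsupp.single q 1 : Occ) q : ℕ)) *
        (Real.sqrt (((γ (p - u) : ℕ) : ℝ) + 1) *
        (Real.sqrt ((((γ + Finsupp.single (p - u) 1 : Occ) (q + u) : ℕ) : ℝ) + 1)))) =
        (((γ + Finsupp.single q 1 + Finsupp.single p 1 : Occ) p *
          (γ + Finsupp.single q 1 : Occ) q : ℕ) : ℝ) := by
      have hs : ∀ x : ℝ, 0 ≤ x → Real.sqrt x * Real.sqrt x = x := fun x hx => Real.mul_self_sqrt hx
      have a1 := hs (γ p + 1) (by positivity)
      have a2 := hs (γ q + 1) (by positivity)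
      have a3 := hs (γ p + 1 + 1) (by positivity)
      by_cases hpq : p = q
      · subst hpq
        have hu0 : u = 0 := by simpa using hu
        subst hu0
        simp only [Finsupp.add_apply, Finsupp.single_eq_same, sub_zero, add_zero]
        push_cast
        linear_combination (Real.sqrt (γ p + 1 + 1) * Real.sqrt (γ p + 1 + 1)) * a1 +
          (γ p + 1 : ℝ) * a3
      · have hqp : ¬ q = p := fun h => hpq h.symm
        rcases hu with rfl | rfl
        · simp only [Finsupp.add_apply, Finsupp.single_eq_same, sub_zero, add_zero,
            Finsupp.single_apply, hpq, hqp, if_false]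
          push_cast
          linear_combination (Real.sqrt (γ q + 1) * Real.sqrt (γ q + 1)) * a1 +
            (γ p + 1 : ℝ) * a2
        · simp only [Finsupp.add_apply, Finsupp.single_eq_same, sub_sub_cancel, add_sub_cancel,
            Finsupp.single_apply, hqp, if_false, add_zero]
          push_cast
          linear_combination (Real.sqrt (γ q + 1) * Real.sqrt (γ q + 1)) * a1 +
            (γ p + 1 : ℝ) * a2
    rw [mul_one, ← Complex.ofReal_mul, ← Complex.ofReal_mul, ← Complex.ofReal_mul, main]
    simp
  · rw [if_neg (fun h => hu (key.1 h)), if_neg hu]; simp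

/-- The kinetic energy of the occupation numbers `α`. -/
noncomputable def kinetic (L : ℝ) (α : Occ) : ℝ := α.sum fun p m => ‖momentum L p‖ ^ 2 * m

/-- For p ≠ q at most two values of u contribute, each at most α(p)α(q). For p = q they coincide,
which saves α(p)²; for p = 0 this saving is the condensate term -α(0)² of the energy bound. -/
theorem sum_quartic_le (α : Occ) (U : Finset Mode)
    (p q : Mode) :
    ∑ u ∈ U, (if u = 0 ∨ u = p - q then ((α p * (α - Finsupp.single p 1 : Occ) q : ℕ) : ℝ) else 0) ≤
      2 * (α p * α q) - if q = p then (α p : ℝ) * α p else 0 := by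
  classical
  rw [← Finset.sum_filter, Finset.sum_const, nsmul_eq_mul]
  by_cases h : q = p
  · subst h
    have hc : (U.filter fun u => u = 0 ∨ u = q - q).card ≤ 1 := by
      refine (Finset.card_le_card (t := {0}) fun u hu => ?_).trans (by simp)
      simpa using (Finset.mem_filter.1 hu).2
    have h1 : (α - Finsupp.single q 1 : Occ) q ≤ α q := by rw [Finsupp.tsub_apply]; omega
    have h2 : ((U.filter fun u => u = 0 ∨ u = q - q).card *
      (α q * (α - Finsupp.single q 1 : Occ) q)) ≤ 1 * (α q * α q) := by gcongr
    rw [if_pos rfl]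
    have h3 : (((U.filter fun u => u = 0 ∨ u = q - q).card : ℕ) : ℝ) *
      ((α q * (α - Finsupp.single q 1 : Occ) q : ℕ) : ℝ) ≤ α q * α q := by
      have := (Nat.cast_le (α := ℝ)).2 h2
      push_cast at this ⊢; linarith
    linarith
  · have hc : (U.filter fun u => u = 0 ∨ u = p - q).card ≤ 2 := by
      refine (Finset.card_le_card (t := {0, p - q}) fun u hu => ?_).trans Finset.card_le_two
      simpa using (Finset.mem_filter.1 hu).2
    have h1 : (α - Finsupp.single p 1 : Occ) q ≤ α q := by rw [Finsupp.tsub_apply]; omega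
    have h2 : ((U.filter fun u => u = 0 ∨ u = p - q).card *
      (α p * (α - Finsupp.single p 1 : Occ) q)) ≤ 2 * (α p * α q) := by gcongr
    rw [if_neg h, sub_zero]
    exact_mod_cast h2

/-- All direct and exchange coefficients are bounded by |V̂_u| ≤ ∫ V. Of the savings α(p)² from p =
q, only the one of the condensate is kept. -/
theorem re_hamiltonian_ket_le (L : ℝ) (hL : 0 < L) (V : Space → ℝ) (hV : ∀ x, 0 ≤ V x)
    (hi : MeasureTheory.Integrable V) (α : Occ) :
    (hamiltonian L V (ketAmplitude α) α).re ≤ kinetic L α +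
      1 / L ^ 3 * ((∫ x, V x) / 2 * (2 * ((α.sum fun _ m => m : ℕ) : ℝ) ^ 2 - α 0 * α 0)) := by
  classical
  set v := ∫ x, V x
  have hv : 0 ≤ v := MeasureTheory.integral_nonneg hV
  unfold hamiltonian
  simp_rw [create_annihilate_ket, quartic_ket]
  set s := α.support
  have hs : ∀ p, p ∉ s → α p = 0 := fun p hp => by simpa [s] using hp
  have hk : ∑' p : Mode, ((‖momentum L p‖ ^ 2 : ℝ) : ℂ) * (α p : ℂ) = ((kinetic L α : ℝ) : ℂ) := by
    rw [tsum_eq_sum (s := s) (fun p hp => by simp [hs p hp])]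
    simp [kinetic, Finsupp.sum, s]
  -- Every momentum transfer with a non-zero term is 0 or a difference of occupied modes.
  set U : Finset Mode := insert 0 ((s ×ˢ s).image fun x => x.1 - x.2)
  have hsum : ∑' x : Mode × Mode × Mode, fourierCoeff L V x.2.2 / 2 *
      (if x.2.2 = 0 ∨ x.2.2 = x.1 - x.2.1 then
        ((α x.1 * (α - Finsupp.single x.1 1 : Occ) x.2.1 : ℕ) : ℂ) else 0) =
      ∑ x ∈ s ×ˢ s ×ˢ U, fourierCoeff L V x.2.2 / 2 *
      (if x.2.2 = 0 ∨ x.2.2 = x.1 - x.2.1 then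
        ((α x.1 * (α - Finsupp.single x.1 1 : Occ) x.2.1 : ℕ) : ℂ) else 0) := by
    refine tsum_eq_sum fun x hx => ?_
    obtain ⟨p, q, u⟩ := x
    by_cases hp : p ∈ s
    · by_cases hq : q ∈ s
      · have hu : u ∉ U := fun hu => hx (by simp [hp, hq, hu])
        rw [if_neg, mul_zero]
        rintro (h | h)
        · exact hu (by simp only at h; simp [U, h])
        · refine hu (Finset.mem_insert_of_mem (Finset.mem_image.2 ⟨(p, q), by simp [hp, hq], h.symm⟩))
      · have : (α - Finsupp.single p 1 : Occ) q = 0 := by rw [Finsupp.tsub_apply, hs q hq]; simp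
        simp [this]
    · simp [hs p hp]
  rw [hk, hsum]
  have hre : ((1 : ℂ) / (L : ℂ) ^ 3) = ((1 / L ^ 3 : ℝ) : ℂ) := by push_cast; rfl
  rw [Complex.add_re, Complex.ofReal_re, hre, Complex.re_ofReal_mul, Complex.re_sum]
  gcongr
  calc _ ≤ ∑ x ∈ s ×ˢ s ×ˢ U, v / 2 * (if x.2.2 = 0 ∨ x.2.2 = x.1 - x.2.1 then
        ((α x.1 * (α - Finsupp.single x.1 1 : Occ) x.2.1 : ℕ) : ℝ) else 0) := by
        refine Finset.sum_le_sum fun x _ => ?_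
        by_cases h : x.2.2 = 0 ∨ x.2.2 = x.1 - x.2.1
        · rw [if_pos h, if_pos h]
          rw [mul_comm, ← Complex.ofReal_natCast, Complex.re_ofReal_mul, mul_comm]
          have h1 : (fourierCoeff L V x.2.2 / 2).re ≤ v / 2 := by
            refine (Complex.re_le_norm _).trans ?_
            rw [norm_div]
            have := norm_fourierCoeff_le L V hV hi x.2.2
            simp only [Complex.norm_ofNat]
            gcongr
          gcongr
        · rw [if_neg h, if_neg h]; simp
    _ = v / 2 * ∑ p ∈ s, ∑ q ∈ s, ∑ u ∈ U, (if u = 0 ∨ u = p - q then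
        ((α p * (α - Finsupp.single p 1 : Occ) q : ℕ) : ℝ) else 0) := by
        rw [← Finset.mul_sum, Finset.sum_product]
        simp_rw [Finset.sum_product]
    _ ≤ v / 2 * ∑ p ∈ s, ∑ q ∈ s, (2 * (α p * α q) - if q = p then (α p : ℝ) * α p else 0) := by
        gcongr with p _ q _
        exact sum_quartic_le α U p q
    _ ≤ _ := by
        gcongr
        have hN : ((α.sum fun _ m => m : ℕ) : ℝ) = ∑ p ∈ s, (α p : ℝ) := by
          simp [Finsupp.sum, s]
        rw [hN, sq, Finset.sum_mul_sum]
        simp_rw [Finset.sum_sub_distrib, ← Finset.mul_sum]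
        gcongr
        have : ∀ p ∈ s, ∑ q ∈ s, (if q = p then (α p : ℝ) * α p else 0) = α p * α p := by
          intro p hp; rw [Finset.sum_ite_eq' s p]; simp [hp]
        rw [Finset.sum_congr rfl this]
        by_cases h0 : (0 : Mode) ∈ s
        · exact Finset.single_le_sum (f := fun p : Mode => (α p : ℝ) * α p)
            (fun p _ => by positivity) h0
        · rw [hs 0 h0]; simp only [Nat.cast_zero, mul_zero]
          exact Finset.sum_nonneg fun p _ => by positivity


/-! ### Theta function and Gaussian lattice sums -/

/-- The theta function `θ(a) = ∑_{m ∈ ℤ} e^{-a m²}`. -/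
noncomputable def theta (a : ℝ) : ℝ := ∑' m : ℤ, Real.exp (-(a * (m : ℝ) ^ 2))

theorem summable_theta {a : ℝ} (ha : 0 < a) :
    Summable fun m : ℤ => Real.exp (-(a * (m : ℝ) ^ 2)) := by
  have h := summable_pow_mul_jacobiTheta₂_term_bound 0 (T := a / Real.pi) (by positivity) 0
  refine h.congr fun m => ?_
  rw [pow_zero, one_mul]
  congr 1
  field_simp
  ring

theorem theta_poisson {a : ℝ} (ha : 0 < a) :
    theta a = Real.sqrt (Real.pi / a) * theta (Real.pi ^ 2 / a) := by
  have h := Real.tsum_exp_neg_mul_int_sq (a := a / Real.pi) (by positivity)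
  have hpi := Real.pi_pos
  have e1 : ∀ n : ℤ, -Real.pi * (a / Real.pi) * (n : ℝ) ^ 2 = -(a * (n : ℝ) ^ 2) := by
    intro n; field_simp
  have e2 : ∀ n : ℤ, -Real.pi / (a / Real.pi) * (n : ℝ) ^ 2 = -(Real.pi ^ 2 / a * (n : ℝ) ^ 2) := by
    intro n; field_simp
  simp_rw [e1, e2] at h
  rw [theta, h, theta, ← Real.sqrt_eq_rpow, one_div, ← Real.sqrt_inv, inv_div]

theorem one_le_theta {a : ℝ} (ha : 0 < a) : 1 ≤ theta a := by
  have := (summable_theta ha).sum_le_tsum {0} (fun _ _ => (Real.exp_pos _).le)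
  simpa [theta] using this

theorem sqrt_le_theta {a : ℝ} (ha : 0 < a) : Real.sqrt (Real.pi / a) ≤ theta a := by
  rw [theta_poisson ha]
  exact le_mul_of_one_le_right (Real.sqrt_nonneg _) (one_le_theta (by positivity))

/-- Since m² ≥ |m| for integers, the series is dominated by two geometric ones, over m ≥ 0 and m <
0. -/
theorem theta_le {a : ℝ} (ha : 0 < a) : theta a ≤ 1 + 2 * (1 / (Real.exp a - 1)) := by
  have hx : Real.exp (-a) < 1 := by simpa using ha
  have hx0 := Real.exp_pos (-a)
  have hg := hasSum_geometric_of_lt_one hx0.le hx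
  have h1 : HasSum (fun m : ℤ => Real.exp (-a) ^ m.natAbs)
      ((1 - Real.exp (-a))⁻¹ + Real.exp (-a) * (1 - Real.exp (-a))⁻¹) := by
    refine HasSum.of_nat_of_neg_add_one (by simpa using hg) ?_
    refine (hg.mul_left (Real.exp (-a))).congr_fun fun n => ?_
    rw [← pow_succ']
    congr 1
  have h2 : theta a ≤ (1 - Real.exp (-a))⁻¹ + Real.exp (-a) * (1 - Real.exp (-a))⁻¹ := by
    refine hasSum_le ?_ (summable_theta ha).hasSum h1
    intro m
    rw [← Real.exp_nat_mul]
    refine Real.exp_le_exp.2 ?_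
    have h3 : ((m.natAbs : ℕ) : ℝ) ≤ (m : ℝ) ^ 2 := by
      rw [Nat.cast_natAbs]
      rw [Int.cast_abs, ← sq_abs]
      have h4 := abs_nonneg (m : ℝ)
      rcases eq_or_ne m 0 with h5 | h5
      · simp [h5]
      · have : (1 : ℝ) ≤ |(m : ℝ)| := by exact_mod_cast Int.one_le_abs h5
        nlinarith
    nlinarith
  refine h2.trans (le_of_eq ?_)
  rw [Real.exp_neg]
  have : Real.exp a - 1 ≠ 0 := by
    have := Real.add_one_lt_exp ha.ne'
    intro h; linarith
  have h4 : (1 - (Real.exp a)⁻¹) ≠ 0 := by rw [← Real.exp_neg]; linarith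
  field_simp
  ring

theorem theta_le_of_inv {a : ℝ} (ha : 0 < a) : theta a ≤ 1 + 2 / a := by
  refine (theta_le ha).trans ?_
  have := Real.add_one_le_exp a
  rw [mul_one_div]
  gcongr
  linarith

theorem theta_le_of_inv_sq {a : ℝ} (ha : 0 < a) : theta a ≤ 1 + 4 / a ^ 2 := by
  refine (theta_le ha).trans ?_
  have := Real.quadratic_le_exp_of_nonneg ha.le
  have h : 4 / a ^ 2 = 2 / (a ^ 2 / 2) := by field_simp; ring
  rw [mul_one_div, h]
  gcongr
  linarith

theorem tendsto_theta_atTop : Tendsto theta atTop (𝓝 1) := by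
  refine tendsto_of_tendsto_of_tendsto_of_le_of_le' tendsto_const_nhds
    (h := fun a : ℝ => 1 + 2 / a) ?_
    ((eventually_gt_atTop 0).mono fun a ha => one_le_theta ha)
    ((eventually_gt_atTop 0).mono fun a ha => theta_le_of_inv ha)
  simpa using (tendsto_const_nhds (x := (1 : ℝ))).add (tendsto_const_nhds.div_atTop tendsto_id)

theorem sqrt_pow_three {x : ℝ} (hx : 0 ≤ x) : Real.sqrt x ^ 3 = x ^ (3 / 2 : ℝ) := by
  rw [Real.sqrt_eq_rpow, ← Real.rpow_natCast, ← Real.rpow_mul hx]; norm_num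

theorem rpow_mul_theta {a : ℝ} (ha : 0 < a) :
    a ^ (3 / 2 : ℝ) * theta a ^ 3 = Real.pi ^ (3 / 2 : ℝ) * theta (Real.pi ^ 2 / a) ^ 3 := by
  rw [theta_poisson ha, mul_pow, sqrt_pow_three (by positivity),
    Real.div_rpow Real.pi_pos.le ha.le]
  have : a ^ (3 / 2 : ℝ) ≠ 0 := by positivity
  field_simp

theorem tendsto_rpow_mul_theta :
    Tendsto (fun a : ℝ => a ^ (3 / 2 : ℝ) * (theta a ^ 3 - 1)) (𝓝[>] 0)
      (𝓝 (Real.pi ^ (3 / 2 : ℝ))) := by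
  have h1 : Tendsto (fun a : ℝ => Real.pi ^ (3 / 2 : ℝ) * theta (Real.pi ^ 2 / a) ^ 3
      - a ^ (3 / 2 : ℝ)) (𝓝[>] 0) (𝓝 (Real.pi ^ (3 / 2 : ℝ) * 1 ^ 3 - 0)) := by
    refine Tendsto.sub (Tendsto.mul tendsto_const_nhds (Tendsto.pow (tendsto_theta_atTop.comp ?_) 3)) ?_
    · exact (tendsto_inv_nhdsGT_zero.const_mul_atTop (r := Real.pi ^ 2) (by positivity)).congr
        fun a => (div_eq_mul_inv _ _).symm
    · have := (Real.continuousAt_rpow_const 0 (3 / 2 : ℝ) (Or.inr (by norm_num))).tendsto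
      rw [Real.zero_rpow (by norm_num)] at this
      exact this.mono_left nhdsWithin_le_nhds
  simp only [one_pow, mul_one, sub_zero] at h1
  refine h1.congr' ?_
  filter_upwards [self_mem_nhdsWithin] with a ha
  rw [mul_sub, rpow_mul_theta ha, mul_one]

/-- One power law valid on all scales: Poisson summation gives it for x ≤ 1, the decay of θ - 1 for
x ≥ 1. At x = (k+1)a it is the summable majorant in k behind the lattice sums. -/
theorem exists_theta_bound : ∃ C : ℝ, 0 < C ∧
    ∀ x : ℝ, 0 < x → theta x ^ 3 - 1 ≤ C * x ^ (-(3 / 2) : ℝ) := by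
  -- For x ≤ 1, θ(π²/x) ≤ 2 yields 8 = 2³. For x ≥ 1, θ ≤ 5 gives θ³ - 1 ≤ 31(θ - 1) with θ - 1 ≤
  -- 4/x², and 124 = 31 · 4.
  refine ⟨124 + 8 * Real.pi ^ (3 / 2 : ℝ), by positivity, fun x hx => ?_⟩
  rcases le_total x 1 with h | h
  · have h1 : theta (Real.pi ^ 2 / x) ≤ 2 := by
      refine (theta_le_of_inv (by positivity)).trans ?_
      have : 2 / (Real.pi ^ 2 / x) ≤ 1 := by
        rw [div_div_eq_mul_div, div_le_one (by positivity)]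
        nlinarith [Real.pi_gt_three]
      linarith
    have h2 := rpow_mul_theta hx
    have h0 := one_le_theta (a := Real.pi ^ 2 / x) (by positivity)
    have h3 : theta (Real.pi ^ 2 / x) ^ 3 ≤ 2 ^ 3 := by gcongr
    have hp : (0 : ℝ) < Real.pi ^ (3 / 2 : ℝ) := by positivity
    rw [Real.rpow_neg hx.le, ← div_eq_mul_inv, le_div_iff₀ (by positivity), mul_comm, mul_sub, h2]
    have : 0 < x ^ (3 / 2 : ℝ) := by positivity
    nlinarith
  · have h1 := theta_le_of_inv_sq hx
    have h0 := one_le_theta hx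
    have h2 : theta x ≤ 5 := by
      have : 4 / x ^ 2 ≤ 4 := div_le_self (by norm_num) (by nlinarith)
      linarith
    have h3 : x ^ (-(2 : ℕ) : ℝ) ≤ x ^ (-(3 / 2) : ℝ) :=
      Real.rpow_le_rpow_of_exponent_le h (by norm_num)
    have h4 : x ^ (-(2 : ℕ) : ℝ) = 1 / x ^ 2 := by
      rw [Real.rpow_neg hx.le, Real.rpow_natCast, one_div]
    have h5 : theta x - 1 ≤ 4 * x ^ (-(3 / 2) : ℝ) := by
      rw [h4] at h3
      have : 4 / x ^ 2 = 4 * (1 / x ^ 2) := by ring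
      linarith
    have h6 : theta x ^ 3 - 1 ≤ 31 * (theta x - 1) := by
      have h7 : theta x ^ 2 ≤ 5 ^ 2 := by gcongr
      have h8 : (theta x - 1) * (theta x ^ 2 + theta x + 1) ≤ (theta x - 1) * 31 :=
        mul_le_mul_of_nonneg_left (by linarith) (by linarith)
      linarith
    have : (0 : ℝ) < x ^ (-(3 / 2) : ℝ) := by positivity
    have hp : (0 : ℝ) < Real.pi ^ (3 / 2 : ℝ) := by positivity
    nlinarith

/-- The square of the Euclidean norm of the label of a momentum. -/
def labelSq (n : Mode) : ℝ := ∑ i, (n i : ℝ) ^ 2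

theorem hasSum_pi_prod {f : ℤ → ℝ} (hf : ∀ m, 0 ≤ f m) (hs : Summable f) (k : ℕ) :
    HasSum (fun n : Fin k → ℤ => ∏ i, f (n i)) ((∑' m, f m) ^ k) := by
  induction k with
  | zero => simp [hasSum_unique]
  | succ k ih =>
    rw [pow_succ']
    have h3 : Summable fun x : ℤ × (Fin k → ℤ) => f x.1 * ∏ i, f (x.2 i) :=
      Summable.mul_of_nonneg (f := f) (g := fun n : Fin k → ℤ => ∏ i, f (n i)) hs ih.summable
        (fun m => hf m) (fun n => Finset.prod_nonneg fun i _ => hf _)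
    generalize (∑' m, f m) ^ k = B at *
    have h : HasSum (fun x : ℤ × (Fin k → ℤ) => f x.1 * ∏ i, f (x.2 i)) ((∑' m, f m) * B) :=
      HasSum.mul (f := f) (g := fun n : Fin k → ℤ => ∏ i, f (n i)) hs.hasSum ih h3
    refine (Equiv.hasSum_iff (Fin.consEquiv fun _ : Fin (k + 1) => ℤ)).1
      (HasSum.congr_fun h fun x => ?_)
    simp [Fin.prod_univ_succ, Fin.consEquiv]

theorem hasSum_gaussian {a : ℝ} (ha : 0 < a) :
    HasSum (fun n : Mode => Real.exp (-(a * labelSq n))) (theta a ^ 3) := by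
  have h := hasSum_pi_prod (fun m => (Real.exp_pos (-(a * (m : ℝ) ^ 2))).le) (summable_theta ha) 3
  refine HasSum.congr_fun h ?_
  intro n
  rw [← Real.exp_sum, labelSq, Finset.mul_sum, Finset.sum_neg_distrib]

theorem one_le_labelSq {n : Mode} (hn : n ≠ 0) : 1 ≤ labelSq n := by
  obtain ⟨i, hi⟩ := Function.ne_iff.1 hn
  have h1 : (1 : ℝ) ≤ (n i : ℝ) ^ 2 := by
    have : (1 : ℤ) ≤ n i ^ 2 := by
      have : n i ≠ 0 := hi
      have := sq_pos_of_ne_zero this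
      omega
    exact_mod_cast this
  exact h1.trans (Finset.single_le_sum (f := fun i => (n i : ℝ) ^ 2) (fun _ _ => sq_nonneg _)
    (Finset.mem_univ i))

theorem labelSq_nonneg (n : Mode) : 0 ≤ labelSq n := Finset.sum_nonneg fun _ _ => sq_nonneg _

theorem labelSq_zero : labelSq 0 = 0 := by simp [labelSq]

/-- Off the origin 1 + n_i² ≤ 2|n|², so |n|^{-2s} ≤ 2^s ∏ (1 + n_i²)^{-s/3}, a product of
one-dimensional series that converge because 2s/3 > 1. The term at the origin is 0 by the convention
0^{-s} = 0. -/
theorem summable_labelSq_rpow {s : ℝ} (hs : 3 / 2 < s) :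
    Summable fun n : Mode => labelSq n ^ (-s) := by
  have h1 : Summable fun m : ℤ => (1 + (m : ℝ) ^ 2) ^ (-(s / 3)) := by
    have hb := Real.summable_abs_int_rpow (b := 2 * s / 3) (by linarith)
    refine hb.of_norm_bounded_eventually ?_
    have : {0}ᶜ ∈ (cofinite : Filter ℤ) := (Set.finite_singleton (0 : ℤ)).compl_mem_cofinite
    filter_upwards [this] with m hm
    have hm' : (m : ℝ) ≠ 0 := by exact_mod_cast hm
    have hpos : 0 < |(m : ℝ)| := abs_pos.2 hm'
    rw [Real.norm_of_nonneg (by positivity)]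
    have h2 : |(m : ℝ)| ^ (-(2 * s / 3)) = ((m : ℝ) ^ 2) ^ (-(s / 3)) := by
      rw [← sq_abs, ← Real.rpow_natCast, ← Real.rpow_mul hpos.le]
      congr 1; push_cast; ring
    rw [h2]
    exact Real.rpow_le_rpow_of_nonpos (by positivity) (by linarith) (by linarith)
  have h3 := (hasSum_pi_prod (fun m => by positivity) h1 3).summable
  refine (h3.mul_left (2 ^ s)).of_nonneg_of_le
    (fun n => Real.rpow_nonneg (labelSq_nonneg n) _) fun n => ?_
  by_cases hn : n = 0
  · subst hn
    rw [labelSq_zero, Real.zero_rpow (by linarith)]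
    positivity
  · have hq := one_le_labelSq hn
    rw [Real.finsetProd_rpow _ _ fun i _ => by positivity]
    set p := ∏ i, (1 + (n i : ℝ) ^ 2)
    have hp : 0 < p := Finset.prod_pos fun i _ => by positivity
    have h4 : p ≤ (2 * labelSq n) ^ (3 : ℝ) := by
      have : p ≤ ∏ _i : Fin 3, (2 * labelSq n) := by
        refine Finset.prod_le_prod (fun i _ => by positivity) fun i _ => ?_
        have := Finset.single_le_sum (f := fun i => (n i : ℝ) ^ 2) (fun _ _ => sq_nonneg _)
          (Finset.mem_univ i)
        have h5 : (n i : ℝ) ^ 2 ≤ labelSq n := this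
        linarith
      refine this.trans (le_of_eq ?_)
      rw [Finset.prod_const]; norm_num
    have h6 : ((2 * labelSq n) ^ (3 : ℝ)) ^ (-(s / 3)) ≤ p ^ (-(s / 3)) :=
      Real.rpow_le_rpow_of_nonpos hp h4 (by linarith)
    rw [← Real.rpow_mul (by linarith), Real.mul_rpow (by norm_num) (by linarith)] at h6
    have e : (3 : ℝ) * -(s / 3) = -s := by ring
    rw [e] at h6
    have h7 : (2 : ℝ) ^ s * (2 ^ (-s) * labelSq n ^ (-s)) = labelSq n ^ (-s) := by
      rw [← mul_assoc, ← Real.rpow_add (by norm_num)]; simp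
    rw [← h7]
    gcongr


/-! ### The ideal gas in the thermodynamic limit -/

/-- The Bose function `g_s(e^y) = ∑_{k ≥ 1} e^{yk} / k^s`. -/
noncomputable def boseFn (s y : ℝ) : ℝ :=
  ∑' k : ℕ, Real.exp (y * ((k : ℝ) + 1)) * ((k : ℝ) + 1) ^ (-s)

theorem summable_succ_rpow {s : ℝ} (hs : 1 < s) : Summable fun k : ℕ => ((k : ℝ) + 1) ^ (-s) := by
  have := (summable_nat_add_iff 1).2 (Real.summable_nat_rpow.2 (show -s < -1 by linarith))
  exact_mod_cast this

theorem summable_boseFn {s y : ℝ} (hs : 1 < s) (hy : y ≤ 0) :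
    Summable fun k : ℕ => Real.exp (y * ((k : ℝ) + 1)) * ((k : ℝ) + 1) ^ (-s) := by
  refine (summable_succ_rpow hs).of_nonneg_of_le (fun k => by positivity) fun k => ?_
  refine mul_le_of_le_one_left (by positivity) (Real.exp_le_one_iff.2 ?_)
  exact mul_nonpos_of_nonpos_of_nonneg hy (by positivity)

theorem boseFn_nonneg (s y : ℝ) : 0 ≤ boseFn s y := tsum_nonneg fun k => by positivity

theorem continuousOn_boseFn {s : ℝ} (hs : 1 < s) : ContinuousOn (boseFn s) (Set.Iic 0) := by
  refine continuousOn_tsum (fun k => by fun_prop) (summable_succ_rpow hs) fun k y hy => ?_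
  rw [Real.norm_of_nonneg (by positivity)]
  refine mul_le_of_le_one_left (by positivity) (Real.exp_le_one_iff.2 ?_)
  exact mul_nonpos_of_nonpos_of_nonneg hy (by positivity)

theorem boseFn_le_exp_mul {s y : ℝ} (hs : 1 < s) (hy : y ≤ 0) :
    boseFn s y ≤ Real.exp y * boseFn s 0 := by
  rw [boseFn, boseFn, ← tsum_mul_left]
  refine (summable_boseFn hs hy).tsum_le_tsum (fun k => ?_) ((summable_boseFn hs le_rfl).mul_left _)
  rw [← mul_assoc, ← Real.exp_add]
  gcongr
  nlinarith [(Nat.cast_nonneg k : (0 : ℝ) ≤ k)]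

/-- Convexity of y ↦ g_{5/2}(e^y), whose slope is g_{3/2}(e^y). Applying e^x ≥ 1 + x term by term
avoids differentiation and includes the endpoint y = 0. -/
theorem boseFn_tangent {y y' : ℝ} (hy : y ≤ 0) (hy' : y' ≤ 0) :
    boseFn (5 / 2) y + (y' - y) * boseFn (3 / 2) y ≤ boseFn (5 / 2) y' := by
  have h1 := summable_boseFn (s := 5 / 2) (by norm_num) hy
  have h2 := summable_boseFn (s := 3 / 2) (by norm_num) hy
  have h3 := summable_boseFn (s := 5 / 2) (by norm_num) hy'
  rw [boseFn, boseFn, boseFn, ← tsum_mul_left, ← h1.tsum_add (h2.mul_left _)]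
  refine (h1.add (h2.mul_left _)).tsum_le_tsum (fun k => ?_) h3
  have hk : (0 : ℝ) < (k : ℝ) + 1 := by positivity
  have e1 : ((k : ℝ) + 1) ^ (-(3 / 2) : ℝ) = ((k : ℝ) + 1) * ((k : ℝ) + 1) ^ (-(5 / 2) : ℝ) := by
    rw [← Real.rpow_one_add' hk.le (by norm_num)]; norm_num
  rw [e1]
  have e2 : Real.exp (y' * ((k : ℝ) + 1)) =
      Real.exp (y * ((k : ℝ) + 1)) * Real.exp ((y' - y) * ((k : ℝ) + 1)) := by
    rw [← Real.exp_add]; ring_nf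
  have e3 := Real.add_one_le_exp ((y' - y) * ((k : ℝ) + 1))
  rw [e2]
  have h4 : Real.exp (y * ((k : ℝ) + 1)) * ((k : ℝ) + 1) ^ (-(5 / 2) : ℝ) *
      ((y' - y) * ((k : ℝ) + 1) + 1) ≤ Real.exp (y * ((k : ℝ) + 1)) *
      ((k : ℝ) + 1) ^ (-(5 / 2) : ℝ) * Real.exp ((y' - y) * ((k : ℝ) + 1)) := by gcongr
  linarith

theorem criticalDensity_eq (β : ℝ) :
    criticalDensity β = (4 * Real.pi * β) ^ (-(3 / 2) : ℝ) * boseFn (3 / 2) 0 := by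
  rw [criticalDensity]
  congr 1
  have h := zeta_eq_tsum_one_div_nat_add_one_cpow (s := 3 / 2) (by norm_num)
  have h2 : ∀ n : ℕ, 1 / ((n : ℂ) + 1) ^ (3 / 2 : ℂ) =
      ((Real.exp (0 * ((n : ℝ) + 1)) * ((n : ℝ) + 1) ^ (-(3 / 2) : ℝ) : ℝ) : ℂ) := by
    intro n
    rw [zero_mul, Real.exp_zero, one_mul, Complex.ofReal_cpow (by positivity), one_div,
      ← Complex.cpow_neg]
    push_cast
    rfl
  simp_rw [h2] at h
  rw [h, ← Complex.ofReal_tsum, Complex.ofReal_re, boseFn]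

theorem integral_gaussian_mode {b : ℝ} (hb : 0 < b) :
    ∫ p : Space, Real.exp (-b * ‖p‖ ^ 2) = (Real.pi / b) ^ (3 / 2 : ℝ) := by
  rw [GaussianFourier.integral_rexp_neg_mul_sq_norm hb]
  simp

theorem integrable_gaussian_mode {b : ℝ} (hb : 0 < b) :
    MeasureTheory.Integrable fun p : Space => Real.exp (-b * ‖p‖ ^ 2) := by
  by_contra h
  have := integral_gaussian_mode hb
  rw [MeasureTheory.integral_undef h] at this
  have h2 : 0 < (Real.pi / b) ^ (3 / 2 : ℝ) := by positivity
  linarith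

/-- Integration of a power series in `e^{-β(p² - μ)}` term by term. -/
theorem integral_tsum_gaussian {β μ s : ℝ} (hβ : 0 < β) (hμ : μ ≤ 0) (hs : -(1 / 2) < s) :
    ∫ p : Space, ∑' k : ℕ, ((k : ℝ) + 1) ^ (-s) * Real.exp (-β * (‖p‖ ^ 2 - μ)) ^ (k + 1) =
      (Real.pi / β) ^ (3 / 2 : ℝ) * boseFn (s + 3 / 2) (β * μ) := by
  have e : ∀ (k : ℕ) (p : Space),
      ((k : ℝ) + 1) ^ (-s) * Real.exp (-β * (‖p‖ ^ 2 - μ)) ^ (k + 1) =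
      (Real.exp (β * μ * ((k : ℝ) + 1)) * ((k : ℝ) + 1) ^ (-s)) *
        Real.exp (-(β * ((k : ℝ) + 1)) * ‖p‖ ^ 2) := by
    intro k p
    rw [← Real.exp_nat_mul, mul_comm (Real.exp (β * μ * _)), mul_assoc, ← Real.exp_add]
    congr 2
    push_cast; ring
  have hint : ∀ k : ℕ, MeasureTheory.Integrable fun p : Space =>
      ((k : ℝ) + 1) ^ (-s) * Real.exp (-β * (‖p‖ ^ 2 - μ)) ^ (k + 1) := by
    intro k
    simp_rw [e]
    exact (integrable_gaussian_mode (by positivity)).const_mul _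
  have hval : ∀ k : ℕ, ∫ p : Space, ((k : ℝ) + 1) ^ (-s) *
      Real.exp (-β * (‖p‖ ^ 2 - μ)) ^ (k + 1) = (Real.pi / β) ^ (3 / 2 : ℝ) *
        (Real.exp (β * μ * ((k : ℝ) + 1)) * ((k : ℝ) + 1) ^ (-(s + 3 / 2))) := by
    intro k
    simp_rw [e]
    have hk : (0 : ℝ) < (k : ℝ) + 1 := by positivity
    rw [MeasureTheory.integral_const_mul, integral_gaussian_mode (by positivity), ← div_div,
      Real.div_rpow (by positivity) hk.le, neg_add, Real.rpow_add hk,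
      Real.rpow_neg hk.le (3 / 2)]
    field_simp
  have hsum : Summable fun k : ℕ => ∫ p : Space, ‖((k : ℝ) + 1) ^ (-s) *
      Real.exp (-β * (‖p‖ ^ 2 - μ)) ^ (k + 1)‖ := by
    have : ∀ (k : ℕ) (p : Space), ‖((k : ℝ) + 1) ^ (-s) *
      Real.exp (-β * (‖p‖ ^ 2 - μ)) ^ (k + 1)‖ = ((k : ℝ) + 1) ^ (-s) *
      Real.exp (-β * (‖p‖ ^ 2 - μ)) ^ (k + 1) := fun k p =>
        Real.norm_of_nonneg (by positivity)
    simp_rw [this, hval]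
    exact (summable_boseFn (by linarith) (mul_nonpos_of_nonneg_of_nonpos hβ.le hμ)).mul_left _
  have h := MeasureTheory.hasSum_integral_of_summable_integral_norm hint hsum
  rw [← h.tsum_eq, boseFn, ← tsum_mul_left]
  exact tsum_congr hval

theorem exp_lt_one_of_ne {β μ : ℝ} (hβ : 0 < β) (hμ : μ ≤ 0) {p : Space} (hp : p ≠ 0) :
    Real.exp (-β * (‖p‖ ^ 2 - μ)) < 1 := by
  rw [Real.exp_lt_one_iff]
  have : 0 < ‖p‖ := norm_pos_iff.2 hp
  nlinarith [sq_pos_of_pos this, mul_pos hβ (sq_pos_of_pos this)]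

theorem ae_ne_zero_space : ∀ᵐ p : Space, p ≠ 0 :=
  MeasureTheory.compl_mem_ae_iff.2 (MeasureTheory.measure_singleton 0)

theorem integral_log_one_sub {β μ : ℝ} (hβ : 0 < β) (hμ : μ ≤ 0) :
    ∫ p : Space, Real.log (1 - Real.exp (-β * (‖p‖ ^ 2 - μ))) =
      -((Real.pi / β) ^ (3 / 2 : ℝ) * boseFn (5 / 2) (β * μ)) := by
  have h := integral_tsum_gaussian (s := 1) hβ hμ (by norm_num)
  norm_num at h
  rw [← h, ← MeasureTheory.integral_neg]
  refine MeasureTheory.integral_congr_ae ?_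
  filter_upwards [ae_ne_zero_space] with p hp
  have h1 := exp_lt_one_of_ne hβ hμ hp
  have h2 := Real.hasSum_pow_div_log_of_abs_lt_one
    (x := Real.exp (-β * (‖p‖ ^ 2 - μ))) (by rwa [abs_of_pos (Real.exp_pos _)])
  rw [← neg_eq_iff_eq_neg, ← h2.tsum_eq]
  refine tsum_congr fun k => ?_
  rw [Real.rpow_neg_one, div_eq_mul_inv, mul_comm]
  norm_num

theorem four_pi_rpow {β : ℝ} (hβ : 0 < β) :
    1 / (2 * Real.pi) ^ 3 * (Real.pi / β) ^ (3 / 2 : ℝ) = (4 * Real.pi * β) ^ (-(3 / 2) : ℝ) := by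
  have hpi := Real.pi_pos
  have h1 : (2 * Real.pi) ^ 3 = ((4 * Real.pi ^ 2) : ℝ) ^ (3 / 2 : ℝ) := by
    rw [show (4 * Real.pi ^ 2 : ℝ) = (2 * Real.pi) ^ (2 : ℕ) by ring, ← Real.rpow_natCast _ 2,
      ← Real.rpow_mul (by positivity), ← Real.rpow_natCast]
    norm_num
  rw [h1, Real.rpow_neg (by positivity), one_div, ← Real.inv_rpow (by positivity),
    ← Real.mul_rpow (by positivity) (by positivity), ← Real.inv_rpow (by positivity)]
  congr 1
  field_simp

theorem idealDensity_eq {β μ : ℝ} (hβ : 0 < β) (hμ : μ ≤ 0) :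
    idealDensity μ β = (4 * Real.pi * β) ^ (-(3 / 2) : ℝ) * boseFn (3 / 2) (β * μ) := by
  have h := integral_tsum_gaussian (s := 0) hβ hμ (by norm_num)
  simp only [neg_zero, Real.rpow_zero, one_mul, zero_add] at h
  rw [idealDensity, ← four_pi_rpow hβ, mul_assoc, ← h]
  congr 1
  refine MeasureTheory.integral_congr_ae ?_
  filter_upwards [ae_ne_zero_space] with p hp
  have h1 := exp_lt_one_of_ne hβ hμ hp
  have h0 := Real.exp_pos (-β * (‖p‖ ^ 2 - μ))
  have e : Real.exp (β * (‖p‖ ^ 2 - μ)) = (Real.exp (-β * (‖p‖ ^ 2 - μ)))⁻¹ := by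
    rw [← Real.exp_neg]; ring_nf
  rw [e]
  generalize Real.exp (-β * (‖p‖ ^ 2 - μ)) = x at h0 h1
  simp_rw [pow_succ]
  rw [tsum_mul_right, tsum_geometric_of_lt_one h0.le h1]
  have : 1 - x ≠ 0 := by linarith
  have h2 : x⁻¹ - 1 ≠ 0 := by
    rw [← one_div, div_sub_one h0.ne']
    exact div_ne_zero this h0.ne'
  field_simp

/-- Intermediate value theorem: as a function of y = βμ ≤ 0 the density is continuous, at most e^y
times its value at 0, and equal to ρ_c > ρ at y = 0. This makes the choice in `chemicalPotential`
meaningful. -/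
theorem exists_chemicalPotential {ρ β : ℝ} (hβ : 0 < β) (hρ : 0 < ρ) (h : ρ < criticalDensity β) :
    ∃ μ < 0, ρ = idealDensity μ β := by
  have hK : (0 : ℝ) < (4 * Real.pi * β) ^ (-(3 / 2) : ℝ) := by
    have := Real.pi_pos; positivity
  set K := (4 * Real.pi * β) ^ (-(3 / 2) : ℝ)
  rw [criticalDensity_eq] at h
  have hB := boseFn_nonneg (3 / 2) 0
  obtain ⟨y₁, hy₁0, hy₁⟩ : ∃ y₁ ≤ 0, K * boseFn (3 / 2) y₁ ≤ ρ := by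
    have h1 : Tendsto (fun y => K * (Real.exp y * boseFn (3 / 2) 0)) atBot (𝓝 (K * (0 * boseFn (3 / 2) 0))) :=
      (Real.tendsto_exp_atBot.mul_const _).const_mul _
    rw [zero_mul, mul_zero] at h1
    obtain ⟨y, hy1, hy2⟩ := ((h1.eventually (gt_mem_nhds hρ)).and (eventually_le_atBot 0)).exists
    refine ⟨y, hy2, le_trans ?_ hy1.le⟩
    gcongr
    exact boseFn_le_exp_mul (by norm_num) hy2
  have hc : ContinuousOn (fun y => K * boseFn (3 / 2) y) (Set.Icc y₁ 0) :=
    ((continuousOn_boseFn (by norm_num)).mono fun y hy => hy.2).const_smul K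
  obtain ⟨y, hy, hyρ⟩ := intermediate_value_Icc hy₁0 hc ⟨hy₁, h.le⟩
  have hy0 : y ≠ 0 := by rintro rfl; simp only at hyρ; linarith
  have hlt : y < 0 := lt_of_le_of_ne hy.2 hy0
  refine ⟨y / β, div_neg_of_neg_of_pos hlt hβ, ?_⟩
  rw [idealDensity_eq hβ (div_neg_of_neg_of_pos hlt hβ).le, mul_div_cancel₀ _ hβ.ne']
  exact hyρ.symm

/-- The free energy `f₀` is the Legendre transform of the pressure; in particular every trial
chemical potential `y / β ≤ 0` gives a lower bound. -/
theorem le_idealFreeEnergy {ρ β y : ℝ} (hβ : 0 < β) (hρ : 0 < ρ) (hy : y ≤ 0) :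
    (ρ * y - (4 * Real.pi * β) ^ (-(3 / 2) : ℝ) * boseFn (5 / 2) y) / β ≤ idealFreeEnergy ρ β := by
  have hK : (0 : ℝ) < (4 * Real.pi * β) ^ (-(3 / 2) : ℝ) := by
    have := Real.pi_pos; positivity
  have key : ∀ μ ≤ 0, ρ * μ + 1 / ((2 * Real.pi) ^ 3 * β) *
      ∫ p : Space, Real.log (1 - Real.exp (-β * (‖p‖ ^ 2 - μ))) =
      (ρ * (β * μ) - (4 * Real.pi * β) ^ (-(3 / 2) : ℝ) * boseFn (5 / 2) (β * μ)) / β := by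
    intro μ hμ
    rw [integral_log_one_sub hβ hμ, ← four_pi_rpow hβ]
    field_simp
    ring
  rw [idealFreeEnergy]
  by_cases h : criticalDensity β ≤ ρ
  · rw [chemicalPotential, if_pos h, key 0 le_rfl]
    rw [criticalDensity_eq] at h
    -- At y = 0 the slope of the pressure term is ρ_c ≤ ρ, and y ≤ 0.
    have h1 := boseFn_tangent le_rfl hy
    rw [mul_zero]
    refine div_le_div_of_nonneg_right ?_ hβ.le
    nlinarith [mul_le_mul_of_nonneg_left h1 hK.le]
  · rw [chemicalPotential, if_neg h]
    have hex := exists_chemicalPotential hβ hρ (not_le.1 h)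
    obtain ⟨hμ, hρμ⟩ := Classical.epsilon_spec (p := fun μ : ℝ => μ < 0 ∧ ρ = idealDensity μ β)
      (by obtain ⟨μ, h1, h2⟩ := hex; exact ⟨μ, h1, h2⟩)
    set μ := Classical.epsilon fun μ : ℝ => μ < 0 ∧ ρ = idealDensity μ β
    rw [key μ hμ.le]
    rw [idealDensity_eq hβ hμ.le] at hρμ
    have h1 := boseFn_tangent (mul_nonpos_of_nonneg_of_nonpos hβ.le hμ.le) hy
    refine div_le_div_of_nonneg_right ?_ hβ.le
    have h2 := mul_le_mul_of_nonneg_left h1 hK.le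
    have h3 : (4 * Real.pi * β) ^ (-(3 / 2) : ℝ) * ((y - β * μ) * boseFn (3 / 2) (β * μ)) =
      (y - β * μ) * ρ := by rw [hρμ]; ring
    linarith


/-! ### Truncated geometric distributions -/

/-- The partition function `∑_{j ≤ K} x^j` of a mode with at most `K` particles. -/
noncomputable def truncZ (K : ℕ) (x : ℝ) : ℝ := ∑ j ∈ Finset.range (K + 1), x ^ j

/-- The mean occupation of a mode with at most `K` particles. -/
noncomputable def truncMean (K : ℕ) (x : ℝ) : ℝ :=
  (∑ j ∈ Finset.range (K + 1), x ^ j * (j : ℝ)) / truncZ K x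

/-- The variance of the occupation of a mode with at most `K` particles. -/
noncomputable def truncVar (K : ℕ) (x : ℝ) : ℝ :=
  (∑ j ∈ Finset.range (K + 1), x ^ j * ((j : ℝ) - truncMean K x) ^ 2) / truncZ K x

theorem one_le_truncZ (K : ℕ) {x : ℝ} (hx : 0 ≤ x) : 1 ≤ truncZ K x := by
  rw [truncZ, Finset.sum_range_succ', pow_zero]
  have : 0 ≤ ∑ k ∈ Finset.range K, x ^ (k + 1) := Finset.sum_nonneg fun _ _ => by positivity
  linarith

theorem truncZ_mul (K : ℕ) (x : ℝ) : truncZ K x * (1 - x) = 1 - x ^ (K + 1) := by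
  rw [truncZ, geom_sum_mul_neg]

theorem continuousOn_truncMean (K : ℕ) : ContinuousOn (truncMean K) (Set.Ici 0) := by
  refine ContinuousOn.div (by fun_prop) (by unfold truncZ; fun_prop) fun x hx => ?_
  have := one_le_truncZ K (x := x) hx
  linarith

theorem sum_mul_pow_mul (K : ℕ) (x : ℝ) :
    (1 - x) * ∑ j ∈ Finset.range (K + 1), x ^ j * (j : ℝ) =
      x * truncZ K x - (K + 1) * x ^ (K + 1) := by
  induction K with
  | zero => simp [truncZ]
  | succ K ih =>
    rw [Finset.sum_range_succ, mul_add, ih, truncZ, truncZ, Finset.sum_range_succ _ (K + 1)]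
    push_cast
    ring

theorem truncMean_eq (K : ℕ) {x : ℝ} (hx : 0 ≤ x) (hx1 : x < 1) :
    truncMean K x = x / (1 - x) - (K + 1) * x ^ (K + 1) / (1 - x ^ (K + 1)) := by
  have h1 := sum_mul_pow_mul K x
  have h2 := one_le_truncZ K hx
  have h3 : 1 - x ≠ 0 := by linarith
  have h4 : truncZ K x ≠ 0 := by linarith
  rw [← truncZ_mul, truncMean, div_sub_div _ _ h3 (mul_ne_zero h4 h3),
    div_eq_div_iff h4 (mul_ne_zero h3 (mul_ne_zero h4 h3))]
  linear_combination (truncZ K x * (1 - x)) * h1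

theorem truncMean_le (K : ℕ) {x : ℝ} (hx : 0 ≤ x) (hx1 : x < 1) :
    truncMean K x ≤ x / (1 - x) := by
  rw [truncMean_eq K hx hx1, sub_le_self_iff]
  have : x ^ (K + 1) ≤ 1 := pow_le_one₀ hx hx1.le
  exact div_nonneg (by positivity) (by linarith)

theorem le_truncMean (K : ℕ) {x : ℝ} (hx : 0 ≤ x) (hx1 : x < 1) (h : x ^ (K + 1) ≤ 1 / 2) :
    x / (1 - x) - 2 * (K + 1) * x ^ (K + 1) ≤ truncMean K x := by
  rw [truncMean_eq K hx hx1]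
  have h2 : (K + 1) * x ^ (K + 1) / (1 - x ^ (K + 1)) ≤ 2 * (K + 1) * x ^ (K + 1) := by
    rw [div_le_iff₀ (by linarith)]
    have : 0 ≤ (K + 1) * x ^ (K + 1) := by positivity
    nlinarith
  linarith

/-- Comparison with the series ∑ C(k+2, 2) x^k = (1 - x)^{-3}, using (k+1)² ≤ 2 C(k+2, 2). -/
theorem sum_sq_mul_pow_le (K : ℕ) {x : ℝ} (hx : 0 ≤ x) (hx1 : x < 1) :
    ∑ j ∈ Finset.range (K + 1), x ^ j * (j : ℝ) ^ 2 ≤ 2 * x / (1 - x) ^ 3 := by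
  have hn : ‖x‖ < 1 := by rwa [Real.norm_of_nonneg hx]
  have h1 := summable_choose_mul_geometric_of_norm_lt_one 2 hn
  have h2 := tsum_choose_mul_geometric_of_norm_lt_one 2 hn
  rw [Finset.sum_range_succ']
  simp only [Nat.cast_zero, ne_eq, OfNat.ofNat_ne_zero, not_false_eq_true, zero_pow, mul_zero,
    add_zero]
  have h3 := h1.sum_le_tsum (Finset.range K) (fun i _ => by positivity)
  rw [h2] at h3
  calc _ ≤ ∑ k ∈ Finset.range K, 2 * x * (((k + 2).choose 2 : ℕ) * x ^ k) := by
        refine Finset.sum_le_sum fun k _ => ?_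
        rw [Nat.cast_choose_two]
        push_cast
        have : x ^ (k + 1) * ((k : ℝ) + 1) ^ 2 ≤ x ^ (k + 1) * (((k : ℝ) + 2) * (k + 1)) := by
          gcongr
          nlinarith [(Nat.cast_nonneg k : (0 : ℝ) ≤ k)]
        refine this.trans (le_of_eq ?_)
        ring
    _ = 2 * x * ∑ k ∈ Finset.range K, (((k + 2).choose 2 : ℕ) * x ^ k) := by rw [Finset.mul_sum]
    _ ≤ 2 * x * (1 / (1 - x) ^ 3) := by gcongr
    _ = _ := by ring

/-- The variance is at most the second moment, and the normalization satisfies Z(1 - x) = 1 -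
x^{K+1} ≥ 1/2. -/
theorem truncVar_le (K : ℕ) {x : ℝ} (hx : 0 ≤ x) (hx1 : x < 1) (h : x ^ (K + 1) ≤ 1 / 2) :
    truncVar K x ≤ 4 * (x / (1 - x) ^ 2) := by
  have hZ := one_le_truncZ K hx
  have hx2 : 0 < 1 - x := by linarith
  have h1 : ∑ j ∈ Finset.range (K + 1), x ^ j * ((j : ℝ) - truncMean K x) ^ 2 ≤
      ∑ j ∈ Finset.range (K + 1), x ^ j * (j : ℝ) ^ 2 := by
    have e : ∀ j : ℕ, x ^ j * ((j : ℝ) - truncMean K x) ^ 2 = x ^ j * (j : ℝ) ^ 2 -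
        2 * truncMean K x * (x ^ j * j) + truncMean K x ^ 2 * x ^ j := fun j => by ring
    simp_rw [e]
    rw [Finset.sum_add_distrib, Finset.sum_sub_distrib, ← Finset.mul_sum, ← Finset.mul_sum]
    have h2 : ∑ j ∈ Finset.range (K + 1), x ^ j * (j : ℝ) = truncMean K x * truncZ K x := by
      rw [truncMean, div_mul_cancel₀ _ (by linarith)]
    have h3 : ∑ j ∈ Finset.range (K + 1), x ^ j = truncZ K x := rfl
    rw [h2, h3]
    nlinarith [mul_nonneg (sq_nonneg (truncMean K x)) (zero_le_one.trans hZ)]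
  have h2 := h1.trans (sum_sq_mul_pow_le K hx hx1)
  rw [truncVar, div_le_iff₀ (by linarith)]
  refine h2.trans ?_
  have h4 : 1 / 2 ≤ truncZ K x * (1 - x) := by rw [truncZ_mul]; linarith
  have h5 : 2 * x / (1 - x) ^ 3 = 4 * (x / (1 - x) ^ 3) * (1 / 2) := by ring
  have h6 : 4 * (x / (1 - x) ^ 2) * truncZ K x =
      4 * (x / (1 - x) ^ 3) * (truncZ K x * (1 - x)) := by field_simp
  rw [h5, h6]
  gcongr

theorem div_one_sub_le {x u : ℝ} (hu : 0 < u) (hx1 : x ≤ Real.exp (-u)) :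
    x / (1 - x) ≤ 1 / u := by
  have h1 := Real.add_one_le_exp u
  have h2 : Real.exp (-u) * Real.exp u = 1 := by rw [← Real.exp_add]; simp
  have h3 : Real.exp (-u) < 1 := by simpa using hu
  have h4 := Real.exp_pos (-u)
  rw [div_le_div_iff₀ (by linarith) hu]
  nlinarith

/-- From x(1+u) ≤ 1 one gets u ≤ (1-x)(1+u), and (1+u)² ≤ 4(1+u/2)² ≤ 4e^u gives x(1+u)² ≤ 4. At x =
e^{-u} this is a crude form of sinh(u/2) ≥ u/2. -/
theorem div_one_sub_sq_le {x u : ℝ} (hu : 0 < u) (hx : 0 ≤ x) (hx1 : x ≤ Real.exp (-u)) :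
    x / (1 - x) ^ 2 ≤ 4 / u ^ 2 := by
  have h1 := Real.add_one_le_exp u
  have h1' := Real.add_one_le_exp (u / 2)
  have h2 : Real.exp (-u) * Real.exp u = 1 := by rw [← Real.exp_add]; simp
  have h2' : Real.exp (u / 2) * Real.exp (u / 2) = Real.exp u := by rw [← Real.exp_add]; ring_nf
  have h3 : Real.exp (-u) < 1 := by simpa using hu
  have h4 := Real.exp_pos (-u)
  have h5 : 0 < 1 - x := by linarith
  have h6 : u ≤ (1 - x) * (1 + u) := by nlinarith
  have h7 : (1 + u) ^ 2 ≤ 4 * Real.exp u := by rw [← h2']; nlinarith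
  have h8 : u ^ 2 ≤ ((1 - x) * (1 + u)) ^ 2 := by gcongr
  have h9 : x * (1 + u) ^ 2 ≤ 4 := by
    calc x * (1 + u) ^ 2 ≤ Real.exp (-u) * (4 * Real.exp u) := by gcongr
      _ = 4 := by linear_combination 4 * h2
  rw [div_le_div_iff₀ (by positivity) (by positivity)]
  calc x * u ^ 2 ≤ x * ((1 - x) * (1 + u)) ^ 2 := by gcongr
    _ = (x * (1 + u) ^ 2) * (1 - x) ^ 2 := by ring
    _ ≤ 4 * (1 - x) ^ 2 := by gcongr

/-! ### Product weights -/

section Product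

variable {ι : Type*} [Fintype ι] [DecidableEq ι]

/-- The function of one coordinate is absorbed into that coordinate's factor, so the sum over
configurations still factorizes. -/
theorem sum_prod_mul_single (t : ι → Finset ℕ) (w : ι → ℕ → ℝ)
    (hZ : ∀ i, ∑ j ∈ t i, w i j ≠ 0) (h : ι → ℕ → ℝ) (i : ι) :
    ∑ f ∈ Fintype.piFinset t, (∏ l, w l (f l)) * h i (f i) =
      (∏ l, ∑ j ∈ t l, w l j) * ((∑ j ∈ t i, w i j * h i j) / ∑ j ∈ t i, w i j) := by
  have e : ∀ f : ι → ℕ, (∏ l, w l (f l)) * h i (f i) =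
      ∏ l, (w l (f l) * if l = i then h l (f l) else 1) := by
    intro f
    rw [Finset.prod_mul_distrib, Finset.prod_ite_eq' Finset.univ i]
    simp
  simp_rw [e]
  rw [← Finset.prod_univ_sum t (fun l j => w l j * if l = i then h l j else 1),
    ← Finset.mul_prod_erase _ _ (Finset.mem_univ i),
    ← Finset.mul_prod_erase _ (fun l => ∑ j ∈ t l, w l j) (Finset.mem_univ i)]
  have e2 : ∀ l ∈ Finset.univ.erase i, (∑ j ∈ t l, w l j * if l = i then h l j else 1) =
      ∑ j ∈ t l, w l j := by
    intro l hl
    simp [Finset.ne_of_mem_erase hl]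
  rw [Finset.prod_congr rfl e2]
  simp only [if_true]
  have := hZ i
  field_simp

theorem sum_prod_mul_pair (t : ι → Finset ℕ) (w : ι → ℕ → ℝ) (h : ι → ℕ → ℝ)
    {i k : ι} (hik : i ≠ k) (h0 : ∑ j ∈ t i, w i j * h i j = 0) :
    ∑ f ∈ Fintype.piFinset t, (∏ l, w l (f l)) * (h i (f i) * h k (f k)) = 0 := by
  have e : ∀ f : ι → ℕ, (∏ l, w l (f l)) * (h i (f i) * h k (f k)) =
      ∏ l, (w l (f l) * ((if l = i then h l (f l) else 1) * if l = k then h l (f l) else 1)) := by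
    intro f
    rw [Finset.prod_mul_distrib, Finset.prod_mul_distrib, Finset.prod_ite_eq' Finset.univ i,
      Finset.prod_ite_eq' Finset.univ k]
    simp
  simp_rw [e]
  rw [← Finset.prod_univ_sum t
    (fun l j => w l j * ((if l = i then h l j else 1) * if l = k then h l j else 1))]
  refine Finset.prod_eq_zero (Finset.mem_univ i) ?_
  simpa [hik] using h0

/-- The variance of a sum of independent centred variables is the sum of the variances. -/
theorem sum_prod_mul_sq (t : ι → Finset ℕ) (w : ι → ℕ → ℝ)
    (hZ : ∀ i, ∑ j ∈ t i, w i j ≠ 0) (h : ι → ℕ → ℝ)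
    (h0 : ∀ i, ∑ j ∈ t i, w i j * h i j = 0) :
    ∑ f ∈ Fintype.piFinset t, (∏ l, w l (f l)) * (∑ i, h i (f i)) ^ 2 =
      (∏ l, ∑ j ∈ t l, w l j) *
        ∑ i, ((∑ j ∈ t i, w i j * h i j ^ 2) / ∑ j ∈ t i, w i j) := by
  simp_rw [sq (∑ i, h i _), Finset.sum_mul_sum, Finset.mul_sum]
  rw [Finset.sum_comm]
  refine Finset.sum_congr rfl fun i _ => ?_
  rw [Finset.sum_comm, Finset.sum_eq_single_of_mem i (Finset.mem_univ i)]
  · rw [← sum_prod_mul_single t w hZ (fun i j => h i j ^ 2) i]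
    exact Finset.sum_congr rfl fun f _ => by ring
  · intro k _ hk
    exact sum_prod_mul_pair t w h (Ne.symm hk) (h0 i)

/-- Chebyshev's and Markov's inequality for independent truncated geometric variables. -/
theorem half_prod_le_sum_filter (K : ι → ℕ) (x : ι → ℝ) (hx : ∀ i, 0 ≤ x i) (A : Finset ι)
    {w v : ℝ} (hw : 0 < w) (hv : 0 < v) (hvar : ∑ i, truncVar (K i) (x i) ≤ w ^ 2 / 4)
    (hmean : ∑ i ∈ A, truncMean (K i) (x i) ≤ v / 4) :
    (∏ i, truncZ (K i) (x i)) / 2 ≤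
      ∑ f ∈ (Fintype.piFinset fun i => Finset.range (K i + 1)).filter
        (fun f => |∑ i, ((f i : ℝ) - truncMean (K i) (x i))| ≤ w ∧ ∑ i ∈ A, (f i : ℝ) ≤ v),
        ∏ i, x i ^ f i := by
  set t : ι → Finset ℕ := fun i => Finset.range (K i + 1)
  have hZ : ∀ i, ∑ j ∈ t i, x i ^ j ≠ 0 := fun i => by
    have := one_le_truncZ (K i) (hx i); rw [truncZ] at this; simp only [t]; linarith
  have hP : 0 ≤ ∏ i, truncZ (K i) (x i) :=
    Finset.prod_nonneg fun i _ => zero_le_one.trans (one_le_truncZ _ (hx i))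
  have h1 := sum_prod_mul_sq t (fun i j => x i ^ j) hZ (fun i j => (j : ℝ) - truncMean (K i) (x i))
    (fun i => by
      simp_rw [mul_sub]
      rw [Finset.sum_sub_distrib, ← Finset.sum_mul, truncMean, truncZ, mul_div_cancel₀ _ (hZ i),
        sub_self])
  have h2 : ∑ f ∈ Fintype.piFinset t, (∏ l, x l ^ f l) * ∑ i ∈ A, (f i : ℝ) =
      (∏ i, truncZ (K i) (x i)) * ∑ i ∈ A, truncMean (K i) (x i) := by
    simp_rw [Finset.mul_sum]
    rw [Finset.sum_comm]
    exact Finset.sum_congr rfl fun i _ =>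
      sum_prod_mul_single t (fun i j => x i ^ j) hZ (fun _ j => (j : ℝ)) i
  have h3 : ∑ f ∈ Fintype.piFinset t, ∏ l, x l ^ f l = ∏ i, truncZ (K i) (x i) :=
    (Finset.prod_univ_sum t fun i j => x i ^ j).symm
  rw [Finset.sum_filter]
  -- Pointwise, W(1 - D²/w² - A/v) is at most W on good configurations and at most 0 on bad ones.
  -- After summation each of the two subtracted moments costs at most a quarter of the total weight.
  have h4 : ∀ f ∈ Fintype.piFinset t, (∏ l, x l ^ f l) -
      (∏ l, x l ^ f l) * (∑ i, ((f i : ℝ) - truncMean (K i) (x i))) ^ 2 / w ^ 2 -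
      (∏ l, x l ^ f l) * (∑ i ∈ A, (f i : ℝ)) / v ≤
      if |∑ i, ((f i : ℝ) - truncMean (K i) (x i))| ≤ w ∧ ∑ i ∈ A, (f i : ℝ) ≤ v
        then ∏ l, x l ^ f l else 0 := by
    intro f _
    have hW : 0 ≤ ∏ l, x l ^ f l := Finset.prod_nonneg fun i _ => pow_nonneg (hx i) _
    have hA : 0 ≤ ∑ i ∈ A, (f i : ℝ) := Finset.sum_nonneg fun i _ => by positivity
    set W := ∏ l, x l ^ f l
    set D := ∑ i, ((f i : ℝ) - truncMean (K i) (x i))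
    have hq1 : 0 ≤ W * D ^ 2 / w ^ 2 := by positivity
    have hq2 : 0 ≤ W * (∑ i ∈ A, (f i : ℝ)) / v := by positivity
    split_ifs with hG
    · linarith
    · rw [not_and_or, not_le, not_le] at hG
      rcases hG with hG | hG
      · have : W ≤ W * D ^ 2 / w ^ 2 := by
          rw [le_div_iff₀ (by positivity)]
          have : w ^ 2 ≤ D ^ 2 := by rw [← sq_abs D]; gcongr
          gcongr
        linarith
      · have : W ≤ W * (∑ i ∈ A, (f i : ℝ)) / v := by
          rw [le_div_iff₀ hv]
          gcongr
        linarith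
  refine le_trans ?_ (Finset.sum_le_sum h4)
  rw [Finset.sum_sub_distrib, Finset.sum_sub_distrib, ← Finset.sum_div, ← Finset.sum_div, h1, h2, h3]
  have e1 : (∏ l, ∑ j ∈ t l, x l ^ j) = ∏ i, truncZ (K i) (x i) := rfl
  have e2 : ∑ i, ((∑ j ∈ t i, x i ^ j * ((j : ℝ) - truncMean (K i) (x i)) ^ 2) /
      ∑ j ∈ t i, x i ^ j) = ∑ i, truncVar (K i) (x i) := rfl
  rw [e1, e2]
  set P := ∏ i, truncZ (K i) (x i)
  have h5 : P * (∑ i, truncVar (K i) (x i)) / w ^ 2 ≤ P / 4 := by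
    rw [div_le_iff₀ (by positivity)]
    nlinarith [mul_le_mul_of_nonneg_left hvar hP]
  have h6 : P * (∑ i ∈ A, truncMean (K i) (x i)) / v ≤ P / 4 := by
    rw [div_le_iff₀ hv]
    nlinarith [mul_le_mul_of_nonneg_left hmean hP]
  linarith

end Product


/-! ### The ideal gas on a finite set of modes -/

/-- A finite set `P` of non-zero modes with maximal occupation numbers `K` such that, up to factors
`e^{-E}`, the modes outside of `P` and the occupation numbers above `K` do not contribute. -/
structure Cutoffs (a E : ℝ) (P : Finset Mode) (K : Mode → ℕ) : Prop where
  pos : 0 < a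
  zero_notMem : (0 : Mode) ∉ P
  outside : ∀ n ∉ P, n ≠ 0 → E ≤ a * labelSq n
  inside : ∀ n ∈ P, E ≤ a * labelSq n * (K n + 1)
  small : Real.exp (-(E / 2)) ≤ 1 / 2

/-- The fugacity `e^{y - a|n|²}` of a mode. -/
noncomputable def fugacity (a y : ℝ) (n : Mode) : ℝ := Real.exp (y - a * labelSq n)

/-- The bound on the contribution of what is cut off. -/
noncomputable def cutoffError (a E : ℝ) : ℝ := Real.exp (-(E / 2)) * theta (a / 2) ^ 3

/-- The mean number of particles in `P`. -/
noncomputable def meanNumber (a : ℝ) (P : Finset Mode) (K : Mode → ℕ) (y : ℝ) : ℝ :=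
  ∑ n ∈ P, truncMean (K n) (fugacity a y n)

/-- The mean number of particles in `P` at `y = 0` without bounds on the occupation numbers. -/
noncomputable def fullNumber (a : ℝ) (P : Finset Mode) : ℝ :=
  ∑ n ∈ P, fugacity a 0 n / (1 - fugacity a 0 n)

theorem fugacity_pos (a y : ℝ) (n : Mode) : 0 < fugacity a y n := Real.exp_pos _

theorem fugacity_le {a y : ℝ} (hy : y ≤ 0) (n : Mode) :
    fugacity a y n ≤ Real.exp (-(a * labelSq n)) := Real.exp_le_exp.2 (by linarith)

theorem sum_gaussian_le {b : ℝ} (hb : 0 < b) (P : Finset Mode) :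
    ∑ n ∈ P, Real.exp (-(b * labelSq n)) ≤ theta b ^ 3 :=
  sum_le_hasSum P (fun _ _ => (Real.exp_pos _).le) (hasSum_gaussian hb)

theorem sum_gaussian_le_sub_one {b : ℝ} (hb : 0 < b) {P : Finset Mode} (h0 : (0 : Mode) ∉ P) :
    ∑ n ∈ P, Real.exp (-(b * labelSq n)) ≤ theta b ^ 3 - 1 := by
  have := sum_gaussian_le hb (insert 0 P)
  rw [Finset.sum_insert h0, labelSq_zero] at this
  simp only [mul_zero, neg_zero, Real.exp_zero] at this
  linarith

theorem cutoffError_nonneg {a : ℝ} (ha : 0 < a) (E : ℝ) : 0 ≤ cutoffError a E := by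
  have := one_le_theta (a := a / 2) (by positivity)
  unfold cutoffError; positivity

namespace Cutoffs

variable {a E : ℝ} {P : Finset Mode} {K : Mode → ℕ}

theorem E_pos (h : Cutoffs a E P K) : 0 < E := by
  have h1 : Real.exp (-(E / 2)) < 1 := h.small.trans_lt (by norm_num)
  rw [Real.exp_lt_one_iff] at h1
  linarith

theorem ne_zero (h : Cutoffs a E P K) {n : Mode} (hn : n ∈ P) : n ≠ 0 := by
  rintro rfl; exact h.zero_notMem hn

theorem energy_pos (h : Cutoffs a E P K) {n : Mode} (hn : n ∈ P) : 0 < a * labelSq n :=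
  mul_pos h.pos (zero_lt_one.trans_le (one_le_labelSq (h.ne_zero hn)))

theorem fugacity_lt_one (h : Cutoffs a E P K) {y : ℝ} (hy : y ≤ 0) {n : Mode} (hn : n ∈ P) :
    fugacity a y n < 1 := by
  have := h.energy_pos hn
  rw [fugacity, Real.exp_lt_one_iff]; linarith

/-- The exponent a|n|²(K+1) is split into halves: one is at least E/2 by `inside`, the other retains
a Gaussian that makes the sum over modes converge. -/
theorem fugacity_pow_le (h : Cutoffs a E P K) {y : ℝ} (hy : y ≤ 0) {n : Mode} (hn : n ∈ P) :
    fugacity a y n ^ (K n + 1) ≤ Real.exp (-(E / 2)) * Real.exp (-(a / 2 * labelSq n)) := by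
  have h1 := h.energy_pos hn
  have h2 := h.inside n hn
  rw [fugacity, ← Real.exp_nat_mul, ← Real.exp_add, Real.exp_le_exp]
  push_cast
  have hk : (0 : ℝ) ≤ K n := by positivity
  have h3 : ((K n : ℝ) + 1) * y ≤ 0 := mul_nonpos_of_nonneg_of_nonpos (by linarith) hy
  nlinarith [mul_nonneg hk h1.le]

theorem fugacity_pow_le_half (h : Cutoffs a E P K) {y : ℝ} (hy : y ≤ 0) {n : Mode}
    (hn : n ∈ P) : fugacity a y n ^ (K n + 1) ≤ 1 / 2 := by
  refine (h.fugacity_pow_le hy hn).trans ?_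
  have h1 := h.energy_pos hn
  have h2 : Real.exp (-(a / 2 * labelSq n)) ≤ 1 := Real.exp_le_one_iff.2 (by linarith)
  have := h.small
  have h3 := Real.exp_pos (-(a / 2 * labelSq n))
  nlinarith [Real.exp_pos (-(E / 2))]

theorem sum_fugacity_pow_le (h : Cutoffs a E P K) {y : ℝ} (hy : y ≤ 0) :
    ∑ n ∈ P, fugacity a y n ^ (K n + 1) ≤ cutoffError a E := by
  refine (Finset.sum_le_sum fun n hn => h.fugacity_pow_le hy hn).trans ?_
  rw [← Finset.mul_sum, cutoffError]
  gcongr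
  exact sum_gaussian_le (by linarith [h.pos]) P

/-- The zero mode accounts for -1. The other modes missing from P have a|n|² ≥ E, so their Gaussians
gain a factor e^{-E/2} ≤ 1/2 for each k; this keeps the error summable over k. -/
theorem le_sum_gaussian (h : Cutoffs a E P K) (k : ℕ) :
    theta (((k : ℝ) + 1) * a) ^ 3 - 1 - (1 / 2) ^ k * cutoffError a E ≤
      ∑ n ∈ P, Real.exp (-(((k : ℝ) + 1) * a * labelSq n)) := by
  have ha := h.pos
  have hf := hasSum_gaussian (a := ((k : ℝ) + 1) * a) (by positivity)
  have hg := (hasSum_gaussian (a := a / 2) (by positivity)).mul_left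
    ((1 / 2) ^ k * Real.exp (-(E / 2)))
  have hi : HasSum (fun n => if n ∈ insert 0 P then
      Real.exp (-(((k : ℝ) + 1) * a * labelSq n)) else 0)
      (∑ n ∈ insert 0 P, Real.exp (-(((k : ℝ) + 1) * a * labelSq n))) := by
    have := hasSum_sum_of_ne_finset_zero (L := .unconditional Mode) (f := fun n => if n ∈ insert 0 P then
      Real.exp (-(((k : ℝ) + 1) * a * labelSq n)) else 0) (s := insert 0 P)
      (fun b hb => if_neg hb)
    rwa [Finset.sum_congr rfl fun x hx => if_pos hx] at this
  have hle := hasSum_le (fun n => ?_) hf (hi.add hg)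
  · rw [Finset.sum_insert h.zero_notMem, labelSq_zero] at hle
    simp only [mul_zero, neg_zero, Real.exp_zero] at hle
    rw [cutoffError]
    linarith
  · by_cases hn : n ∈ insert 0 P
    · rw [if_pos hn]
      have : 0 ≤ (1 / 2) ^ k * Real.exp (-(E / 2)) * Real.exp (-(a / 2 * labelSq n)) := by
        positivity
      linarith
    · rw [if_neg hn, zero_add]
      simp only [Finset.mem_insert, not_or] at hn
      have h1 := h.outside n hn.2 hn.1
      have h2 : Real.exp (-(((k : ℝ) + 1) * a * labelSq n)) ≤
          Real.exp (-(E / 2)) ^ k * Real.exp (-(E / 2)) * Real.exp (-(a / 2 * labelSq n)) := by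
        rw [← Real.exp_nat_mul, ← Real.exp_add, ← Real.exp_add, Real.exp_le_exp]
        have hk : (0 : ℝ) ≤ k := by positivity
        nlinarith [mul_le_mul_of_nonneg_left h1 hk, mul_nonneg hk h.E_pos.le]
      refine h2.trans ?_
      gcongr
      exact h.small

/-- By the geometric sum, ln Z + ln(1 - x) = ln(1 - x^{K+1}), which is at least -2x^{K+1} because
x^{K+1} ≤ 1/2. -/
theorem log_truncZ_ge (h : Cutoffs a E P K) {y : ℝ} (hy : y ≤ 0) {n : Mode} (hn : n ∈ P) :
    -Real.log (1 - fugacity a y n) - 2 * fugacity a y n ^ (K n + 1) ≤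
      Real.log (truncZ (K n) (fugacity a y n)) := by
  have h1 := h.fugacity_lt_one hy hn
  have h2 := h.fugacity_pow_le_half hy hn
  have h3 := truncZ_mul (K n) (fugacity a y n)
  have h4 := one_le_truncZ (K n) (fugacity_pos a y n).le
  have h5 : Real.log (truncZ (K n) (fugacity a y n)) + Real.log (1 - fugacity a y n) =
      Real.log (1 - fugacity a y n ^ (K n + 1)) := by
    rw [← h3, Real.log_mul (by linarith) (by linarith)]
  have h6 := Real.one_sub_inv_le_log_of_pos (x := 1 - fugacity a y n ^ (K n + 1)) (by linarith)
  have h0 : 0 < fugacity a y n ^ (K n + 1) := pow_pos (fugacity_pos a y n) _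
  generalize fugacity a y n ^ (K n + 1) = t at *
  have h7 : (1 - t)⁻¹ ≤ 1 + 2 * t := by
    rw [inv_le_iff_one_le_mul₀ (by linarith)]
    nlinarith
  linarith

theorem hasSum_log (h : Cutoffs a E P K) {y : ℝ} (hy : y ≤ 0) :
    HasSum (fun k : ℕ => Real.exp (y * ((k : ℝ) + 1)) / ((k : ℝ) + 1) *
      ∑ n ∈ P, Real.exp (-(((k : ℝ) + 1) * a * labelSq n)))
      (∑ n ∈ P, -Real.log (1 - fugacity a y n)) := by
  have h1 : HasSum (fun k : ℕ => ∑ n ∈ P, fugacity a y n ^ (k + 1) / ((k : ℝ) + 1))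
      (∑ n ∈ P, -Real.log (1 - fugacity a y n)) :=
    hasSum_sum fun n hn => Real.hasSum_pow_div_log_of_abs_lt_one (by
      rw [abs_of_pos (fugacity_pos a y n)]; exact h.fugacity_lt_one hy hn)
  refine h1.congr_fun fun k => ?_
  rw [Finset.mul_sum]
  refine Finset.sum_congr rfl fun n _ => ?_
  rw [fugacity, ← Real.exp_nat_mul, div_mul_eq_mul_div, ← Real.exp_add]
  congr 2
  push_cast; ring

theorem hasSum_fullNumber (h : Cutoffs a E P K) :
    HasSum (fun k : ℕ => ∑ n ∈ P, Real.exp (-(((k : ℝ) + 1) * a * labelSq n)))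
      (fullNumber a P) := by
  have h1 : HasSum (fun k : ℕ => ∑ n ∈ P, fugacity a 0 n * fugacity a 0 n ^ k)
      (∑ n ∈ P, fugacity a 0 n * (1 - fugacity a 0 n)⁻¹) :=
    hasSum_sum fun n hn => (hasSum_geometric_of_lt_one (fugacity_pos a 0 n).le
      (h.fugacity_lt_one le_rfl hn)).mul_left _
  refine HasSum.congr_fun h1 fun k => ?_
  refine Finset.sum_congr rfl fun n _ => ?_
  rw [← pow_succ', fugacity, ← Real.exp_nat_mul]
  congr 1
  push_cast; ring

/-- The pressure of the modes in `P` is the one of the thermodynamic limit, up to a surface term. -/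
theorem le_sum_log_truncZ (h : Cutoffs a E P K) {y : ℝ} (hy : y ≤ 0) :
    (Real.pi / a) ^ (3 / 2 : ℝ) * boseFn (5 / 2) y - Real.sqrt (Real.pi / a) * boseFn (3 / 2) 0 -
      4 * cutoffError a E ≤ ∑ n ∈ P, Real.log (truncZ (K n) (fugacity a y n)) := by
  have ha := h.pos
  have hpi := Real.pi_pos
  set δ := cutoffError a E
  have hδ : 0 ≤ δ := cutoffError_nonneg ha E
  have h1 := Finset.sum_le_sum fun n hn => h.log_truncZ_ge hy (n := n) hn
  rw [Finset.sum_sub_distrib, ← Finset.mul_sum] at h1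
  have h2 := h.sum_fugacity_pow_le hy
  have h3 : HasSum (fun k : ℕ => (Real.pi / a) ^ (3 / 2 : ℝ) *
        (Real.exp (y * ((k : ℝ) + 1)) * ((k : ℝ) + 1) ^ (-(5 / 2) : ℝ)) -
      Real.sqrt (Real.pi / a) * (Real.exp (y * ((k : ℝ) + 1)) * ((k : ℝ) + 1) ^ (-(3 / 2) : ℝ)) -
      (1 / 2) ^ k * δ)
      ((Real.pi / a) ^ (3 / 2 : ℝ) * boseFn (5 / 2) y -
        Real.sqrt (Real.pi / a) * boseFn (3 / 2) y - 2 * δ) :=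
    (((summable_boseFn (by norm_num) hy).hasSum.mul_left _).sub
      ((summable_boseFn (by norm_num) hy).hasSum.mul_left _)).sub (hasSum_geometric_two.mul_right δ)
  have h4 := hasSum_le (fun k => ?_) h3 (h.hasSum_log hy)
  · have h5 : boseFn (3 / 2) y ≤ boseFn (3 / 2) 0 := by
      refine (boseFn_le_exp_mul (by norm_num) hy).trans ?_
      exact mul_le_of_le_one_left (boseFn_nonneg _ _) (Real.exp_le_one_iff.2 hy)
    have h6 := mul_le_mul_of_nonneg_left h5 (Real.sqrt_nonneg (Real.pi / a))
    linarith
  · have hk : (0 : ℝ) < (k : ℝ) + 1 := by positivity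
    set e := Real.exp (y * ((k : ℝ) + 1))
    have he : 0 < e := Real.exp_pos _
    have he1 : e ≤ 1 := Real.exp_le_one_iff.2 (mul_nonpos_of_nonpos_of_nonneg hy hk.le)
    set s := Real.sqrt (Real.pi / (((k : ℝ) + 1) * a))
    have hs0 : 0 ≤ s := Real.sqrt_nonneg _
    have hs := sqrt_le_theta (a := ((k : ℝ) + 1) * a) (by positivity)
    have ht := one_le_theta (a := ((k : ℝ) + 1) * a) (by positivity)
    -- Losing s instead of 1 is what makes the surface term summable: with the weight e/(k+1) it
    -- decays like (k+1)^{-3/2}, whereas a loss of 1 would leave the harmonic series at y = 0. If s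
    -- ≥ 1, then s³ - s ≤ s³ - 1; if s ≤ 1, then s³ - s ≤ 0.
    have h5 : s ^ 3 - s ≤ theta (((k : ℝ) + 1) * a) ^ 3 - 1 := by
      have h6 : s ^ 3 ≤ theta (((k : ℝ) + 1) * a) ^ 3 := by gcongr
      have h7 : (1 : ℝ) ≤ theta (((k : ℝ) + 1) * a) ^ 3 := one_le_pow₀ ht
      rcases le_total 1 s with h8 | h8
      · linarith
      · nlinarith [mul_nonneg hs0 (sub_nonneg.2 (pow_le_one₀ hs0 h8 : s ^ 2 ≤ 1))]
    have h6 := h.le_sum_gaussian k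
    have e1 : s = Real.sqrt (Real.pi / a) * ((k : ℝ) + 1) ^ (-(1 / 2) : ℝ) := by
      simp only [s]
      rw [mul_comm, ← div_div, Real.sqrt_div (by positivity), Real.sqrt_eq_rpow ((k : ℝ) + 1),
        Real.rpow_neg hk.le, div_eq_mul_inv]
    have e2 : s ^ 3 = (Real.pi / a) ^ (3 / 2 : ℝ) * ((k : ℝ) + 1) ^ (-(3 / 2) : ℝ) := by
      rw [e1, mul_pow, sqrt_pow_three (by positivity), ← Real.rpow_natCast, ← Real.rpow_mul hk.le]
      norm_num
    have e3 : ((k : ℝ) + 1) ^ (-(5 / 2) : ℝ) = ((k : ℝ) + 1) ^ (-(3 / 2) : ℝ) / ((k : ℝ) + 1) := by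
      rw [← Real.rpow_sub_one hk.ne']; norm_num
    have e4 : ((k : ℝ) + 1) ^ (-(3 / 2) : ℝ) = ((k : ℝ) + 1) ^ (-(1 / 2) : ℝ) / ((k : ℝ) + 1) := by
      rw [← Real.rpow_sub_one hk.ne']; norm_num
    have h7 : e / ((k : ℝ) + 1) * (s ^ 3 - s - (1 / 2) ^ k * δ) ≤
        e / ((k : ℝ) + 1) * ∑ n ∈ P, Real.exp (-(((k : ℝ) + 1) * a * labelSq n)) := by
      gcongr
      linarith
    have h8 : e / ((k : ℝ) + 1) * ((1 / 2) ^ k * δ) ≤ (1 / 2) ^ k * δ := by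
      refine mul_le_of_le_one_left (by positivity) ?_
      rw [div_le_one hk]
      linarith [(Nat.cast_nonneg k : (0 : ℝ) ≤ k)]
    have h9 : (Real.pi / a) ^ (3 / 2 : ℝ) * (e * ((k : ℝ) + 1) ^ (-(5 / 2) : ℝ)) =
        e / ((k : ℝ) + 1) * s ^ 3 := by rw [e2, e3]; ring
    have h10 : Real.sqrt (Real.pi / a) * (e * ((k : ℝ) + 1) ^ (-(3 / 2) : ℝ)) =
        e / ((k : ℝ) + 1) * s := by rw [e1, e4]; ring
    rw [h9, h10]
    linarith

/-- With x the fugacity at y = 0, e^y x / (1 - e^y x) ≤ e^y x / (1 - x). The factor e^y empties the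
modes as y → -∞ and later controls -y. -/
theorem meanNumber_le_fullNumber (h : Cutoffs a E P K) {y : ℝ} (hy : y ≤ 0) :
    meanNumber a P K y ≤ Real.exp y * fullNumber a P := by
  rw [meanNumber, fullNumber, Finset.mul_sum]
  refine Finset.sum_le_sum fun n hn => ?_
  refine (truncMean_le _ (fugacity_pos a y n).le (h.fugacity_lt_one hy hn)).trans ?_
  have e : fugacity a y n = Real.exp y * fugacity a 0 n := by
    rw [fugacity, fugacity, ← Real.exp_add]; ring_nf
  have h1 := h.fugacity_lt_one le_rfl hn
  have h2 : fugacity a y n ≤ fugacity a 0 n := by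
    rw [e]; exact mul_le_of_le_one_left (fugacity_pos a 0 n).le (Real.exp_le_one_iff.2 hy)
  have h3 := fugacity_pos a 0 n
  rw [← mul_div_assoc, ← e]
  have h4 := fugacity_pos a y n
  gcongr

theorem summable_theta_sub_one (ha : 0 < a) :
    Summable fun k : ℕ => theta (((k : ℝ) + 1) * a) ^ 3 - 1 := by
  obtain ⟨C, hC, hθ⟩ := exists_theta_bound
  refine ((summable_succ_rpow (s := 3 / 2) (by norm_num)).mul_left
    (C * a ^ (-(3 / 2) : ℝ))).of_nonneg_of_le (fun k => ?_) fun k => ?_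
  · have := one_le_pow₀ (n := 3) (one_le_theta (a := ((k : ℝ) + 1) * a) (by positivity))
    linarith
  · refine (hθ _ (by positivity)).trans (le_of_eq ?_)
    rw [Real.mul_rpow (by positivity) ha.le]
    ring

theorem fullNumber_le (h : Cutoffs a E P K) :
    fullNumber a P ≤ ∑' k : ℕ, (theta (((k : ℝ) + 1) * a) ^ 3 - 1) := by
  have ha := h.pos
  exact hasSum_le (fun k => sum_gaussian_le_sub_one (by positivity) h.zero_notMem)
    h.hasSum_fullNumber (summable_theta_sub_one ha).hasSum

/-- Of 2N + 4, the part 2(N + 1) is the price of truncating occupation numbers and the remaining 2 =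
∑ 2^{-k} that of the missing modes. -/
theorem le_meanNumber_zero (h : Cutoffs a E P K) {N : ℕ} (hN : ∀ n ∈ P, K n ≤ N) :
    ∑' k : ℕ, (theta (((k : ℝ) + 1) * a) ^ 3 - 1) - (2 * N + 4) * cutoffError a E ≤
      meanNumber a P K 0 := by
  have ha := h.pos
  have h1 := hasSum_le (fun k => h.le_sum_gaussian k)
    ((summable_theta_sub_one ha).hasSum.sub (hasSum_geometric_two.mul_right (cutoffError a E)))
    h.hasSum_fullNumber
  have h2 : fullNumber a P - 2 * (N + 1) * ∑ n ∈ P, fugacity a 0 n ^ (K n + 1) ≤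
      meanNumber a P K 0 := by
    rw [meanNumber, fullNumber, Finset.mul_sum, ← Finset.sum_sub_distrib]
    refine Finset.sum_le_sum fun n hn => ?_
    refine le_trans ?_ (le_truncMean (K n) (fugacity_pos a 0 n).le (h.fugacity_lt_one le_rfl hn)
      (h.fugacity_pow_le_half le_rfl hn))
    have h3 : (K n : ℝ) ≤ N := by exact_mod_cast hN n hn
    have h4 := pow_pos (fugacity_pos a 0 n) (K n + 1)
    gcongr
  have h3 := mul_le_mul_of_nonneg_left (h.sum_fugacity_pow_le le_rfl)
    (by positivity : (0 : ℝ) ≤ 2 * (N + 1))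
  linarith

/-- The variance of mode n is at most 16/(a|n|²)², and ∑ |n|^{-4} converges in three dimensions.
Hence the excited number fluctuates by O(1/a), uniformly in y ≤ 0. -/
theorem sum_truncVar_le (h : Cutoffs a E P K) {y : ℝ} (hy : y ≤ 0) :
    ∑ n ∈ P, truncVar (K n) (fugacity a y n) ≤
      16 / a ^ 2 * ∑' n : Mode, labelSq n ^ (-2 : ℝ) := by
  have hs := summable_labelSq_rpow (s := 2) (by norm_num)
  refine le_trans ?_ (mul_le_mul_of_nonneg_left (hs.sum_le_tsum P
    fun n _ => Real.rpow_nonneg (labelSq_nonneg n) _) (by positivity))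
  rw [Finset.mul_sum]
  refine Finset.sum_le_sum fun n hn => ?_
  have h1 := h.energy_pos hn
  refine (truncVar_le _ (fugacity_pos a y n).le (h.fugacity_lt_one hy hn)
    (h.fugacity_pow_le_half hy hn)).trans ?_
  have h2 := div_one_sub_sq_le h1 (fugacity_pos a y n).le (fugacity_le hy n)
  rw [Real.rpow_neg (labelSq_nonneg n), Real.rpow_two]
  refine (mul_le_mul_of_nonneg_left h2 (by norm_num)).trans (le_of_eq ?_)
  rw [mul_pow]
  field_simp
  norm_num

/-- The bound 1/(a|n|²) on the occupation is not summable over all modes. On |n|² ≤ T, a factor T^τ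
buys the decay |n|^{-2-2τ}, summable for τ > 1/2. -/
theorem sum_truncMean_le (h : Cutoffs a E P K) {y : ℝ} (hy : y ≤ 0) {A : Finset Mode}
    (hA : A ⊆ P) {T τ : ℝ} (hT0 : 0 ≤ T) (hT : ∀ n ∈ A, labelSq n ≤ T) (hτ : 1 / 2 < τ) :
    ∑ n ∈ A, truncMean (K n) (fugacity a y n) ≤
      T ^ τ / a * ∑' n : Mode, labelSq n ^ (-(1 + τ)) := by
  have ha := h.pos
  have hs := summable_labelSq_rpow (s := 1 + τ) (by linarith)
  refine le_trans ?_ (mul_le_mul_of_nonneg_left (hs.sum_le_tsum A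
    fun n _ => Real.rpow_nonneg (labelSq_nonneg n) _) (by positivity))
  rw [Finset.mul_sum]
  refine Finset.sum_le_sum fun n hn => ?_
  have h1 := h.energy_pos (hA hn)
  have hq := zero_lt_one.trans_le (one_le_labelSq (h.ne_zero (hA hn)))
  refine (truncMean_le _ (fugacity_pos a y n).le (h.fugacity_lt_one hy (hA hn))).trans ?_
  refine (div_one_sub_le h1 (fugacity_le hy n)).trans ?_
  have h2 : labelSq n ^ τ ≤ T ^ τ := Real.rpow_le_rpow hq.le (hT n hn) (by linarith)
  have h3 : labelSq n ^ (-(1 + τ)) = (labelSq n * labelSq n ^ τ)⁻¹ := by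
    rw [Real.rpow_neg hq.le, Real.rpow_add hq, Real.rpow_one]
  have h4 : 0 < labelSq n ^ τ := Real.rpow_pos_of_pos hq _
  rw [h3]
  calc 1 / (a * labelSq n) = labelSq n ^ τ / a * (labelSq n * labelSq n ^ τ)⁻¹ := by field_simp
    _ ≤ _ := by gcongr

theorem continuous_meanNumber : Continuous (meanNumber a P K) := by
  refine continuous_finsetSum _ fun n _ => ?_
  exact (continuousOn_truncMean (K n)).comp_continuous (by unfold fugacity; fun_prop)
    fun y => (fugacity_pos a y n).le

/-- The chemical potential of a gas of mean particle number at most `N`. -/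
theorem exists_meanNumber_eq (h : Cutoffs a E P K) {N : ℝ} (hN : 0 < N) :
    ∃ y ≤ 0, meanNumber a P K y = min (meanNumber a P K 0) N ∧
      (y = 0 ∨ meanNumber a P K y = N) ∧ -y * N ≤ fullNumber a P := by
  have hB : 0 ≤ fullNumber a P := Finset.sum_nonneg fun n hn =>
    div_nonneg (fugacity_pos a 0 n).le (sub_nonneg.2 (h.fugacity_lt_one le_rfl hn).le)
  rcases le_total (meanNumber a P K 0) N with h1 | h1
  · exact ⟨0, le_rfl, by rw [min_eq_left h1], .inl rfl, by simpa using hB⟩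
  · obtain ⟨y₁, hy₁0, hy₁⟩ : ∃ y₁ ≤ 0, meanNumber a P K y₁ ≤ N := by
      have h2 : Tendsto (fun y => Real.exp y * fullNumber a P) atBot (𝓝 (0 * fullNumber a P)) :=
        Real.tendsto_exp_atBot.mul_const _
      rw [zero_mul] at h2
      obtain ⟨y, hy1, hy2⟩ := ((h2.eventually (gt_mem_nhds hN)).and (eventually_le_atBot 0)).exists
      exact ⟨y, hy2, (h.meanNumber_le_fullNumber hy2).trans hy1.le⟩
    obtain ⟨y, hy, hyN⟩ := intermediate_value_Icc hy₁0
      (continuous_meanNumber (a := a) (P := P) (K := K)).continuousOn ⟨hy₁, h1⟩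
    refine ⟨y, hy.2, by rw [min_eq_right h1, hyN], .inr hyN, ?_⟩
    have h3 := h.meanNumber_le_fullNumber hy.2
    rw [hyN] at h3
    -- The bound on -y comes from -y ≤ e^{-y} and N ≤ e^y · `fullNumber`.
    have h4 := Real.add_one_le_exp (-y)
    have h5 : Real.exp y * Real.exp (-y) = 1 := by rw [← Real.exp_add]; simp
    calc -y * N ≤ Real.exp (-y) * N := by gcongr; linarith
      _ ≤ Real.exp (-y) * (Real.exp y * fullNumber a P) := by gcongr
      _ = fullNumber a P := by linear_combination (fullNumber a P) * h5

end Cutoffs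


/-! ### Occupation numbers with prescribed values on a finite set of modes -/

/-- The occupation numbers `f` on `P`, with the remaining ones of `N` particles in the mode `0`. -/
noncomputable def occOf (N : ℕ) (P : Finset Mode) (f : P → ℕ) : Occ :=
  Finsupp.single 0 (N - ∑ i, f i) + ∑ i : P, Finsupp.single (i : Mode) (f i)

theorem occOf_apply {N : ℕ} {P : Finset Mode} (h0 : (0 : Mode) ∉ P) (f : P → ℕ) (i : P) :
    occOf N P f i = f i := by
  classical
  have hi : (0 : Mode) ≠ i := fun h => h0 (h ▸ i.2)
  rw [occOf, Finsupp.add_apply, Finsupp.single_eq_of_ne' hi, zero_add, Finsupp.finsetSum_apply,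
    Finset.sum_eq_single_of_mem i (Finset.mem_univ i), Finsupp.single_eq_same]
  intro j _ hj
  exact Finsupp.single_eq_of_ne' (fun h => hj (Subtype.ext h))

theorem occOf_apply_zero {N : ℕ} {P : Finset Mode} (h0 : (0 : Mode) ∉ P) (f : P → ℕ) :
    occOf N P f 0 = N - ∑ i, f i := by
  have e : ∑ i : P, Finsupp.single (i : Mode) (f i) 0 = 0 := Finset.sum_eq_zero fun j _ =>
    Finsupp.single_eq_of_ne' (fun h => h0 (h ▸ j.2))
  rw [occOf, Finsupp.add_apply, Finsupp.single_eq_same, Finsupp.finsetSum_apply, e, add_zero]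

theorem support_occOf (N : ℕ) (P : Finset Mode) (f : P → ℕ) :
    ((occOf N P f).support : Set Mode) ⊆ insert 0 (P : Set Mode) := by
  intro n hn
  by_contra h
  simp only [Set.mem_insert_iff, Finset.mem_coe, not_or] at h
  have : occOf N P f n = 0 := by
    rw [occOf, Finsupp.add_apply, Finsupp.single_eq_of_ne h.1, Finsupp.finsetSum_apply,
      Finset.sum_eq_zero, add_zero]
    intro j _
    exact Finsupp.single_eq_of_ne (fun e => h.2 (e ▸ j.2))
  simp [this] at hn

theorem sum_occOf {N : ℕ} {P : Finset Mode} {f : P → ℕ} (hf : ∑ i, f i ≤ N) :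
    ((occOf N P f).sum fun _ m => m) = N := by
  rw [occOf, Finsupp.sum_add_index' (fun _ => rfl) (fun _ _ _ => rfl),
    ← Finsupp.sum_finsetSum_index (fun _ => rfl) (fun _ _ _ => rfl)]
  simp only [Finsupp.sum_single_index]
  omega

theorem norm_momentum_sq (L : ℝ) (n : Mode) :
    ‖momentum L n‖ ^ 2 = (2 * Real.pi / L) ^ 2 * labelSq n := by
  rw [EuclideanSpace.norm_sq_eq, labelSq, Finset.mul_sum]
  refine Finset.sum_congr rfl fun i _ => ?_
  rw [Real.norm_eq_abs, sq_abs, momentum, mul_pow]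

theorem kinetic_occOf (L : ℝ) (N : ℕ) (P : Finset Mode) (f : P → ℕ) :
    kinetic L (occOf N P f) = (2 * Real.pi / L) ^ 2 * ∑ i : P, labelSq i * f i := by
  have ha : ∀ p : Mode, ‖momentum L p‖ ^ 2 * ((0 : ℕ) : ℝ) = 0 := by simp
  have hb : ∀ (p : Mode) (m m' : ℕ), ‖momentum L p‖ ^ 2 * ((m + m' : ℕ) : ℝ) =
      ‖momentum L p‖ ^ 2 * m + ‖momentum L p‖ ^ 2 * m' := by intros; push_cast; ring
  rw [kinetic, occOf, Finsupp.sum_add_index' ha hb, ← Finsupp.sum_finsetSum_index ha hb,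
    Finsupp.sum_single_index (ha 0), norm_momentum_sq, labelSq_zero, mul_zero, zero_mul, zero_add,
    Finset.mul_sum]
  refine Finset.sum_congr rfl fun i _ => ?_
  rw [Finsupp.sum_single_index (ha _), norm_momentum_sq, mul_assoc]

theorem occOf_injective {N : ℕ} {P : Finset Mode} (h0 : (0 : Mode) ∉ P) :
    Function.Injective (occOf N P) := by
  intro f g h
  ext i
  rw [← occOf_apply (N := N) h0 f i, h, occOf_apply h0]

/-- A lower bound on the canonical partition function, restricted to typical occupation numbers. -/
theorem Cutoffs.exists_typical {a E : ℝ} {P : Finset Mode} {K : Mode → ℕ} (h : Cutoffs a E P K)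
    {L β : ℝ} (haL : a = β * (2 * Real.pi / L) ^ 2) {y : ℝ} (hy : y ≤ 0) {A : Finset Mode}
    (hA : A ⊆ P) {w v : ℝ} (hw : 0 < w) (hv : 0 < v)
    (hvar : ∑ n ∈ P, truncVar (K n) (fugacity a y n) ≤ w ^ 2 / 4)
    (hmean : ∑ n ∈ A, truncMean (K n) (fugacity a y n) ≤ v / 4)
    {N : ℕ} (hN : meanNumber a P K y + w ≤ N) :
    ∃ S : Finset Occ,
      (∀ α ∈ S, (α.support : Set Mode) ⊆ insert 0 (P : Set Mode) ∧ (α.sum fun _ m => m) = N ∧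
        (∀ n ∈ P, α n ≤ K n) ∧ |(N : ℝ) - α 0 - meanNumber a P K y| ≤ w ∧
        ∑ n ∈ A, (α n : ℝ) ≤ v) ∧
      Real.exp (-y * (meanNumber a P K y - w)) *
        ((∏ n ∈ P, truncZ (K n) (fugacity a y n)) / 2) ≤
        ∑ α ∈ S, Real.exp (-(β * kinetic L α)) := by
  classical
  set x : P → ℝ := fun i => fugacity a y i
  set k : P → ℕ := fun i => K i
  set A' : Finset P := A.subtype (fun n => n ∈ P)
  have hsumA : ∀ F : Mode → ℝ, ∑ i ∈ A', F i = ∑ n ∈ A, F n := fun F =>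
    Finset.sum_subtype_of_mem F fun n hn => hA hn
  have hsumP : ∀ F : Mode → ℝ, ∑ i : P, F i = ∑ n ∈ P, F n := fun F => Finset.sum_coe_sort P F
  have hch := half_prod_le_sum_filter k x (fun i => (fugacity_pos a y i).le) A' hw hv
    (by rw [hsumP (fun n => truncVar (K n) (fugacity a y n))]; exact hvar)
    (by rw [hsumA (fun n => truncMean (K n) (fugacity a y n))]; exact hmean)
  set G := (Fintype.piFinset fun i => Finset.range (k i + 1)).filter
        (fun f => |∑ i, ((f i : ℝ) - truncMean (k i) (x i))| ≤ w ∧ ∑ i ∈ A', (f i : ℝ) ≤ v)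
  have hmean' : ∀ f : P → ℕ, ∑ i, ((f i : ℝ) - truncMean (k i) (x i)) =
      ((∑ i, f i : ℕ) : ℝ) - meanNumber a P K y := by
    intro f
    rw [Finset.sum_sub_distrib, hsumP (fun n => truncMean (K n) (fugacity a y n)), meanNumber]
    push_cast; rfl
  have hG : ∀ f ∈ G, (∀ i, f i ≤ K i) ∧ |((∑ i, f i : ℕ) : ℝ) - meanNumber a P K y| ≤ w ∧
      ∑ i ∈ A', (f i : ℝ) ≤ v := by
    intro f hf
    obtain ⟨h1, h2, h3⟩ := Finset.mem_filter.1 hf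
    rw [hmean'] at h2
    refine ⟨fun i => ?_, h2, h3⟩
    have := Finset.mem_range.1 (Fintype.mem_piFinset.1 h1 i)
    simp only [k] at this; omega
  refine ⟨G.image (occOf N P), ?_, ?_⟩
  · intro α hα
    obtain ⟨f, hf, rfl⟩ := Finset.mem_image.1 hα
    obtain ⟨h1, h2, h3⟩ := hG f hf
    have hle : ∑ i, f i ≤ N := by
      have := (abs_le.1 h2).2
      have : ((∑ i, f i : ℕ) : ℝ) ≤ N := by linarith
      exact_mod_cast this
    refine ⟨support_occOf N P f, sum_occOf hle, ?_, ?_, ?_⟩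
    · intro n hn
      rw [occOf_apply h.zero_notMem f ⟨n, hn⟩]
      exact h1 ⟨n, hn⟩
    · rw [occOf_apply_zero h.zero_notMem, Nat.cast_sub hle, sub_sub_cancel]
      exact h2
    · rw [← hsumA (fun n => (occOf N P f n : ℝ))]
      simp_rw [occOf_apply h.zero_notMem f]
      exact h3
  · rw [Finset.sum_image fun f _ g _ hfg => occOf_injective h.zero_notMem hfg,
      ← Finset.prod_coe_sort P (fun n => truncZ (K n) (fugacity a y n))]
    refine (mul_le_mul_of_nonneg_left hch (Real.exp_pos _).le).trans ?_
    rw [Finset.mul_sum]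
    refine Finset.sum_le_sum fun f hf => ?_
    obtain ⟨_, h2, _⟩ := hG f hf
    have e1 : ∏ i, x i ^ f i = Real.exp (y * ((∑ i, f i : ℕ) : ℝ) -
        β * kinetic L (occOf N P f)) := by
      simp only [x, fugacity]
      simp_rw [← Real.exp_nat_mul]
      rw [← Real.exp_sum, kinetic_occOf, haL]
      congr 1
      push_cast
      rw [Finset.mul_sum, Finset.mul_sum, Finset.mul_sum, ← Finset.sum_sub_distrib]
      exact Finset.sum_congr rfl fun i _ => by ring
    -- Passing from grand-canonical to canonical weights multiplies by e^{-yn}, n being the excited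
    -- number. Since y ≤ 0 and n ≥ mean - w, this factor is at least e^{-y(mean - w)}.
    rw [e1, ← Real.exp_add, Real.exp_le_exp]
    have := (abs_le.1 h2).1
    nlinarith

/-! ### Gibbs weights -/

/-- The Gibbs weights of the non-interacting energy on a finite set of occupation numbers. -/
noncomputable def gibbs (b L : ℝ) (S : Finset Occ) (α : Occ) : ℝ :=
  (S : Set Occ).indicator
    (fun α => Real.exp (-(b * kinetic L α)) / ∑ γ ∈ S, Real.exp (-(b * kinetic L γ))) α

theorem gibbs_nonneg (b L : ℝ) (S : Finset Occ) (α : Occ) : 0 ≤ gibbs b L S α :=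
  Set.indicator_nonneg (fun _ _ => div_nonneg (Real.exp_pos _).le
    (Finset.sum_nonneg fun _ _ => (Real.exp_pos _).le)) α

theorem gibbs_of_mem {b L : ℝ} {S : Finset Occ} {α : Occ} (h : α ∈ S) : gibbs b L S α =
    Real.exp (-(b * kinetic L α)) / ∑ γ ∈ S, Real.exp (-(b * kinetic L γ)) :=
  Set.indicator_of_mem (by exact_mod_cast h) _

theorem gibbs_of_notMem {b L : ℝ} {S : Finset Occ} {α : Occ} (h : α ∉ S) : gibbs b L S α = 0 :=
  Set.indicator_of_notMem (by exact_mod_cast h) _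

theorem sum_gibbs (b L : ℝ) {S : Finset Occ} (hS : S.Nonempty) : ∑ α ∈ S, gibbs b L S α = 1 := by
  rw [Finset.sum_congr rfl fun α hα => gibbs_of_mem hα, ← Finset.sum_div]
  exact div_self (Finset.sum_pos (fun _ _ => Real.exp_pos _) hS).ne'

theorem sum_M_eq_of_support {ρ : ℝ} (hρ : 0 < ρ) {S : Finset Occ} (hS : ∀ α ∈ S, α ∈ M ρ)
    {F : Occ → ℝ} (hF : ∀ α ∉ S, F α = 0) :
    ∑ α ∈ (finite_M ρ hρ).toFinset, F α = ∑ α ∈ S, F α :=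
  (Finset.sum_subset (fun α hα => (finite_M ρ hρ).mem_toFinset.2 (hS α hα))
    fun α _ hα => hF α hα).symm

theorem finsum_gibbs {ρ : ℝ} (hρ : 0 < ρ) (b L : ℝ) {S : Finset Occ} (hne : S.Nonempty)
    (hS : ∀ α ∈ S, α ∈ M ρ) : (∑ᶠ α ∈ M ρ, gibbs b L S α) = 1 := by
  rw [finsum_mem_eq_finite_toFinset_sum _ (finite_M ρ hρ),
    sum_M_eq_of_support hρ hS fun α hα => gibbs_of_notMem hα, sum_gibbs b L hne]

theorem abs_finsum_mul_gibbs_sub_le {ρ : ℝ} (hρ : 0 < ρ) (b L : ℝ) {S : Finset Occ}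
    (hne : S.Nonempty) (hS : ∀ α ∈ S, α ∈ M ρ) {F : Occ → ℝ} {l ε : ℝ}
    (hF : ∀ α ∈ S, |F α - l| ≤ ε) : |(∑ᶠ α ∈ M ρ, F α * gibbs b L S α) - l| ≤ ε := by
  rw [finsum_mem_eq_finite_toFinset_sum _ (finite_M ρ hρ),
    sum_M_eq_of_support hρ hS fun α hα => by rw [gibbs_of_notMem hα, mul_zero]]
  have e : ∑ α ∈ S, F α * gibbs b L S α - l = ∑ α ∈ S, (F α - l) * gibbs b L S α := by
    simp_rw [sub_mul]
    rw [Finset.sum_sub_distrib, ← Finset.mul_sum, sum_gibbs b L hne, mul_one]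
  rw [e]
  calc _ ≤ ∑ α ∈ S, |(F α - l) * gibbs b L S α| := Finset.abs_sum_le_sum_abs _ _
    _ ≤ ∑ α ∈ S, ε * gibbs b L S α := by
        refine Finset.sum_le_sum fun α hα => ?_
        rw [abs_mul, abs_of_nonneg (gibbs_nonneg b L S α)]
        exact mul_le_mul_of_nonneg_right (hF α hα) (gibbs_nonneg b L S α)
    _ = ε := by rw [← Finset.mul_sum, sum_gibbs b L hne, mul_one]

/-- For Gibbs weights -ln g_α is b times the kinetic energy plus ln Z, so the kinetic part of the
free energy is exactly -ln Z / b. The interaction is bounded on each configuration separately,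
through α(0) ≥ m. -/
theorem gibbs_free_energy_le {ρ : ℝ} (hρ : 0 < ρ) {b L : ℝ} (hb : 0 < b) (hL : 0 < L)
    {S : Finset Occ} (hne : S.Nonempty) (hS : ∀ α ∈ S, α ∈ M ρ) {V : Space → ℝ}
    (hV : ∀ x, 0 ≤ V x) (hi : MeasureTheory.Integrable V) {m : ℝ} (hm : 0 ≤ m)
    (hmS : ∀ α ∈ S, m ≤ α 0) :
    energy L V (diagonal ρ (gibbs b L S)) - entropy (diagonal ρ (gibbs b L S)) / b ≤
      -Real.log (∑ α ∈ S, Real.exp (-(b * kinetic L α))) / b +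
        1 / L ^ 3 * ((∫ x, V x) / 2 * (2 * (particleNumber ρ : ℝ) ^ 2 - m ^ 2)) := by
  set Z := ∑ α ∈ S, Real.exp (-(b * kinetic L α))
  have hZ : 0 < Z := Finset.sum_pos (fun _ _ => Real.exp_pos _) hne
  set I := 1 / L ^ 3 * ((∫ x, V x) / 2 * (2 * (particleNumber ρ : ℝ) ^ 2 - m ^ 2))
  have hv : 0 ≤ ∫ x, V x := MeasureTheory.integral_nonneg hV
  have h1 : energy L V (diagonal ρ (gibbs b L S)) ≤ ∑ α ∈ S, gibbs b L S α * (kinetic L α + I) := by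
    rw [energy_diagonal ρ hρ, sum_M_eq_of_support hρ hS fun α hα => by
      rw [gibbs_of_notMem hα, zero_mul]]
    refine Finset.sum_le_sum fun α hα => mul_le_mul_of_nonneg_left ?_ (gibbs_nonneg b L S α)
    refine (re_hamiltonian_ket_le L hL V hV hi α).trans ?_
    have hα0 := hmS α hα
    rw [(hS α hα).1.2]
    simp only [I]
    gcongr
    nlinarith
  have h2 : entropy (diagonal ρ (gibbs b L S)) =
      ∑ α ∈ S, gibbs b L S α * (b * kinetic L α + Real.log Z) := by
    rw [entropy_diagonal ρ hρ _ (gibbs_nonneg b L S), sum_M_eq_of_support hρ hS fun α hα => by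
      rw [gibbs_of_notMem hα, Real.negMulLog_zero]]
    refine Finset.sum_congr rfl fun α hα => ?_
    rw [Real.negMulLog, gibbs_of_mem hα, Real.log_div (Real.exp_pos _).ne' hZ.ne', Real.log_exp]
    ring
  have h3 := sum_gibbs b L hne
  simp_rw [mul_add] at h1 h2
  rw [Finset.sum_add_distrib, ← Finset.sum_mul, h3, one_mul] at h1 h2
  have h4 : ∑ α ∈ S, gibbs b L S α * (b * kinetic L α) =
      b * ∑ α ∈ S, gibbs b L S α * kinetic L α := by
    rw [Finset.mul_sum]; exact Finset.sum_congr rfl fun α _ => by ring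
  rw [h2, h4]
  have h5 : (b * ∑ α ∈ S, gibbs b L S α * kinetic L α + Real.log Z) / b =
      ∑ α ∈ S, gibbs b L S α * kinetic L α + Real.log Z / b := by field_simp
  rw [h5, neg_div]
  linarith

/-! ### The number of pairs -/

theorem boxSide_pos {ρ : ℝ} (hρ : 0 < ρ) : 0 < boxSide ρ := by unfold boxSide; positivity

theorem finite_PI {ρ : ℝ} (hρ : 0 < ρ) : (PI ρ).Finite :=
  (finite_modes _ _ (boxSide_pos hρ)).subset fun _ hn => hn.2.le

theorem finite_PL {ρ : ℝ} (hρ : 0 < ρ) : (PL ρ).Finite :=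
  (finite_modes _ _ (boxSide_pos hρ)).subset fun _ hn => hn.2

theorem momentum_zero (L : ℝ) : momentum L 0 = 0 := by
  ext i; simp [momentum]

theorem zero_notMem_PI (ρ : ℝ) : (0 : Mode) ∉ PI ρ := fun h => by
  have := h.1
  rw [momentum_zero, norm_zero] at this
  exact this.false

theorem zero_notMem_PL {ρ : ℝ} (hρ : 0 < ρ) : (0 : Mode) ∉ PL ρ := fun h => by
  have := h.1
  rw [momentum_zero, norm_zero] at this
  have h2 : 0 < cutoff ρ * ρ ^ (1 / 3 : ℝ) := by unfold cutoff; positivity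
  linarith

theorem disjoint_PI_PL (ρ : ℝ) : Disjoint (PI ρ) (PL ρ) :=
  Set.disjoint_left.2 fun _ h1 h2 => absurd h2.1 (not_le.2 h1.2)

/-- Without the restriction u ≠ ±v the double sum would be 2(N - I)², I being the number of
particles in P_I. The excluded pairs with u ∈ P_L number at most two per u, and the bound `mc` on
their occupation makes them negligible against N². -/
theorem abs_pairNumber_sub_le {ρ : ℝ} (hρ : 0 < ρ) {α : Occ} (hα : α ∈ M ρ) :
    |pairNumber ρ α - (2 * ((particleNumber ρ : ℝ) -
      ∑ n ∈ (finite_PI hρ).toFinset, (α n : ℝ)) ^ 2 - (α 0 : ℝ) ^ 2)| ≤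
      4 * mc ρ * particleNumber ρ := by
  classical
  set Q := (finite_PL hρ).toFinset
  have h0 : (0 : Mode) ∉ Q := by simpa [Q] using zero_notMem_PL hρ
  set F := insert 0 Q
  have hF : ∀ n, n ∈ F ↔ n ∈ PL ρ ∪ P0 := by
    intro n; simp [F, Q, P0, or_comm]
  have hmc : 0 ≤ mc ρ := by unfold mc; positivity
  have hN : (particleNumber ρ : ℝ) - ∑ n ∈ (finite_PI hρ).toFinset, (α n : ℝ) =
      ∑ n ∈ F, (α n : ℝ) := by
    have hd : Disjoint F (finite_PI hρ).toFinset := by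
      rw [Finset.disjoint_insert_left]
      refine ⟨by simpa using zero_notMem_PI ρ, ?_⟩
      rw [Set.Finite.disjoint_toFinset]
      exact (disjoint_PI_PL ρ).symm
    have h1 : (particleNumber ρ : ℝ) = ∑ n ∈ F ∪ (finite_PI hρ).toFinset, (α n : ℝ) := by
      rw [← hα.1.2, Finsupp.sum]
      push_cast
      refine Finset.sum_subset (fun n hn => ?_) fun n _ hn => by simpa using hn
      have := hα.2.1 hn
      rw [Finset.mem_union, hF]
      simp only [Set.Finite.mem_toFinset, Set.mem_union] at this ⊢
      tauto
    rw [h1, Finset.sum_union hd]; ring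
  have hQN : ∑ n ∈ Q, (α n : ℝ) ≤ particleNumber ρ := by
    have h1 : ∑ n ∈ Q, (α n : ℝ) ≤ ∑ n ∈ F, (α n : ℝ) :=
      Finset.sum_le_sum_of_subset_of_nonneg (Finset.subset_insert _ _) fun _ _ _ => by positivity
    have h2 : (0 : ℝ) ≤ ∑ n ∈ (finite_PI hρ).toFinset, (α n : ℝ) :=
      Finset.sum_nonneg fun _ _ => by positivity
    linarith
  rw [hN]
  have hpair : pairNumber ρ α = (α 0 : ℝ) * α 0 +
      ∑ u ∈ F, ∑ v ∈ F, if u ≠ v ∧ u ≠ -v then 2 * (α u : ℝ) * α v else 0 := by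
    rw [pairNumber]
    congr 1
    rw [← Finset.sum_product', ← Finset.sum_filter, ← finsum_mem_coe_finset]
    refine finsum_congr fun x => finsum_congr_Prop ?_ fun _ => rfl
    rw [Finset.mem_coe, Finset.mem_filter, Finset.mem_product, hF, hF, and_assoc]
  have hbad : ∑ u ∈ F, ∑ v ∈ F, (if u ≠ v ∧ u ≠ -v then 2 * (α u : ℝ) * α v else 0) =
      2 * (∑ n ∈ F, (α n : ℝ)) ^ 2 -
        2 * ∑ u ∈ F, ∑ v ∈ F, if u ≠ v ∧ u ≠ -v then 0 else (α u : ℝ) * α v := by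
    rw [sq, Finset.sum_mul_sum, ← mul_sub, ← Finset.sum_sub_distrib, Finset.mul_sum]
    refine Finset.sum_congr rfl fun u _ => ?_
    rw [← Finset.sum_sub_distrib, Finset.mul_sum]
    refine Finset.sum_congr rfl fun v _ => ?_
    split_ifs <;> ring
  -- For u = 0 the only excluded partner is v = 0. It removes 2α(0)², while the separate condensate
  -- term restores only α(0)².
  have hzero : ∑ v ∈ F, (if (0 : Mode) ≠ v ∧ (0 : Mode) ≠ -v then 0 else (α 0 : ℝ) * α v) =
      (α 0 : ℝ) ^ 2 := by
    rw [Finset.sum_eq_single_of_mem 0 (Finset.mem_insert_self _ _)]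
    · simp [sq]
    · intro v _ hv
      rw [if_pos ⟨hv.symm, fun h => hv (by simpa using h.symm)⟩]
  have hQ : ∀ u ∈ Q, ∑ v ∈ F, (if u ≠ v ∧ u ≠ -v then 0 else (α u : ℝ) * α v) ≤
      (α u : ℝ) * (2 * mc ρ) := by
    intro u hu
    have hu0 : u ≠ 0 := by rintro rfl; exact h0 hu
    have e : ∀ v ∈ F, (if u ≠ v ∧ u ≠ -v then 0 else (α u : ℝ) * α v) ≤
        if u = v ∨ -u = v then (α u : ℝ) * mc ρ else 0 := by
      intro v hv
      by_cases hc : u ≠ v ∧ u ≠ -v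
      · rw [if_pos hc]; split_ifs <;> positivity
      · have hc' : u = v ∨ -u = v := by
          rw [not_and_or, not_not, not_not] at hc
          exact hc.imp_right fun h => by rw [h, neg_neg]
        rw [if_neg hc, if_pos hc']
        have hvQ : v ∈ PL ρ := by
          have := (hF v).1 hv
          refine this.resolve_right fun h => ?_
          have hv0 : v = 0 := h
          subst hv0
          rcases hc' with h | h
          · exact hu0 h
          · exact hu0 (by simpa using h)
        have := hα.2.2 v hvQ
        gcongr
    refine (Finset.sum_le_sum e).trans ?_
    rw [← Finset.sum_filter, Finset.sum_const, nsmul_eq_mul]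
    have hcard : (F.filter fun v => u = v ∨ -u = v).card ≤ 2 := by
      refine (Finset.card_le_card (t := {u, -u}) fun v hv => ?_).trans Finset.card_le_two
      have := (Finset.mem_filter.1 hv).2
      simp only [Finset.mem_insert, Finset.mem_singleton]
      exact this.imp Eq.symm Eq.symm
    have hcard' : ((F.filter fun v => u = v ∨ -u = v).card : ℝ) ≤ 2 := by exact_mod_cast hcard
    calc _ ≤ 2 * ((α u : ℝ) * mc ρ) := by gcongr
      _ = _ := by ring
  have hup : ∑ u ∈ Q, ∑ v ∈ F, (if u ≠ v ∧ u ≠ -v then 0 else (α u : ℝ) * α v) ≤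
      2 * mc ρ * particleNumber ρ := by
    refine (Finset.sum_le_sum hQ).trans ?_
    rw [← Finset.sum_mul]
    nlinarith
  have hlow : 0 ≤ ∑ u ∈ Q, ∑ v ∈ F, (if u ≠ v ∧ u ≠ -v then 0 else (α u : ℝ) * α v) :=
    Finset.sum_nonneg fun u _ => Finset.sum_nonneg fun v _ => by split_ifs <;> positivity
  rw [hpair, hbad, Finset.sum_insert h0 (f := fun u => ∑ v ∈ F,
    if u ≠ v ∧ u ≠ -v then 0 else (α u : ℝ) * α v), hzero, abs_le]
  constructor <;> nlinarith


/-! ### The trial state at fixed density -/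

/-- The ratio `β(2π/L)²` of the lowest excitation energy and the temperature. -/
noncomputable def gapRatio (β ρ : ℝ) : ℝ := β * (2 * Real.pi / boxSide ρ) ^ 2

/-- The maximal occupation numbers. -/
noncomputable def maxOcc (ρ : ℝ) (n : Mode) : ℕ :=
  open Classical in if n ∈ PL ρ then ⌊mc ρ⌋₊ else particleNumber ρ

/-- The non-zero modes of the trial state. -/
noncomputable def excitedModes {ρ : ℝ} (hρ : 0 < ρ) : Finset Mode :=
  open Classical in (finite_PI hρ).toFinset ∪ (finite_PL hρ).toFinset

theorem mem_excitedModes {ρ : ℝ} (hρ : 0 < ρ) (n : Mode) :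
    n ∈ excitedModes hρ ↔ n ∈ PI ρ ∨ n ∈ PL ρ := by simp [excitedModes]

theorem boxSide_pow_three {ρ : ℝ} (hρ : 0 < ρ) : boxSide ρ ^ 3 = ρ ^ (-(41 / 20) : ℝ) := by
  rw [boxSide, ← Real.rpow_natCast, ← Real.rpow_mul hρ.le]; norm_num

/-- L^{-2} = ρ^{41/30} and 41/30 = 2/3 + 7/10, so the ratio is of order ρ^{7/10} when β is of order
ρ^{-2/3}. -/
theorem gapRatio_eq {ρ : ℝ} (hρ : 0 < ρ) (β : ℝ) :
    gapRatio β ρ = 4 * Real.pi ^ 2 * (ρ ^ (2 / 3 : ℝ) * β) * ρ ^ (7 / 10 : ℝ) := by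
  have h1 : (boxSide ρ ^ 2)⁻¹ = ρ ^ (2 / 3 : ℝ) * ρ ^ (7 / 10 : ℝ) := by
    rw [boxSide, ← Real.rpow_natCast, ← Real.rpow_mul hρ.le, ← Real.rpow_neg hρ.le,
      ← Real.rpow_add hρ]
    norm_num
  rw [gapRatio, div_pow, div_eq_mul_inv, h1]
  ring

theorem gapRatio_mul_labelSq (β ρ : ℝ) (n : Mode) :
    gapRatio β ρ * labelSq n = β * ‖momentum (boxSide ρ) n‖ ^ 2 := by
  rw [norm_momentum_sq, gapRatio, mul_assoc]

theorem pi_div_gapRatio_rpow {β ρ : ℝ} (hρ : 0 < ρ) (hβ : 0 < β) :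
    (Real.pi / gapRatio β ρ) ^ (3 / 2 : ℝ) =
      boxSide ρ ^ 3 * (4 * Real.pi * β) ^ (-(3 / 2) : ℝ) := by
  have hL := boxSide_pos hρ
  have hpi := Real.pi_pos
  have h1 : Real.pi / gapRatio β ρ = boxSide ρ ^ 2 * (4 * Real.pi * β)⁻¹ := by
    rw [gapRatio]; field_simp; ring
  rw [h1, Real.mul_rpow (by positivity) (by positivity), Real.rpow_neg (by positivity),
    Real.inv_rpow (by positivity), ← Real.rpow_natCast, ← Real.rpow_natCast,
    ← Real.rpow_mul hL.le]
  norm_num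

/-- With E = βρ^{2/3-η}: beyond P_L, βp² ≥ βρ^{2/3-2η} ≥ E. On P_L, βp² ≥ βρ^{2/3+2η}, and the
maximal occupation ρ^{-3η} restores exactly E. On P_I the bound N suffices, because a(N+1) is at
least of order ρ^{7/10-21/20}, larger than ρ^{-η}. -/
theorem cutoffs_excitedModes {β ρ : ℝ} (hρ : 0 < ρ) (hρ1 : ρ < 1) (hβ : 0 < β)
    (hs : Real.exp (-(ρ ^ (2 / 3 : ℝ) * β * ρ ^ (-eta) / 2)) ≤ 1 / 2) :
    Cutoffs (gapRatio β ρ) (ρ ^ (2 / 3 : ℝ) * β * ρ ^ (-eta)) (excitedModes hρ) (maxOcc ρ) := by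
  have hL := boxSide_pos hρ
  have hpi := Real.pi_pos
  have hη : (0 : ℝ) < eta := by unfold eta; norm_num
  set t := ρ ^ (2 / 3 : ℝ) * β
  have ht : 0 < t := by positivity
  have hcut : ∀ s : ℝ, (ρ ^ s * ρ ^ (1 / 3 : ℝ)) ^ 2 = ρ ^ (2 * s) * ρ ^ (2 / 3 : ℝ) := by
    intro s
    rw [mul_pow, ← Real.rpow_natCast, ← Real.rpow_natCast, ← Real.rpow_mul hρ.le,
      ← Real.rpow_mul hρ.le]
    norm_num [mul_comm]
  refine ⟨by unfold gapRatio; positivity, ?_, ?_, ?_, hs⟩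
  · rw [mem_excitedModes]
    exact fun h => h.elim (zero_notMem_PI ρ) (zero_notMem_PL hρ)
  · intro n hn hn0
    rw [mem_excitedModes, not_or] at hn
    have hpos : 0 < ‖momentum (boxSide ρ) n‖ := by
      have h1 := norm_momentum_sq (boxSide ρ) n
      have h2 := one_le_labelSq hn0
      by_contra hc
      have h3 : ‖momentum (boxSide ρ) n‖ = 0 := le_antisymm (not_lt.1 hc) (norm_nonneg _)
      rw [h3] at h1
      have : 0 < (2 * Real.pi / boxSide ρ) ^ 2 * labelSq n := by positivity
      linarith
    have h1 : cutoff ρ * ρ ^ (1 / 3 : ℝ) ≤ ‖momentum (boxSide ρ) n‖ := by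
      by_contra hc
      exact hn.1 ⟨hpos, not_le.1 hc⟩
    have h2 : (cutoff ρ)⁻¹ * ρ ^ (1 / 3 : ℝ) ≤ ‖momentum (boxSide ρ) n‖ := by
      by_contra hc
      exact hn.2 ⟨h1, (not_le.1 hc).le⟩
    rw [cutoff, ← Real.rpow_neg hρ.le] at h2
    rw [gapRatio_mul_labelSq]
    have h3 : (ρ ^ (-eta) * ρ ^ (1 / 3 : ℝ)) ^ 2 ≤ ‖momentum (boxSide ρ) n‖ ^ 2 := by gcongr
    rw [hcut] at h3
    have h4 : ρ ^ (-eta) ≤ ρ ^ (2 * -eta) :=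
      Real.rpow_le_rpow_of_exponent_ge hρ hρ1.le (by linarith)
    calc t * ρ ^ (-eta) ≤ t * ρ ^ (2 * -eta) := by gcongr
      _ = β * (ρ ^ (2 * -eta) * ρ ^ (2 / 3 : ℝ)) := by simp only [t]; ring
      _ ≤ _ := by gcongr
  · intro n hn
    by_cases hL' : n ∈ PL ρ
    · rw [maxOcc, if_pos hL', gapRatio_mul_labelSq]
      have h2 := hL'.1
      rw [cutoff] at h2
      have h3 : (ρ ^ eta * ρ ^ (1 / 3 : ℝ)) ^ 2 ≤ ‖momentum (boxSide ρ) n‖ ^ 2 := by gcongr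
      rw [hcut] at h3
      have h4 := (Nat.lt_floor_add_one (mc ρ)).le
      rw [mc] at h4 ⊢
      calc t * ρ ^ (-eta) = t * (ρ ^ (2 * eta) * ρ ^ (-(3 * eta))) := by
            rw [← Real.rpow_add hρ]; ring_nf
        _ = β * (ρ ^ (2 * eta) * ρ ^ (2 / 3 : ℝ)) * ρ ^ (-(3 * eta)) := by simp only [t]; ring
        _ ≤ _ := by gcongr
    · rw [maxOcc, if_neg hL']
      have hn0 : n ≠ 0 := by
        rintro rfl
        exact ((mem_excitedModes hρ 0).1 hn).elim (zero_notMem_PI ρ) (zero_notMem_PL hρ)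
      have h1 := one_le_labelSq hn0
      have h2 : ρ ^ (-(21 / 20) : ℝ) ≤ particleNumber ρ + 1 := (Nat.lt_floor_add_one _).le
      have h3 : ρ ^ (-eta) ≤ ρ ^ (7 / 10 : ℝ) * ρ ^ (-(21 / 20) : ℝ) := by
        rw [← Real.rpow_add hρ]
        exact Real.rpow_le_rpow_of_exponent_ge hρ hρ1.le (by rw [eta]; norm_num)
      have h4 : (1 : ℝ) ≤ 4 * Real.pi ^ 2 := by nlinarith [Real.pi_gt_three]
      rw [gapRatio_eq hρ]
      calc t * ρ ^ (-eta) ≤ t * (ρ ^ (7 / 10 : ℝ) * ρ ^ (-(21 / 20) : ℝ)) := by gcongr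
        _ = 1 * t * ρ ^ (7 / 10 : ℝ) * 1 * ρ ^ (-(21 / 20) : ℝ) := by ring
        _ ≤ 4 * Real.pi ^ 2 * t * ρ ^ (7 / 10 : ℝ) * labelSq n * (particleNumber ρ + 1) := by
            gcongr

theorem maxOcc_le {ρ : ℝ} (hρ : 0 < ρ) (hρ1 : ρ < 1) (n : Mode) :
    maxOcc ρ n ≤ particleNumber ρ := by
  rw [maxOcc]
  split_ifs
  · rw [particleNumber]
    refine Nat.floor_le_floor (Real.rpow_le_rpow_of_exponent_ge hρ hρ1.le ?_)
    rw [eta]; norm_num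
  · exact le_rfl

/-- The number `∑_{n ≠ 0} (e^{a|n|²} - 1)⁻¹` of excited particles at the critical point. -/
noncomputable def latticeNumber (a : ℝ) : ℝ := ∑' k : ℕ, (theta (((k : ℝ) + 1) * a) ^ 3 - 1)

/-- The width of the distribution of the number of excited particles. -/
noncomputable def numberWidth (a : ℝ) : ℝ := 8 * ((∑' n : Mode, labelSq n ^ (-2 : ℝ)) + 1) / a

/-- A bound on the number of particles in `P_I`. -/
noncomputable def lowModesBound (a ρ : ℝ) : ℝ :=
  4 * (((cutoff ρ * ρ ^ (1 / 3 : ℝ) * boxSide ρ / (2 * Real.pi)) ^ 2) ^ (101 / 200 : ℝ) / a *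
    ∑' n : Mode, labelSq n ^ (-(1 + 101 / 200) : ℝ)) + 1

/-- The error in `-ln Z`. -/
noncomputable def freeEnergyError (β ρ : ℝ) : ℝ :=
  latticeNumber (gapRatio β ρ) / (particleNumber ρ - numberWidth (gapRatio β ρ)) *
      (1 + 2 * numberWidth (gapRatio β ρ)) +
    Real.sqrt (Real.pi / gapRatio β ρ) * boseFn (3 / 2) 0 +
    4 * cutoffError (gapRatio β ρ) (ρ ^ (2 / 3 : ℝ) * β * ρ ^ (-eta)) + Real.log 2

theorem numberWidth_pos {a : ℝ} (ha : 0 < a) : 0 < numberWidth a := by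
  have : 0 ≤ ∑' n : Mode, labelSq n ^ (-2 : ℝ) :=
    tsum_nonneg fun n => Real.rpow_nonneg (labelSq_nonneg n) _
  unfold numberWidth; positivity

theorem lowModesBound_pos {a ρ : ℝ} (ha : 0 < a) : 0 < lowModesBound a ρ := by
  have : 0 ≤ ∑' n : Mode, labelSq n ^ (-(1 + 101 / 200) : ℝ) :=
    tsum_nonneg fun n => Real.rpow_nonneg (labelSq_nonneg n) _
  unfold lowModesBound; positivity

/-- The lower bound on Z_S and the lower bound on f₀ are taken at the same y, so that the
thermodynamic pressures cancel. The number ν is the mean excited number at y = 0. -/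
theorem exists_trial_occupations {β ρ : ℝ} (hρ : 0 < ρ) (hρ1 : ρ < 1) (hβ : 0 < β)
    (hs : Real.exp (-(ρ ^ (2 / 3 : ℝ) * β * ρ ^ (-eta) / 2)) ≤ 1 / 2)
    (hw : numberWidth (gapRatio β ρ) < particleNumber ρ) :
    ∃ (S : Finset Occ) (ν : ℝ), S.Nonempty ∧ (∀ α ∈ S, α ∈ M ρ) ∧
      ν ≤ latticeNumber (gapRatio β ρ) ∧
      latticeNumber (gapRatio β ρ) - (2 * particleNumber ρ + 4) *
        cutoffError (gapRatio β ρ) (ρ ^ (2 / 3 : ℝ) * β * ρ ^ (-eta)) ≤ ν ∧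
      (∀ α ∈ S, |(α 0 : ℝ) - (particleNumber ρ -
          min ν (particleNumber ρ - numberWidth (gapRatio β ρ)))| ≤
          numberWidth (gapRatio β ρ) ∧
        ∑ n ∈ (finite_PI hρ).toFinset, (α n : ℝ) ≤ lowModesBound (gapRatio β ρ) ρ) ∧
      -Real.log (∑ α ∈ S, Real.exp (-(β * kinetic (boxSide ρ) α))) -
        boxSide ρ ^ 3 * (β * idealFreeEnergy ρ β) ≤ freeEnergyError β ρ := by
  classical
  have h := cutoffs_excitedModes hρ hρ1 hβ hs
  have hL := boxSide_pos hρ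
  have hpi := Real.pi_pos
  rw [freeEnergyError]
  set a := gapRatio β ρ with ha_def
  set E := ρ ^ (2 / 3 : ℝ) * β * ρ ^ (-eta)
  set P := excitedModes hρ
  set K := maxOcc ρ
  set N := particleNumber ρ with hN_def
  set w := numberWidth a with hw_def
  set v := lowModesBound a ρ with hv_def
  have ha : 0 < a := h.pos
  have hw0 : 0 < w := numberWidth_pos ha
  have hv0 : 0 < v := lowModesBound_pos ha
  have hNw : 0 < (N : ℝ) - w := by linarith
  obtain ⟨y, hy, hmin, hor, hyN⟩ := h.exists_meanNumber_eq hNw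
  have hfull : fullNumber a P ≤ latticeNumber a := h.fullNumber_le
  have hA : (finite_PI hρ).toFinset ⊆ P := Finset.subset_union_left
  -- With s the lattice sum of |n|^{-4}, the choice w = 8(s+1)/a gives w²/4 = 16(s+1)²/a², which
  -- dominates the variance bound 16s/a².
  have hvar : ∑ n ∈ P, truncVar (K n) (fugacity a y n) ≤ w ^ 2 / 4 := by
    refine (h.sum_truncVar_le hy).trans ?_
    have hS : 0 ≤ ∑' n : Mode, labelSq n ^ (-2 : ℝ) :=
      tsum_nonneg fun n => Real.rpow_nonneg (labelSq_nonneg n) _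
    rw [hw_def, numberWidth]
    generalize ∑' n : Mode, labelSq n ^ (-2 : ℝ) = s at hS
    have e : (8 * (s + 1) / a) ^ 2 / 4 = 16 / a ^ 2 * (s + 1) ^ 2 := by field_simp; norm_num
    rw [e]
    gcongr
    nlinarith
  have hmean : ∑ n ∈ (finite_PI hρ).toFinset, truncMean (K n) (fugacity a y n) ≤ v / 4 := by
    -- Any τ with 1/2 < τ < 35/69 would serve: the lower limit makes the lattice sum converge, the
    -- upper one makes the bound o(N).
    refine (h.sum_truncMean_le hy hA (τ := 101 / 200) (sq_nonneg
      (cutoff ρ * ρ ^ (1 / 3 : ℝ) * boxSide ρ / (2 * Real.pi))) (fun n hn => ?_)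
      (by norm_num)).trans ?_
    · have hn' : n ∈ PI ρ := by simpa using hn
      have h1 := norm_momentum_sq (boxSide ρ) n
      have h2 : ‖momentum (boxSide ρ) n‖ ^ 2 ≤ (cutoff ρ * ρ ^ (1 / 3 : ℝ)) ^ 2 := by
        have := hn'.2
        gcongr
      rw [h1] at h2
      have h3 : labelSq n = (boxSide ρ / (2 * Real.pi)) ^ 2 *
          ((2 * Real.pi / boxSide ρ) ^ 2 * labelSq n) := by field_simp
      calc labelSq n = (boxSide ρ / (2 * Real.pi)) ^ 2 *
            ((2 * Real.pi / boxSide ρ) ^ 2 * labelSq n) := h3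
        _ ≤ (boxSide ρ / (2 * Real.pi)) ^ 2 * (cutoff ρ * ρ ^ (1 / 3 : ℝ)) ^ 2 :=
            mul_le_mul_of_nonneg_left h2 (sq_nonneg _)
        _ = _ := by ring
    · rw [hv_def, lowModesBound]
      linarith
  have hNle : meanNumber a P K y + w ≤ N := by
    rw [hmin]
    linarith [min_le_right (meanNumber a P K 0) ((N : ℝ) - w)]
  obtain ⟨S, hS, hZ⟩ := h.exists_typical (L := boxSide ρ) (β := β) rfl hy hA hw0 hv0 hvar hmean hNle
  have hprod : 0 < ∏ n ∈ P, truncZ (K n) (fugacity a y n) :=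
    Finset.prod_pos fun n _ => zero_lt_one.trans_le (one_le_truncZ _ (fugacity_pos a y n).le)
  have hlow : 0 < Real.exp (-y * (meanNumber a P K y - w)) *
        ((∏ n ∈ P, truncZ (K n) (fugacity a y n)) / 2) := by positivity
  refine ⟨S, meanNumber a P K 0, ?_, ?_, ?_, ?_, ?_, ?_⟩
  · rw [Finset.nonempty_iff_ne_empty]
    rintro rfl
    rw [Finset.sum_empty] at hZ
    linarith
  · intro α hα
    obtain ⟨h1, h2, h3, _, _⟩ := hS α hα
    have h4 : (α.support : Set Mode) ⊆ P0 ∪ PI ρ ∪ PL ρ := by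
      intro n hn
      rcases h1 hn with h5 | h5
      · exact .inl (.inl h5)
      · rcases (mem_excitedModes hρ n).1 h5 with h6 | h6
        · exact .inl (.inr h6)
        · exact .inr h6
    refine ⟨⟨fun n hn => ?_, h2⟩, h4, fun k hk => ?_⟩
    · rcases h4 hn with (h5 | h5) | h5
      · exact .inl (.inl (.inl h5))
      · exact .inl (.inr h5)
      · exact .inl (.inl (.inr h5))
    · have h5 := h3 k ((mem_excitedModes hρ k).2 (.inr hk))
      simp only [K, maxOcc, if_pos hk] at h5
      exact (Nat.cast_le.2 h5).trans (Nat.floor_le (by unfold mc; positivity))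
  · refine (h.meanNumber_le_fullNumber le_rfl).trans ?_
    rwa [Real.exp_zero, one_mul]
  · exact h.le_meanNumber_zero fun n _ => maxOcc_le hρ hρ1 n
  · intro α hα
    obtain ⟨_, _, _, h4, h5⟩ := hS α hα
    refine ⟨?_, h5⟩
    rw [← hmin, ← abs_neg]
    convert h4 using 2
    ring
  · have h1 := Real.log_le_log hlow hZ
    rw [Real.log_mul (Real.exp_pos _).ne' (by positivity), Real.log_exp,
      Real.log_div hprod.ne' two_ne_zero,
      Real.log_prod fun n _ => (zero_lt_one.trans_le
        (one_le_truncZ (K n) (fugacity_pos a y n).le)).ne'] at h1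
    have h2 := h.le_sum_log_truncZ hy
    rw [ha_def, pi_div_gapRatio_rpow hρ hβ, ← ha_def] at h2
    have h3 := le_idealFreeEnergy (y := y) hβ hρ hy
    rw [div_le_iff₀ hβ] at h3
    have h4 := mul_le_mul_of_nonneg_left h3 (by positivity : 0 ≤ boxSide ρ ^ 3)
    have hNρ : boxSide ρ ^ 3 * ρ ≤ N + 1 := by
      rw [boxSide_pow_three hρ, ← Real.rpow_add_one hρ.ne']
      have := (Nat.lt_floor_add_one (ρ ^ (-(21 / 20) : ℝ))).le
      norm_num at this ⊢
      exact this
    -- If y ≠ 0, the mean is N - w, and rounding gives L³ρ ≤ N + 1, so the mismatch is at most 1 +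
    -- 2w. If y = 0, it costs nothing.
    have h5 : -y * (boxSide ρ ^ 3 * ρ - meanNumber a P K y + w) ≤
        latticeNumber a / (N - w) * (1 + 2 * w) := by
      have hlat : 0 ≤ latticeNumber a := by
        refine le_trans ?_ hfull
        exact Finset.sum_nonneg fun n hn => div_nonneg (fugacity_pos a 0 n).le
          (sub_nonneg.2 (h.fugacity_lt_one le_rfl hn).le)
      rcases hor with rfl | hor
      · rw [neg_zero, zero_mul]; positivity
      · have h6 : -y ≤ latticeNumber a / (N - w) := by
          rw [le_div_iff₀ hNw]; linarith
        have h7 : 0 ≤ -y := by linarith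
        rw [hor]
        calc _ ≤ -y * (1 + 2 * w) := mul_le_mul_of_nonneg_left (by linarith) h7
          _ ≤ _ := by gcongr
    nlinarith


/-! ### Asymptotics at low density -/

theorem tendsto_rpow_nhdsGT_zero {s : ℝ} (hs : 0 < s) :
    Tendsto (fun ρ : ℝ => ρ ^ s) (𝓝[>] 0) (𝓝 0) := by
  have := (Real.continuousAt_rpow_const 0 s (Or.inr hs.le)).tendsto
  rw [Real.zero_rpow hs.ne'] at this
  exact this.mono_left nhdsWithin_le_nhds

theorem tendsto_rpow_neg_nhdsGT_zero {s : ℝ} (hs : 0 < s) :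
    Tendsto (fun ρ : ℝ => ρ ^ (-s)) (𝓝[>] 0) atTop := by
  refine ((tendsto_rpow_atTop hs).comp tendsto_inv_nhdsGT_zero).congr' ?_
  filter_upwards [self_mem_nhdsWithin] with ρ hρ
  rw [Function.comp_apply, Real.inv_rpow (le_of_lt hρ), Real.rpow_neg (le_of_lt hρ)]

/-- Dominated convergence in k: after multiplication by a^{3/2} the k-th term tends to
π^{3/2}(k+1)^{-3/2} by Poisson summation, and `exists_theta_bound` gives the majorant C(k+1)^{-3/2}.
-/
theorem tendsto_latticeNumber :
    Tendsto (fun a : ℝ => a ^ (3 / 2 : ℝ) * latticeNumber a) (𝓝[>] 0)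
      (𝓝 (Real.pi ^ (3 / 2 : ℝ) * boseFn (3 / 2) 0)) := by
  obtain ⟨C, hC, hθ⟩ := exists_theta_bound
  have hsum := summable_succ_rpow (s := 3 / 2) (by norm_num)
  have key : ∀ (a : ℝ) (k : ℕ), 0 < a → a ^ (3 / 2 : ℝ) * (theta (((k : ℝ) + 1) * a) ^ 3 - 1) =
      ((((k : ℝ) + 1) * a) ^ (3 / 2 : ℝ) * (theta (((k : ℝ) + 1) * a) ^ 3 - 1)) *
        ((k : ℝ) + 1) ^ (-(3 / 2) : ℝ) := by
    intro a k ha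
    have hk : (0 : ℝ) < (k : ℝ) + 1 := by positivity
    have h1 : ((k : ℝ) + 1) ^ (3 / 2 : ℝ) * ((k : ℝ) + 1) ^ (-(3 / 2) : ℝ) = 1 := by
      rw [← Real.rpow_add hk]; simp
    rw [Real.mul_rpow hk.le ha.le]
    linear_combination (-(a ^ (3 / 2 : ℝ) * (theta (((k : ℝ) + 1) * a) ^ 3 - 1))) * h1
  have h := tendsto_tsum_of_dominated_convergence (𝓕 := 𝓝[>] (0 : ℝ))
    (f := fun (a : ℝ) (k : ℕ) => a ^ (3 / 2 : ℝ) * (theta (((k : ℝ) + 1) * a) ^ 3 - 1))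
    (g := fun k : ℕ => Real.pi ^ (3 / 2 : ℝ) * ((k : ℝ) + 1) ^ (-(3 / 2) : ℝ)) (hsum.mul_left C)
    (fun k => by
      have hk : (0 : ℝ) < (k : ℝ) + 1 := by positivity
      have h1 : Tendsto (fun a : ℝ => ((k : ℝ) + 1) * a) (𝓝[>] 0) (𝓝[>] 0) := by
        refine tendsto_nhdsWithin_iff.2 ⟨?_, ?_⟩
        · have : Tendsto (fun a : ℝ => ((k : ℝ) + 1) * a) (𝓝 0) (𝓝 (((k : ℝ) + 1) * 0)) :=
            tendsto_id.const_mul _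
          rw [mul_zero] at this
          exact this.mono_left nhdsWithin_le_nhds
        · filter_upwards [self_mem_nhdsWithin] with a ha
          exact mul_pos hk ha
      refine ((tendsto_rpow_mul_theta.comp h1).mul_const _).congr' ?_
      filter_upwards [self_mem_nhdsWithin] with a ha
      exact (key a k ha).symm)
    (by
      filter_upwards [self_mem_nhdsWithin] with a ha k
      have ha' : (0 : ℝ) < a := ha
      have hk : (0 : ℝ) < ((k : ℝ) + 1) * a := by positivity
      have h2 := one_le_pow₀ (n := 3) (one_le_theta hk)
      rw [Real.norm_of_nonneg (mul_nonneg (by positivity) (by linarith)), key a k ha]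
      gcongr
      calc _ ≤ (((k : ℝ) + 1) * a) ^ (3 / 2 : ℝ) *
            (C * (((k : ℝ) + 1) * a) ^ (-(3 / 2) : ℝ)) := by
              gcongr; exact hθ _ hk
        _ = C := by
            rw [mul_left_comm, ← Real.rpow_add hk]; simp)
  simp_rw [tsum_mul_left] at h
  simpa [latticeNumber, boseFn] using h

theorem eventually_beta_pos {β : ℝ → ℝ} {c : ℝ} (hc : 0 < c)
    (hβ : Tendsto (fun ρ : ℝ => ρ ^ (2 / 3 : ℝ) * β ρ) (𝓝[>] 0) (𝓝 c)) :
    ∀ᶠ ρ : ℝ in 𝓝[>] 0, 0 < β ρ := by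
  filter_upwards [hβ.eventually (lt_mem_nhds hc), self_mem_nhdsWithin] with ρ h1 h2
  exact pos_of_mul_pos_right h1 (Real.rpow_nonneg (le_of_lt h2) _)

theorem tendsto_gapRatio_scaled {β : ℝ → ℝ} {c : ℝ}
    (hβ : Tendsto (fun ρ : ℝ => ρ ^ (2 / 3 : ℝ) * β ρ) (𝓝[>] 0) (𝓝 c)) :
    Tendsto (fun ρ : ℝ => gapRatio (β ρ) ρ * ρ ^ (-(7 / 10) : ℝ)) (𝓝[>] 0)
      (𝓝 (4 * Real.pi ^ 2 * c)) := by
  refine (hβ.const_mul (4 * Real.pi ^ 2)).congr' ?_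
  filter_upwards [self_mem_nhdsWithin] with ρ hρ
  have hρ' : (0 : ℝ) < ρ := hρ
  rw [gapRatio_eq hρ', mul_assoc _ (ρ ^ (7 / 10 : ℝ)), ← Real.rpow_add hρ']
  norm_num

theorem gapRatio_pos {β ρ : ℝ} (hρ : 0 < ρ) (hβ : 0 < β) : 0 < gapRatio β ρ := by
  have := boxSide_pos hρ
  have := Real.pi_pos
  unfold gapRatio; positivity

theorem tendsto_gapRatio {β : ℝ → ℝ} {c : ℝ} (hc : 0 < c)
    (hβ : Tendsto (fun ρ : ℝ => ρ ^ (2 / 3 : ℝ) * β ρ) (𝓝[>] 0) (𝓝 c)) :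
    Tendsto (fun ρ : ℝ => gapRatio (β ρ) ρ) (𝓝[>] 0) (𝓝[>] 0) := by
  refine tendsto_nhdsWithin_iff.2 ⟨?_, ?_⟩
  · have h := (hβ.const_mul (4 * Real.pi ^ 2)).mul
      (tendsto_rpow_nhdsGT_zero (s := 7 / 10) (by norm_num))
    rw [mul_zero] at h
    refine h.congr' ?_
    filter_upwards [self_mem_nhdsWithin] with ρ hρ
    exact (gapRatio_eq hρ _).symm
  · filter_upwards [eventually_beta_pos hc hβ, self_mem_nhdsWithin] with ρ h1 h2
    exact gapRatio_pos h2 h1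

theorem tendsto_gapRatio_rpow_mul {β : ℝ → ℝ} {c : ℝ} (hc : 0 < c)
    (hβ : Tendsto (fun ρ : ℝ => ρ ^ (2 / 3 : ℝ) * β ρ) (𝓝[>] 0) (𝓝 c)) :
    Tendsto (fun ρ : ℝ => gapRatio (β ρ) ρ ^ (3 / 2 : ℝ) * ρ ^ (-(21 / 20) : ℝ)) (𝓝[>] 0)
      (𝓝 ((4 * Real.pi ^ 2 * c) ^ (3 / 2 : ℝ))) := by
  refine ((tendsto_gapRatio_scaled hβ).rpow_const (p := 3 / 2) (.inr (by norm_num))).congr' ?_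
  filter_upwards [eventually_beta_pos hc hβ, self_mem_nhdsWithin] with ρ h1 hρ
  have hρ' : (0 : ℝ) < ρ := hρ
  rw [Real.mul_rpow (gapRatio_pos hρ' h1).le (by positivity), ← Real.rpow_mul hρ'.le]
  norm_num

theorem tendsto_one_div_gapRatio {β : ℝ → ℝ} {c : ℝ} (hc : 0 < c)
    (hβ : Tendsto (fun ρ : ℝ => ρ ^ (2 / 3 : ℝ) * β ρ) (𝓝[>] 0) (𝓝 c)) {s : ℝ} (hs : 7 / 10 < s) :
    Tendsto (fun ρ : ℝ => 1 / gapRatio (β ρ) ρ * ρ ^ s) (𝓝[>] 0) (𝓝 0) := by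
  have hpi := Real.pi_pos
  have h := ((tendsto_gapRatio_scaled hβ).inv₀ (by positivity)).mul
    (tendsto_rpow_nhdsGT_zero (s := s - 7 / 10) (by linarith))
  rw [mul_zero] at h
  refine h.congr' ?_
  filter_upwards [self_mem_nhdsWithin] with ρ hρ
  have hρ' : (0 : ℝ) < ρ := hρ
  rw [mul_inv, ← Real.rpow_neg hρ'.le, mul_assoc, ← Real.rpow_add hρ', one_div]
  ring_nf

theorem criticalRatio_eq {β : ℝ → ℝ} {c R : ℝ} (hc : 0 < c)
    (hβ : Tendsto (fun ρ : ℝ => ρ ^ (2 / 3 : ℝ) * β ρ) (𝓝[>] 0) (𝓝 c))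
    (hR : Tendsto (fun ρ : ℝ => criticalDensity (β ρ) / ρ) (𝓝[>] 0) (𝓝 R)) :
    R = Real.pi ^ (3 / 2 : ℝ) * boseFn (3 / 2) 0 / (4 * Real.pi ^ 2 * c) ^ (3 / 2 : ℝ) := by
  have hpi := Real.pi_pos
  have h : Tendsto (fun ρ : ℝ => criticalDensity (β ρ) / ρ) (𝓝[>] 0)
      (𝓝 ((4 * Real.pi * c) ^ (-(3 / 2) : ℝ) * boseFn (3 / 2) 0)) := by
    refine (((hβ.const_mul (4 * Real.pi)).rpow_const (p := -(3 / 2))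
      (.inl (by positivity))).mul_const (boseFn (3 / 2) 0)).congr' ?_
    filter_upwards [eventually_beta_pos hc hβ, self_mem_nhdsWithin] with ρ h1 hρ
    have hρ' : (0 : ℝ) < ρ := hρ
    have e : 4 * Real.pi * (ρ ^ (2 / 3 : ℝ) * β ρ) = ρ ^ (2 / 3 : ℝ) * (4 * Real.pi * β ρ) := by ring
    rw [criticalDensity_eq, e, Real.mul_rpow (by positivity) (by positivity), ← Real.rpow_mul hρ'.le]
    norm_num
    rw [Real.rpow_neg_one]
    ring
  rw [tendsto_nhds_unique hR h]
  have e : (4 * Real.pi * c) ^ (-(3 / 2) : ℝ) =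
      Real.pi ^ (3 / 2 : ℝ) / (4 * Real.pi ^ 2 * c) ^ (3 / 2 : ℝ) := by
    rw [← Real.div_rpow (by positivity) (by positivity), Real.rpow_neg (by positivity),
      ← Real.inv_rpow (by positivity)]
    congr 1
    field_simp
  rw [e]
  ring

/-- The constant produced by the lattice sum is the limit of ρ_c/ρ, so at criticality the box holds
about RN excited particles. -/
theorem tendsto_latticeNumber_div {β : ℝ → ℝ} {c R : ℝ} (hc : 0 < c)
    (hβ : Tendsto (fun ρ : ℝ => ρ ^ (2 / 3 : ℝ) * β ρ) (𝓝[>] 0) (𝓝 c))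
    (hR : Tendsto (fun ρ : ℝ => criticalDensity (β ρ) / ρ) (𝓝[>] 0) (𝓝 R)) :
    Tendsto (fun ρ : ℝ => latticeNumber (gapRatio (β ρ) ρ) / ρ ^ (-(21 / 20) : ℝ)) (𝓝[>] 0)
      (𝓝 R) := by
  have hpi := Real.pi_pos
  rw [criticalRatio_eq hc hβ hR]
  refine ((tendsto_latticeNumber.comp (tendsto_gapRatio hc hβ)).div
    (tendsto_gapRatio_rpow_mul hc hβ) (by positivity)).congr' ?_
  filter_upwards [eventually_beta_pos hc hβ, self_mem_nhdsWithin] with ρ h1 hρ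
  have := gapRatio_pos hρ h1
  rw [Pi.div_apply, Function.comp_apply, mul_div_mul_left _ _ (by positivity)]

theorem tendsto_particleNumber_div :
    Tendsto (fun ρ : ℝ => (particleNumber ρ : ℝ) / ρ ^ (-(21 / 20) : ℝ)) (𝓝[>] 0) (𝓝 1) :=
  tendsto_nat_floor_div_atTop.comp (tendsto_rpow_neg_nhdsGT_zero (by norm_num))

theorem tendsto_numberWidth_mul {β : ℝ → ℝ} {c : ℝ} (hc : 0 < c)
    (hβ : Tendsto (fun ρ : ℝ => ρ ^ (2 / 3 : ℝ) * β ρ) (𝓝[>] 0) (𝓝 c)) {s : ℝ} (hs : 7 / 10 < s) :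
    Tendsto (fun ρ : ℝ => numberWidth (gapRatio (β ρ) ρ) * ρ ^ s) (𝓝[>] 0) (𝓝 0) := by
  have h := (tendsto_one_div_gapRatio hc hβ hs).const_mul
    (8 * ((∑' n : Mode, labelSq n ^ (-2 : ℝ)) + 1))
  rw [mul_zero] at h
  refine h.congr fun ρ => ?_
  rw [numberWidth]; ring

/-- In label units P_I has radius of order ρ^{-69/200}. Its power 2τ = 101/100, divided by a, is of
order ρ^{-20969/20000}, just below ρ^{-21/20}. -/
theorem tendsto_lowModesBound_div {β : ℝ → ℝ} {c : ℝ} (hc : 0 < c)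
    (hβ : Tendsto (fun ρ : ℝ => ρ ^ (2 / 3 : ℝ) * β ρ) (𝓝[>] 0) (𝓝 c)) :
    Tendsto (fun ρ : ℝ => lowModesBound (gapRatio (β ρ) ρ) ρ / ρ ^ (-(21 / 20) : ℝ)) (𝓝[>] 0)
      (𝓝 0) := by
  have hpi := Real.pi_pos
  have h1 := (tendsto_one_div_gapRatio hc hβ (s := 14031 / 20000) (by norm_num)).const_mul
    (4 * (((2 * Real.pi)⁻¹ ^ 2) ^ (101 / 200 : ℝ) *
      ∑' n : Mode, labelSq n ^ (-(1 + 101 / 200) : ℝ)))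
  have h2 := h1.add (tendsto_rpow_nhdsGT_zero (s := 21 / 20) (by norm_num))
  rw [mul_zero, add_zero] at h2
  refine h2.congr' ?_
  filter_upwards [self_mem_nhdsWithin] with ρ hρ
  have hρ' : (0 : ℝ) < ρ := hρ
  have e : ((cutoff ρ * ρ ^ (1 / 3 : ℝ) * boxSide ρ / (2 * Real.pi)) ^ 2) ^ (101 / 200 : ℝ) =
      ((2 * Real.pi)⁻¹ ^ 2) ^ (101 / 200 : ℝ) * ρ ^ (-(6969 / 20000) : ℝ) := by
    rw [cutoff, boxSide, ← Real.rpow_add hρ', ← Real.rpow_add hρ', div_eq_mul_inv, mul_pow,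
      mul_comm, Real.mul_rpow (by positivity) (by positivity), ← Real.rpow_natCast (ρ ^ _),
      ← Real.rpow_mul hρ'.le, ← Real.rpow_mul hρ'.le, eta]
    norm_num
  have e2 : ρ ^ (14031 / 20000 : ℝ) = ρ ^ (-(6969 / 20000) : ℝ) * ρ ^ (21 / 20 : ℝ) := by
    rw [← Real.rpow_add hρ']; norm_num
  rw [lowModesBound, e, e2, Real.rpow_neg hρ'.le (21 / 20), div_inv_eq_mul]
  ring

theorem tendsto_mc_div :
    Tendsto (fun ρ : ℝ => mc ρ / ρ ^ (-(21 / 20) : ℝ)) (𝓝[>] 0) (𝓝 0) := by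
  refine (tendsto_rpow_nhdsGT_zero (s := 21 / 20 - 3 / 200) (by norm_num)).congr' ?_
  filter_upwards [self_mem_nhdsWithin] with ρ hρ
  have hρ' : (0 : ℝ) < ρ := hρ
  rw [mc, ← Real.rpow_sub hρ', eta]
  norm_num

/-- In the variable z = ρ^{-η} this is a power of z against e^{-cz/4}, since ρ^{2/3}β is eventually
above c/2. -/
theorem tendsto_rpow_mul_exp {β : ℝ → ℝ} {c : ℝ} (hc : 0 < c)
    (hβ : Tendsto (fun ρ : ℝ => ρ ^ (2 / 3 : ℝ) * β ρ) (𝓝[>] 0) (𝓝 c)) (s : ℝ) :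
    Tendsto (fun ρ : ℝ => ρ ^ (-s) * Real.exp (-(ρ ^ (2 / 3 : ℝ) * β ρ * ρ ^ (-eta) / 2)))
      (𝓝[>] 0) (𝓝 0) := by
  have hη : (0 : ℝ) < eta := by unfold eta; norm_num
  have h := (tendsto_rpow_mul_exp_neg_mul_atTop_nhds_zero (s / eta) (c / 4) (by positivity)).comp
    (tendsto_rpow_neg_nhdsGT_zero hη)
  refine tendsto_of_tendsto_of_tendsto_of_le_of_le' tendsto_const_nhds h ?_ ?_
  · filter_upwards [self_mem_nhdsWithin] with ρ hρ
    have hρ' : (0 : ℝ) < ρ := hρ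
    positivity
  · filter_upwards [hβ.eventually (lt_mem_nhds (half_lt_self hc)), self_mem_nhdsWithin]
      with ρ h1 hρ
    have hρ' : (0 : ℝ) < ρ := hρ
    have hz : 0 < ρ ^ (-eta) := by positivity
    rw [Function.comp_apply, ← Real.rpow_mul hρ'.le]
    have e : -eta * (s / eta) = -s := by field_simp
    rw [e]
    gcongr
    nlinarith

/-- The factor θ(a/2)³ grows at most like a^{-3/2}, of order ρ^{-21/20}, and e^{-E/2} beats every
power of ρ. -/
theorem tendsto_cutoffError {β : ℝ → ℝ} {c : ℝ} (hc : 0 < c)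
    (hβ : Tendsto (fun ρ : ℝ => ρ ^ (2 / 3 : ℝ) * β ρ) (𝓝[>] 0) (𝓝 c)) :
    Tendsto (fun ρ : ℝ => cutoffError (gapRatio (β ρ) ρ) (ρ ^ (2 / 3 : ℝ) * β ρ * ρ ^ (-eta)))
      (𝓝[>] 0) (𝓝 0) := by
  have hpi := Real.pi_pos
  obtain ⟨C, hC, hθ⟩ := exists_theta_bound
  have h1 := tendsto_rpow_mul_exp hc hβ 0
  have h2 := ((tendsto_rpow_mul_exp hc hβ (21 / 20)).mul
    ((tendsto_gapRatio_rpow_mul hc hβ).inv₀ (by positivity))).const_mul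
      (C * (1 / 2 : ℝ) ^ (-(3 / 2) : ℝ))
  have h3 := h1.add h2
  rw [zero_mul, mul_zero, add_zero] at h3
  refine tendsto_of_tendsto_of_tendsto_of_le_of_le' tendsto_const_nhds h3 ?_ ?_
  · filter_upwards [eventually_beta_pos hc hβ, self_mem_nhdsWithin] with ρ h4 hρ
    exact cutoffError_nonneg (gapRatio_pos hρ h4) _
  · filter_upwards [eventually_beta_pos hc hβ, self_mem_nhdsWithin] with ρ h4 hρ
    have hρ' : (0 : ℝ) < ρ := hρ
    have ha := gapRatio_pos hρ h4
    have h5 := hθ (gapRatio (β ρ) ρ / 2) (by positivity)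
    rw [cutoffError]
    set e := Real.exp (-(ρ ^ (2 / 3 : ℝ) * β ρ * ρ ^ (-eta) / 2))
    have he : 0 < e := Real.exp_pos _
    have h6 : (gapRatio (β ρ) ρ / 2) ^ (-(3 / 2) : ℝ) =
        (1 / 2 : ℝ) ^ (-(3 / 2) : ℝ) * (gapRatio (β ρ) ρ ^ (3 / 2 : ℝ))⁻¹ := by
      rw [div_eq_mul_one_div, Real.mul_rpow ha.le (by norm_num), mul_comm, Real.rpow_neg ha.le]
    rw [h6] at h5
    have h7 : ρ ^ (-(21 / 20) : ℝ) * e *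
        (gapRatio (β ρ) ρ ^ (3 / 2 : ℝ) * ρ ^ (-(21 / 20) : ℝ))⁻¹ =
        e * (gapRatio (β ρ) ρ ^ (3 / 2 : ℝ))⁻¹ := by
      have : 0 < ρ ^ (-(21 / 20) : ℝ) := by positivity
      field_simp
    rw [h7, neg_zero, Real.rpow_zero, one_mul]
    have h8 := mul_le_mul_of_nonneg_left h5 he.le
    linarith


/-- Dividing an error in -ln Z by βL³ρ² multiplies it by order ρ^{43/60}, as 41/20 + 2/3 - 2 =
43/60. The mismatch is of order at most ρ^{-42/60}, the surface term of order ρ^{-21/60}, and the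
rest is bounded. -/
theorem tendsto_freeEnergyError {β : ℝ → ℝ} {c R : ℝ} (hc : 0 < c)
    (hβ : Tendsto (fun ρ : ℝ => ρ ^ (2 / 3 : ℝ) * β ρ) (𝓝[>] 0) (𝓝 c))
    (hR : Tendsto (fun ρ : ℝ => criticalDensity (β ρ) / ρ) (𝓝[>] 0) (𝓝 R)) :
    Tendsto (fun ρ : ℝ => freeEnergyError (β ρ) ρ * ρ ^ (43 / 60 : ℝ)) (𝓝[>] 0) (𝓝 0) := by
  have hpi := Real.pi_pos
  have hN := tendsto_particleNumber_div
  have hz := tendsto_rpow_nhdsGT_zero (s := 43 / 60) (by norm_num)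
  have hw := tendsto_numberWidth_mul hc hβ (s := 21 / 20) (by norm_num)
  have hw2 := tendsto_numberWidth_mul hc hβ (s := 43 / 60) (by norm_num)
  have h1 := ((tendsto_latticeNumber_div hc hβ hR).div (hN.sub hw) (by norm_num)).mul
    (hz.add (hw2.const_mul 2))
  have h2 : Tendsto (fun ρ : ℝ => Real.sqrt (Real.pi * (1 / gapRatio (β ρ) ρ * ρ ^ (43 / 30 : ℝ))))
      (𝓝[>] 0) (𝓝 0) := by
    have := ((tendsto_one_div_gapRatio hc hβ (s := 43 / 30) (by norm_num)).const_mul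
      Real.pi).sqrt
    rwa [mul_zero, Real.sqrt_zero] at this
  have h3 := ((tendsto_cutoffError hc hβ).const_mul 4).mul hz
  have h4 := ((h1.add (h2.mul_const (boseFn (3 / 2) 0))).add h3).add (hz.const_mul (Real.log 2))
  simp only [mul_zero, add_zero, zero_mul] at h4
  refine h4.congr' ?_
  filter_upwards [self_mem_nhdsWithin] with ρ hρ
  have hρ' : (0 : ℝ) < ρ := hρ
  have e1 : Real.sqrt (Real.pi * (1 / gapRatio (β ρ) ρ * ρ ^ (43 / 30 : ℝ))) =
      Real.sqrt (Real.pi / gapRatio (β ρ) ρ) * ρ ^ (43 / 60 : ℝ) := by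
    rw [← mul_assoc, mul_one_div, Real.sqrt_mul' _ (by positivity), Real.sqrt_eq_rpow (ρ ^ _),
      ← Real.rpow_mul hρ'.le]
    norm_num
  have e2 : latticeNumber (gapRatio (β ρ) ρ) / ρ ^ (-(21 / 20) : ℝ) /
      (particleNumber ρ / ρ ^ (-(21 / 20) : ℝ) -
        numberWidth (gapRatio (β ρ) ρ) * ρ ^ (21 / 20 : ℝ)) =
      latticeNumber (gapRatio (β ρ) ρ) /
        (particleNumber ρ - numberWidth (gapRatio (β ρ) ρ)) := by
    have e3 : ρ ^ (21 / 20 : ℝ) = (ρ ^ (-(21 / 20) : ℝ))⁻¹ := by rw [Real.rpow_neg hρ'.le, inv_inv]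
    rw [e3, ← div_eq_mul_inv, ← sub_div, div_div_div_cancel_right₀ (by positivity)]
  rw [Pi.div_apply, e1, e2, freeEnergyError]
  ring

/-! ### Condensate fraction and collected error bounds -/

theorem single_mem_M {ρ : ℝ} (hρ : 0 < ρ) : Finsupp.single 0 (particleNumber ρ) ∈ M ρ := by
  have h1 : ((Finsupp.single (0 : Mode) (particleNumber ρ)).support : Set Mode) ⊆ P0 := by
    intro n hn
    exact Finset.mem_singleton.1 (Finsupp.support_single_subset hn)
  refine ⟨⟨fun n hn => .inl (.inl (.inl (h1 hn))), Finsupp.sum_single_index rfl⟩,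
    fun n hn => .inl (.inl (h1 hn)), fun k hk => ?_⟩
  have hk0 : k ≠ 0 := by rintro rfl; exact zero_notMem_PL hρ hk
  rw [Finsupp.single_eq_of_ne hk0]
  unfold mc
  simpa using Real.rpow_nonneg hρ.le _

/-- The number of particles in the condensate of the trial state, when the lattice gas has at most
`ν` excited particles. -/
noncomputable def condensate (β ρ ν : ℝ) : ℝ :=
  particleNumber ρ - min ν (particleNumber ρ - numberWidth (gapRatio β ρ))

/-- The hypotheses squeeze ν/N to R. As w = o(N), the minimum with N - w leaves 1 - min(R, 1) =
[1-R]_+. -/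
theorem tendsto_condensate_div {β : ℝ → ℝ} {c R : ℝ} (hc : 0 < c)
    (hβ : Tendsto (fun ρ : ℝ => ρ ^ (2 / 3 : ℝ) * β ρ) (𝓝[>] 0) (𝓝 c))
    (hR : Tendsto (fun ρ : ℝ => criticalDensity (β ρ) / ρ) (𝓝[>] 0) (𝓝 R)) {ν : ℝ → ℝ}
    (hν : ∀ᶠ ρ : ℝ in 𝓝[>] 0, ν ρ ≤ latticeNumber (gapRatio (β ρ) ρ) ∧
      latticeNumber (gapRatio (β ρ) ρ) - (2 * particleNumber ρ + 4) *
        cutoffError (gapRatio (β ρ) ρ) (ρ ^ (2 / 3 : ℝ) * β ρ * ρ ^ (-eta)) ≤ ν ρ) :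
    Tendsto (fun ρ : ℝ => condensate (β ρ) ρ (ν ρ) / ρ ^ (-(21 / 20) : ℝ)) (𝓝[>] 0)
      (𝓝 (max (1 - R) 0)) := by
  have hN := tendsto_particleNumber_div
  have hΛ := tendsto_latticeNumber_div hc hβ hR
  have hz := tendsto_rpow_nhdsGT_zero (s := 21 / 20) (by norm_num)
  have hw := tendsto_numberWidth_mul hc hβ (s := 21 / 20) (by norm_num)
  have hlow := hΛ.sub (((hN.const_mul 2).add (hz.const_mul 4)).mul (tendsto_cutoffError hc hβ))
  rw [mul_zero, sub_zero] at hlow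
  have hinv : ∀ ρ : ℝ, 0 < ρ → ρ ^ (21 / 20 : ℝ) = 1 / ρ ^ (-(21 / 20) : ℝ) := fun ρ hρ => by
    rw [Real.rpow_neg hρ.le, one_div, inv_inv]
  have hνR : Tendsto (fun ρ : ℝ => ν ρ / ρ ^ (-(21 / 20) : ℝ)) (𝓝[>] 0) (𝓝 R) := by
    refine tendsto_of_tendsto_of_tendsto_of_le_of_le' hlow hΛ ?_ ?_
    · filter_upwards [hν, self_mem_nhdsWithin] with ρ h1 hρ
      have hρ' : (0 : ℝ) < ρ := hρ
      have hp : 0 < ρ ^ (-(21 / 20) : ℝ) := by positivity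
      refine le_trans (le_of_eq ?_) (div_le_div_of_nonneg_right h1.2 hp.le)
      rw [hinv ρ hρ']
      field_simp
    · filter_upwards [hν, self_mem_nhdsWithin] with ρ h1 hρ
      have hρ' : (0 : ℝ) < ρ := hρ
      exact div_le_div_of_nonneg_right h1.1 (by positivity)
  have h := hN.sub (hνR.min (hN.sub hw))
  have e : (1 : ℝ) - min R (1 - 0) = max (1 - R) 0 := by
    rw [sub_zero]
    rcases le_total R 1 with h | h
    · rw [min_eq_left h, max_eq_left (by linarith)]
    · rw [min_eq_right h, max_eq_right (by linarith), sub_self]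
  rw [e] at h
  refine h.congr' ?_
  filter_upwards [self_mem_nhdsWithin] with ρ hρ
  have hρ' : (0 : ℝ) < ρ := hρ
  have hp : 0 < ρ ^ (-(21 / 20) : ℝ) := by positivity
  rw [condensate, hinv ρ hρ', mul_one_div, ← sub_div, min_div_div_right hp.le, ← sub_div]

/-- The errors come from the particles in P_I (v), the fluctuation of the condensate (w), the
excluded pairs (`mc`) and the distance of the mean condensate fraction from its limit s. -/
theorem abs_pairNumber_div_sub_le {ρ : ℝ} (hρ : 0 < ρ) {α : Occ} (hα : α ∈ M ρ)
    (hN : 0 < (particleNumber ρ : ℝ)) {x w v s : ℝ} (hx : |(α 0 : ℝ) - x| ≤ w)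
    (hv : ∑ n ∈ (finite_PI hρ).toFinset, (α n : ℝ) ≤ v) :
    |((particleNumber ρ : ℝ) ^ 2)⁻¹ * pairNumber ρ α - (2 - s ^ 2)| ≤
      2 * (v / particleNumber ρ) ^ 2 + 4 * (v / particleNumber ρ) +
        (w / particleNumber ρ) * (2 * |x / particleNumber ρ| + w / particleNumber ρ) +
        4 * (mc ρ / particleNumber ρ) + |(x / particleNumber ρ) ^ 2 - s ^ 2| := by
  have h1 := abs_pairNumber_sub_le hρ hα
  have hI : 0 ≤ ∑ n ∈ (finite_PI hρ).toFinset, (α n : ℝ) :=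
    Finset.sum_nonneg fun _ _ => by positivity
  set N : ℝ := ((particleNumber ρ : ℕ) : ℝ)
  set I := ∑ n ∈ (finite_PI hρ).toFinset, (α n : ℝ)
  have e : (N ^ 2)⁻¹ * pairNumber ρ α - (2 - s ^ 2) =
      (pairNumber ρ α - (2 * (N - I) ^ 2 - (α 0 : ℝ) ^ 2)) / N ^ 2 +
      (2 * I ^ 2 - 4 * N * I) / N ^ 2 + (x ^ 2 - (α 0 : ℝ) ^ 2) / N ^ 2 -
      ((x / N) ^ 2 - s ^ 2) := by
    field_simp
    ring
  have h2 : |(pairNumber ρ α - (2 * (N - I) ^ 2 - (α 0 : ℝ) ^ 2)) / N ^ 2| ≤ 4 * (mc ρ / N) := by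
    rw [abs_div, abs_of_pos (by positivity : 0 < N ^ 2), div_le_iff₀ (by positivity)]
    refine h1.trans (le_of_eq ?_)
    field_simp
  have h3 : |(2 * I ^ 2 - 4 * N * I) / N ^ 2| ≤ 2 * (v / N) ^ 2 + 4 * (v / N) := by
    rw [abs_div, abs_of_pos (by positivity : 0 < N ^ 2), div_le_iff₀ (by positivity)]
    have e2 : (2 * (v / N) ^ 2 + 4 * (v / N)) * N ^ 2 = 2 * v ^ 2 + 4 * N * v := by field_simp
    rw [e2]
    have h4 : I ^ 2 ≤ v ^ 2 := by gcongr
    have h5 : N * I ≤ N * v := by gcongr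
    have h6 : 0 ≤ N * I := by positivity
    rw [abs_le]
    constructor <;> nlinarith [sq_nonneg I, sq_nonneg v]
  have h4 : |(x ^ 2 - (α 0 : ℝ) ^ 2) / N ^ 2| ≤ (w / N) * (2 * |x / N| + w / N) := by
    rw [abs_div, abs_of_pos (by positivity : 0 < N ^ 2), div_le_iff₀ (by positivity), abs_div,
      abs_of_pos hN]
    have e2 : w / N * (2 * (|x| / N) + w / N) * N ^ 2 = w * (2 * |x| + w) := by field_simp
    have e3 : x ^ 2 - (α 0 : ℝ) ^ 2 = -(((α 0 : ℝ) - x) * (2 * x + ((α 0 : ℝ) - x))) := by ring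
    rw [e2, e3, abs_neg, abs_mul]
    have h5 : |2 * x + ((α 0 : ℝ) - x)| ≤ 2 * |x| + w := by
      refine (abs_add_le _ _).trans ?_
      rw [abs_mul, abs_two]
      linarith
    have := (abs_nonneg _).trans hx
    gcongr
  rw [e]
  have h5 := abs_sub ((pairNumber ρ α - (2 * (N - I) ^ 2 - (α 0 : ℝ) ^ 2)) / N ^ 2 +
      (2 * I ^ 2 - 4 * N * I) / N ^ 2 + (x ^ 2 - (α 0 : ℝ) ^ 2) / N ^ 2) ((x / N) ^ 2 - s ^ 2)
  have h6 := abs_add_three ((pairNumber ρ α - (2 * (N - I) ^ 2 - (α 0 : ℝ) ^ 2)) / N ^ 2)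
    ((2 * I ^ 2 - 4 * N * I) / N ^ 2) ((x ^ 2 - (α 0 : ℝ) ^ 2) / N ^ 2)
  linarith

/-- An upper bound on the free energy of the trial state per volume and `ρ²`. -/
theorem free_energy_density_le {β ρ : ℝ} (hρ : 0 < ρ) (hβ : 0 < β) {S : Finset Occ}
    (hne : S.Nonempty) (hS : ∀ α ∈ S, α ∈ M ρ) {V : Space → ℝ} (hV : ∀ x, 0 ≤ V x)
    (hi : MeasureTheory.Integrable V) {m : ℝ} (hm : 0 ≤ m) (hmS : ∀ α ∈ S, m ≤ α 0) {e : ℝ}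
    (he : -Real.log (∑ α ∈ S, Real.exp (-(β * kinetic (boxSide ρ) α))) -
        boxSide ρ ^ 3 * (β * idealFreeEnergy ρ β) ≤ e) :
    (1 / boxSide ρ ^ 3 * energy (boxSide ρ) V (diagonal ρ (gibbs β (boxSide ρ) S))
        - 1 / (boxSide ρ ^ 3 * β) * entropy (diagonal ρ (gibbs β (boxSide ρ) S))
        - idealFreeEnergy ρ β) * (ρ ^ 2)⁻¹ ≤
      e * ρ ^ (43 / 60 : ℝ) / (ρ ^ (2 / 3 : ℝ) * β) +
        1 / 2 * (∫ x, V x) * (2 * (particleNumber ρ / ρ ^ (-(21 / 20) : ℝ)) ^ 2 -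
          (m / ρ ^ (-(21 / 20) : ℝ)) ^ 2) := by
  have hL := boxSide_pos hρ
  have h1 := gibbs_free_energy_le hρ hβ hL hne hS hV hi hm hmS
  set Z := ∑ α ∈ S, Real.exp (-(β * kinetic (boxSide ρ) α))
  set U := energy (boxSide ρ) V (diagonal ρ (gibbs β (boxSide ρ) S))
  set T := entropy (diagonal ρ (gibbs β (boxSide ρ) S))
  set f := idealFreeEnergy ρ β
  have hL3 : 0 < boxSide ρ ^ 3 := by positivity
  have h2 : -Real.log Z / β ≤ boxSide ρ ^ 3 * f + e / β := by
    rw [div_le_iff₀ hβ, add_mul, div_mul_cancel₀ _ hβ.ne']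
    linarith
  have h3 : 1 / boxSide ρ ^ 3 * U - 1 / (boxSide ρ ^ 3 * β) * T - f ≤
      (e / β + 1 / boxSide ρ ^ 3 *
        ((∫ x, V x) / 2 * (2 * (particleNumber ρ : ℝ) ^ 2 - m ^ 2))) / boxSide ρ ^ 3 := by
    rw [le_div_iff₀ hL3]
    have e1 : (1 / boxSide ρ ^ 3 * U - 1 / (boxSide ρ ^ 3 * β) * T - f) * boxSide ρ ^ 3 =
        U - T / β - boxSide ρ ^ 3 * f := by field_simp
    rw [e1]
    linarith
  refine (mul_le_mul_of_nonneg_right h3 (by positivity)).trans (le_of_eq ?_)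
  have p1 : (boxSide ρ ^ 3)⁻¹ = ρ ^ (41 / 20 : ℝ) := by
    rw [boxSide_pow_three hρ, Real.rpow_neg hρ.le, inv_inv]
  have p2 : (ρ ^ 2)⁻¹ = ρ ^ (-2 : ℝ) := by rw [Real.rpow_neg hρ.le, Real.rpow_two]
  have p3 : ρ ^ (43 / 60 : ℝ) / ρ ^ (2 / 3 : ℝ) = ρ ^ (41 / 20 : ℝ) * ρ ^ (-2 : ℝ) := by
    rw [← Real.rpow_sub hρ, ← Real.rpow_add hρ]; norm_num
  have p4 : (1 / ρ ^ (-(21 / 20) : ℝ)) ^ 2 =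
      ρ ^ (41 / 20 : ℝ) * ρ ^ (41 / 20 : ℝ) * ρ ^ (-2 : ℝ) := by
    rw [Real.rpow_neg hρ.le, one_div, inv_inv, sq, ← Real.rpow_add hρ, ← Real.rpow_add hρ,
      ← Real.rpow_add hρ]
    norm_num
  have q1 : e * ρ ^ (43 / 60 : ℝ) / (ρ ^ (2 / 3 : ℝ) * β) =
      e / β * (ρ ^ (43 / 60 : ℝ) / ρ ^ (2 / 3 : ℝ)) := by
    have : 0 < ρ ^ (2 / 3 : ℝ) := by positivity
    field_simp
  have q2 : 2 * ((particleNumber ρ : ℝ) / ρ ^ (-(21 / 20) : ℝ)) ^ 2 -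
      (m / ρ ^ (-(21 / 20) : ℝ)) ^ 2 = (2 * (particleNumber ρ : ℝ) ^ 2 - m ^ 2) *
        (1 / ρ ^ (-(21 / 20) : ℝ)) ^ 2 := by ring
  rw [q1, q2, p3, p4, one_div (boxSide ρ ^ 3), div_eq_mul_inv _ (boxSide ρ ^ 3), p1, p2]
  ring

end BoseGas

/-! ### Proof of the theorem -/

open BoseGas
theorem lemma2 (β : ℝ → ℝ) (c : ℝ) (hc : 0 < c)
    (hβ : Tendsto (fun ρ : ℝ => ρ ^ (2 / 3 : ℝ) * β ρ) (𝓝[>] 0) (𝓝 c))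
    (R : ℝ) (hR : Tendsto (fun ρ : ℝ => criticalDensity (β ρ) / ρ) (𝓝[>] 0) (𝓝 R)) :
    ∃ (Γ : ℝ → Fock →L[ℂ] Fock) (g : ℝ → Occ → ℝ),
      (∀ ρ : ℝ, 0 < ρ →
        IsState (Γ ρ) ∧ Γ ρ = diagonal ρ (g ρ) ∧ (∑ᶠ α ∈ M ρ, g ρ α) = 1) ∧
      (∀ V : Space → ℝ, ContDiff ℝ ∞ V → HasCompactSupport V → (∀ x, 0 ≤ V x) →
        (∀ x y, ‖x‖ = ‖y‖ → V x = V y) →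
        limsup (fun ρ : ℝ =>
            (((1 / boxSide ρ ^ 3 * energy (boxSide ρ) V (Γ ρ)
                - 1 / (boxSide ρ ^ 3 * β ρ) * entropy (Γ ρ)
                - idealFreeEnergy ρ (β ρ)) * (ρ ^ 2)⁻¹ : ℝ) : EReal)) (𝓝[>] 0)
          ≤ ((1 / 2 * (∫ x, V x) * (2 - max (1 - R) 0 ^ 2) : ℝ) : EReal)) ∧
      Tendsto (fun ρ : ℝ =>
          ∑ᶠ α ∈ M ρ, ((particleNumber ρ : ℝ) ^ 2)⁻¹ * pairNumber ρ α * g ρ α) (𝓝[>] 0)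
        (𝓝 (2 - max (1 - R) 0 ^ 2)) := by
  have hN := tendsto_particleNumber_div
  have hw := tendsto_numberWidth_mul hc hβ (s := 21 / 20) (by norm_num)
  have hlt1 : ∀ᶠ ρ : ℝ in 𝓝[>] 0, ρ < 1 := nhdsWithin_le_nhds (gt_mem_nhds one_pos)
  have hsmall : ∀ᶠ ρ : ℝ in 𝓝[>] 0,
      Real.exp (-(ρ ^ (2 / 3 : ℝ) * β ρ * ρ ^ (-eta) / 2)) ≤ 1 / 2 := by
    have h := tendsto_rpow_mul_exp hc hβ 0
    simp only [neg_zero, Real.rpow_zero, one_mul] at h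
    exact (h.eventually (gt_mem_nhds (show (0 : ℝ) < 1 / 2 by norm_num))).mono fun _ => le_of_lt
  have hwN : ∀ᶠ ρ : ℝ in 𝓝[>] 0, numberWidth (gapRatio (β ρ) ρ) < particleNumber ρ := by
    have h := hN.sub hw
    rw [sub_zero] at h
    filter_upwards [h.eventually (lt_mem_nhds one_pos), self_mem_nhdsWithin] with ρ h1 hρ
    have hρ' : (0 : ℝ) < ρ := hρ
    have hp : 0 < ρ ^ (-(21 / 20) : ℝ) := by positivity
    have e : ρ ^ (21 / 20 : ℝ) = (ρ ^ (-(21 / 20) : ℝ))⁻¹ := by rw [Real.rpow_neg hρ'.le, inv_inv]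
    rw [e, ← div_eq_mul_inv, ← sub_div, lt_div_iff₀ hp, zero_mul] at h1
    linarith
  -- A state is needed for every ρ > 0, even where β ≤ 0 or the estimates do not apply. There S is
  -- the single configuration with all particles in the condensate, and ν = 0 is a dummy value.
  have hex : ∀ ρ : ℝ, ∃ (S : Finset Occ) (ν : ℝ), 0 < ρ → (S.Nonempty ∧ (∀ α ∈ S, α ∈ M ρ) ∧
      ∀ hρ : 0 < ρ, (ρ < 1 ∧ 0 < β ρ ∧
        Real.exp (-(ρ ^ (2 / 3 : ℝ) * β ρ * ρ ^ (-eta) / 2)) ≤ 1 / 2 ∧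
        numberWidth (gapRatio (β ρ) ρ) < particleNumber ρ) →
      ((ν ≤ latticeNumber (gapRatio (β ρ) ρ) ∧
      latticeNumber (gapRatio (β ρ) ρ) - (2 * particleNumber ρ + 4) *
        cutoffError (gapRatio (β ρ) ρ) (ρ ^ (2 / 3 : ℝ) * β ρ * ρ ^ (-eta)) ≤ ν) ∧
      (∀ α ∈ S, |(α 0 : ℝ) - condensate (β ρ) ρ ν| ≤ numberWidth (gapRatio (β ρ) ρ) ∧
        ∑ n ∈ (finite_PI hρ).toFinset, (α n : ℝ) ≤ lowModesBound (gapRatio (β ρ) ρ) ρ) ∧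
      -Real.log (∑ α ∈ S, Real.exp (-(β ρ * kinetic (boxSide ρ) α))) -
        boxSide ρ ^ 3 * (β ρ * idealFreeEnergy ρ (β ρ)) ≤ freeEnergyError (β ρ) ρ)) := by
    intro ρ
    by_cases hgood : 0 < ρ ∧ ρ < 1 ∧ 0 < β ρ ∧
        Real.exp (-(ρ ^ (2 / 3 : ℝ) * β ρ * ρ ^ (-eta) / 2)) ≤ 1 / 2 ∧
        numberWidth (gapRatio (β ρ) ρ) < particleNumber ρ
    · obtain ⟨hρ, h1, h2, h3, h4⟩ := hgood
      obtain ⟨S, ν, k1, k2, k3, k4, k5, k6⟩ := exists_trial_occupations hρ h1 h2 h3 h4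
      exact ⟨S, ν, fun _ => ⟨k1, k2, fun _ _ => ⟨⟨k3, k4⟩, k5, k6⟩⟩⟩
    · refine ⟨{Finsupp.single 0 (particleNumber ρ)}, 0, fun hρ => ⟨Finset.singleton_nonempty _,
        fun α hα => ?_, fun _ h => absurd ⟨hρ, h⟩ hgood⟩⟩
      rw [Finset.mem_singleton.1 hα]
      exact single_mem_M hρ
  choose S ν hSν using hex
  have hgood : ∀ᶠ ρ : ℝ in 𝓝[>] 0, ρ < 1 ∧ 0 < β ρ ∧
        Real.exp (-(ρ ^ (2 / 3 : ℝ) * β ρ * ρ ^ (-eta) / 2)) ≤ 1 / 2 ∧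
        numberWidth (gapRatio (β ρ) ρ) < particleNumber ρ := by
    filter_upwards [hlt1, eventually_beta_pos hc hβ, hsmall, hwN] with ρ h1 h2 h3 h4
    exact ⟨h1, h2, h3, h4⟩
  have hcond := tendsto_condensate_div hc hβ hR (ν := ν) (by
    filter_upwards [hgood, self_mem_nhdsWithin] with ρ h1 hρ
    exact ((hSν ρ hρ).2.2 hρ h1).1)
  refine ⟨fun ρ => diagonal ρ (gibbs (β ρ) (boxSide ρ) (S ρ)),
    fun ρ => gibbs (β ρ) (boxSide ρ) (S ρ), ?_, ?_, ?_⟩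
  · intro ρ hρ
    have h1 := finsum_gibbs hρ (β ρ) (boxSide ρ) (hSν ρ hρ).1 (hSν ρ hρ).2.1
    exact ⟨diagonal_isState ρ hρ _ (gibbs_nonneg _ _ _) h1, rfl, h1⟩
  · intro V hsm hcs hV _
    have hi : MeasureTheory.Integrable V := hsm.continuous.integrable_of_hasCompactSupport hcs
    have hlim : Tendsto (fun ρ : ℝ => freeEnergyError (β ρ) ρ * ρ ^ (43 / 60 : ℝ) /
        (ρ ^ (2 / 3 : ℝ) * β ρ) +
        1 / 2 * (∫ x, V x) * (2 * (particleNumber ρ / ρ ^ (-(21 / 20) : ℝ)) ^ 2 -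
          ((condensate (β ρ) ρ (ν ρ) - numberWidth (gapRatio (β ρ) ρ)) /
            ρ ^ (-(21 / 20) : ℝ)) ^ 2)) (𝓝[>] 0)
        (𝓝 (0 / c + 1 / 2 * (∫ x, V x) * (2 * 1 ^ 2 - (max (1 - R) 0 - 0) ^ 2))) := by
      refine ((tendsto_freeEnergyError hc hβ hR).div hβ hc.ne').add
        ((((hN.pow 2).const_mul 2).sub (Tendsto.pow ((hcond.sub hw).congr' ?_) 2)).const_mul _)
      filter_upwards [self_mem_nhdsWithin] with ρ hρ
      have hρ' : (0 : ℝ) < ρ := hρ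
      rw [sub_div, Real.rpow_neg hρ'.le, div_inv_eq_mul _ (ρ ^ (21 / 20 : ℝ)),
        div_inv_eq_mul _ (ρ ^ (21 / 20 : ℝ))]
    have e : 0 / c + 1 / 2 * (∫ x, V x) * (2 * 1 ^ 2 - (max (1 - R) 0 - 0) ^ 2) =
        1 / 2 * (∫ x, V x) * (2 - max (1 - R) 0 ^ 2) := by ring
    rw [e] at hlim
    -- The limsup is compared with the limit of the explicit upper bound; in `EReal` no boundedness
    -- has to be checked.
    rw [← ((continuous_coe_real_ereal.tendsto _).comp hlim).limsup_eq]
    refine limsup_le_limsup ?_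
    filter_upwards [hgood, self_mem_nhdsWithin] with ρ h1 hρ
    obtain ⟨k1, k2, k3⟩ := hSν ρ hρ
    obtain ⟨_, k4, k5⟩ := k3 hρ h1
    -- The lower bound m on α(0) is condensate minus width; it is non-negative because the mean
    -- excited number is at most N - w.
    refine EReal.coe_le_coe_iff.2 (free_energy_density_le hρ h1.2.1 k1 k2 hV hi ?_ ?_ k5)
    · rw [condensate]
      linarith [min_le_right (ν ρ) (particleNumber ρ - numberWidth (gapRatio (β ρ) ρ))]
    · intro α hα
      linarith [(abs_le.1 (k4 α hα).1).1]
  · have hNinv : ∀ {F : ℝ → ℝ} {l : ℝ},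
        Tendsto (fun ρ : ℝ => F ρ / ρ ^ (-(21 / 20) : ℝ)) (𝓝[>] 0) (𝓝 l) →
        Tendsto (fun ρ : ℝ => F ρ / particleNumber ρ) (𝓝[>] 0) (𝓝 l) := by
      intro F l hF
      have h := hF.div hN one_ne_zero
      rw [div_one] at h
      refine h.congr' ?_
      filter_upwards [self_mem_nhdsWithin] with ρ hρ
      have hρ' : (0 : ℝ) < ρ := hρ
      rw [Pi.div_apply, div_div_div_cancel_right₀ (by positivity)]
    have hw' := hNinv (F := fun ρ => numberWidth (gapRatio (β ρ) ρ)) (l := 0) (hw.congr' (by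
      filter_upwards [self_mem_nhdsWithin] with ρ hρ
      have hρ' : (0 : ℝ) < ρ := hρ
      rw [Real.rpow_neg hρ'.le, div_inv_eq_mul]))
    have hv' := hNinv (tendsto_lowModesBound_div hc hβ)
    have hm' := hNinv tendsto_mc_div
    have hx' := hNinv hcond
    have hε := ((((hv'.pow 2).const_mul 2).add (hv'.const_mul 4)).add
      (hw'.mul ((hx'.abs.const_mul 2).add hw'))).add (hm'.const_mul 4) |>.add
      ((hx'.pow 2).sub (tendsto_const_nhds (x := max (1 - R) 0 ^ 2))).abs
    simp only [ne_eq, OfNat.ofNat_ne_zero, not_false_eq_true, zero_pow, mul_zero, zero_mul,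
      add_zero, sub_self, abs_zero] at hε
    rw [tendsto_iff_norm_sub_tendsto_zero]
    refine squeeze_zero' (Eventually.of_forall fun _ => norm_nonneg _) ?_ hε
    filter_upwards [hgood, self_mem_nhdsWithin] with ρ h1 hρ
    obtain ⟨k1, k2, k3⟩ := hSν ρ hρ
    obtain ⟨_, k4, _⟩ := k3 hρ h1
    have hNpos : 0 < (particleNumber ρ : ℝ) :=
      (numberWidth_pos (gapRatio_pos hρ h1.2.1)).trans h1.2.2.2
    rw [Real.norm_eq_abs]
    exact abs_finsum_mul_gibbs_sub_le hρ _ _ k1 k2 fun α hα =>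
      abs_pairNumber_div_sub_le hρ (k2 α hα) hNpos (k4 α hα).1 (k4 α hα).2
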